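/- **Setting.** Let $d\ge 1$, $\mathcal V\subseteq\mathbb R^d$, let $\theta:\mathbb R^d\to\mathbb R$ be a bound-generating function with estimators $\widehat\theta_n$ and precision estimates $s_n$, let $V_0=\{v\in\mathcal V:\theta(v)\le\theta(v')\ \forall v'\in\mathcal V\}$, and let $V_0\subseteq V\subseteq\mathcal V$ with Lebesgue measure $\mathrm{mes}(V)>0$. On a probability space let $V_1,V_2,\dots$ be i.i.d. $\mathbb R^d$-valued with density $f_V$. Let $K:\mathbb R\to\mathbb R$, $\mathbf K(u)=\prod_{i=1}^d K(u_i)$, $h_n>0$, and let $\sigma\ge0$ be a function on $\mathbb R^d$. Put $$w_n(v)=\left(\frac{\sigma(V_i)\,\mathbf K[h_n^{-1}(v-V_i)]}{(nh_n^d)^{1/2}f_V(v)}\right)_{i=1}^n,\qquad \alpha_n(v)=\frac{w_n(v)}{\|w_n(v)\|},\qquad Z_n'(v)=\alpha_n(v)'U_n ,$$ where $U_n$ is a random vector in $\mathbb R^n$. For $\lambda=-\int KK''/\int K^2$ let $a_n(V)$ be the largest solution $a$ of $$\mathrm{mes}(V)\,h_n^{-d}\lambda^{d/2}(2\pi)^{-(d+1)/2}a^{d-1}e^{-a^2/2}=1$$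 (it exists for large $n$; any convention is used otherwise). **Condition K.** (i) $K$ is not identically zero, has compact support and is continuously differentiable, and $K'$ is absolutely continuous; $h_n\to0$ and $\log n/(nh_n^d)^{1/2}\to0$; on some $\eta$-neighbourhood of $\mathcal V$ ($\eta>0$), $\sigma^2$ is uniformly continuous, bounded and bounded away from zero, and $f_V$ is bounded away from zero and differentiable with bounded derivative. (ii) Conditionally on $(V_1,\dots,V_n)$, $U_n\sim N(0,I_n)$, and, as processes indexed by $v\in\mathcal V$, $$\frac{(nh_n^d)^{1/2}[\widehat\theta_n(v)-\theta(v)]}{\|w_n(v)\|}=_d Z_n'(v)+R_n(v),\qquad \sup_{v\in\mathcal V}|R_n(v)|=o_p(a_n(V)^{-1}).$$ (iii) $s_n(v)=(nh_n^d)^{-1/2}\|w_n(v)\|(1+o_p(1))$ uniformly in $v\in\mathcal V$. **Condition N.2** (for random sets $\widehat V_n\subseteq\mathcal V$, constants $r_n\ge0$, and normalizing constants $a_n,b_n,\widehat a_n,\widehat b_n$): if $P(V\subseteq\widehat V_n)\to1$, $r_n\to0$ and the Hausdorff distance satisfies $d_H(\widehat V_n,V)= O_p(r_n)$, then $$\widehat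 a_n\Big(\sup_{v\in\widehat V_n}Z_n'(v)-\widehat b_n\Big)-a_n\Big(\sup_{v\in V}Z_n'(v)-b_n\Big)\to_p0 .$$ **Lemma.** Assume Condition K and $\mathrm{mes}(V)>0$. (1) For all $(\widehat V_n)$ and $(r_n)$, with $a_n=b_n=a_n(V)$ and $\widehat a_n=\widehat b_n=a_n(\widehat V_n)$, Condition N.2 holds if $$a_n(\widehat V_n)^2-a_n(V)^2\to_p0\qquad\text{and}\qquad a_n(V)\cdot r_n\cdot\sup_{v\in\mathcal V}\|\nabla\alpha_n(v)\|\to_p0 .$$ (2) $\sup_{v\in\mathcal V}\|\nabla\alpha_n(v)\|=O_p(h_n^{-1})$. Here $\|\nabla\alpha_n(v)\|$ is the operator norm, read as $+\infty$ at points where $\alpha_n$ is not differentiable. -/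

import Mathlib

open MeasureTheory ProbabilityTheory Filter Topology Set
open scoped ENNReal NNReal

noncomputable section

namespace KernelBounds

/-! ### Stochastic orders for `[0, ∞]`-valued random quantities

Probabilities of possibly non-measurable events are outer probabilities. -/

section StochasticOrders

variable {Ω : Type*} [MeasurableSpace Ω]

/-- `X_n →_p 0` for `[0, ∞]`-valued quantities. -/
def TendsToZeroInProb (P : Measure Ω) (X : ℕ → Ω → ℝ≥0∞) : Prop :=
  ∀ ε : ℝ≥0∞, 0 < ε → Tendsto (fun n => P {ω | ε ≤ X n ω}) atTop (𝓝 0)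

/-- `X_n = O_p(r_n)` for `[0, ∞]`-valued quantities and nonnegative constants `r_n`. -/
def IsBigOInProb (P : Measure Ω) (X : ℕ → Ω → ℝ≥0∞) (r : ℕ → ℝ) : Prop :=
  ∀ ε : ℝ≥0∞, 0 < ε → ∃ M : ℝ≥0, ∀ᶠ n in atTop,
    P {ω | (M : ℝ≥0∞) * ENNReal.ofReal (r n) < X n ω} ≤ ε

end StochasticOrders

/-! ### Superset estimators and insensitivity of the supremum -/

section Insensitivity

variable {Ω : Type*} [MeasurableSpace Ω] {E : Type*} [PseudoEMetricSpace E]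

/-- The argmin set of the bound-generating function `θ` over `𝓥`. -/
def argminSet (𝓥 : Set E) (θ : E → ℝ) : Set E := {v | v ∈ 𝓥 ∧ ∀ v' ∈ 𝓥, θ v ≤ θ v'}

/-- `Vhat` is a sequence of data-dependent subsets of `𝓥` that contain `V` with probability
approaching one and converge to `V` in Hausdorff distance at the rate `r`, where `r → 0`. -/
structure SupersetEstimator (P : Measure Ω) (𝓥 V : Set E) (Vhat : ℕ → Ω → Set E)
    (r : ℕ → ℝ) : Prop where
  subset : ∀ n ω, Vhat n ω ⊆ 𝓥
  contains : Tendsto (fun n => P {ω | ¬ V ⊆ Vhat n ω}) atTop (𝓝 0)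
  rate_nonneg : ∀ n, 0 ≤ r n
  rate_tendsto : Tendsto r atTop (𝓝 0)
  rate : IsBigOInProb P (fun n ω => Metric.hausdorffEDist (Vhat n ω) V) r

/-- Condition C.2 for a process `Z`: for the superset estimator `Vhat` of `V` with rate `r`,
`â_n (sup_{v ∈ V̂} Z_n(v) - b̂_n) - a_n (sup_{v ∈ V} Z_n(v) - b_n) →_p 0`. -/
def ConditionC2 (P : Measure Ω) (𝓥 V : Set E) (Vhat : ℕ → Ω → Set E) (r : ℕ → ℝ)
    (Z : ℕ → Ω → E → ℝ) (a b : ℕ → ℝ) (ahat bhat : ℕ → Ω → ℝ) : Prop :=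
  SupersetEstimator P 𝓥 V Vhat r →
    TendstoInMeasure P
      (fun n ω => ahat n ω * (sSup (Z n ω '' Vhat n ω) - bhat n ω)
        - a n * (sSup (Z n ω '' V) - b n))
      atTop (fun _ => 0)

end Insensitivity

/-! ### Kernel-type estimators -/

/-- The objects attached to a kernel-type estimator of a bound-generating function on `ℝ^d`.
No property is assumed here; see `ConditionK`. The `i`-th observation of the regressor is
`X (i - 1)`. -/
structure KernelData (Ω : Type*) (d : ℕ) where
  /-- the set over which the bound-generating function is minimised -/
  𝓥 : Set (EuclideanSpace ℝ (Fin d))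
  /-- the bound-generating function -/
  θ : EuclideanSpace ℝ (Fin d) → ℝ
  /-- its estimator -/
  θhat : ℕ → Ω → EuclideanSpace ℝ (Fin d) → ℝ
  /-- the precision (standard error) of the estimator -/
  s : ℕ → Ω → EuclideanSpace ℝ (Fin d) → ℝ
  /-- the univariate kernel -/
  K : ℝ → ℝ
  /-- the bandwidth -/
  h : ℕ → ℝ
  /-- the conditional standard deviation -/
  σ : EuclideanSpace ℝ (Fin d) → ℝ
  /-- the density of the regressors -/
  f : EuclideanSpace ℝ (Fin d) → ℝ
  /-- the regressors -/
  X : ℕ → Ω → EuclideanSpace ℝ (Fin d)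
  /-- the Gaussian vectors of the strong approximation -/
  U : (n : ℕ) → Ω → EuclideanSpace ℝ (Fin n)

namespace KernelData

variable {Ω : Type*} {d : ℕ} (D : KernelData Ω d)

/-- The product kernel `𝐊(u) = ∏ i, K(u_i)`. -/
def prodKernel (u : EuclideanSpace ℝ (Fin d)) : ℝ := ∏ i, D.K (u i)

/-- The vector `w_n(v)`, with entries `σ(V_i) 𝐊[(v - V_i)/h_n] / ((n h_n^d)^{1/2} f_V(v))`. -/
def w (n : ℕ) (ω : Ω) (v : EuclideanSpace ℝ (Fin d)) : EuclideanSpace ℝ (Fin n) :=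
  WithLp.toLp 2 fun i : Fin n =>
    D.σ (D.X i ω) * D.prodKernel ((D.h n)⁻¹ • (v - D.X i ω))
      / (Real.sqrt (n * D.h n ^ d) * D.f v)

/-- `α_n(v) = w_n(v) / ‖w_n(v)‖`. -/
def alpha (n : ℕ) (ω : Ω) (v : EuclideanSpace ℝ (Fin d)) : EuclideanSpace ℝ (Fin n) :=
  ‖D.w n ω v‖⁻¹ • D.w n ω v

/-- The penultimate process `Z'_n(v) = w_n(v)'U_n / ‖w_n(v)‖`. -/
def Z' (n : ℕ) (ω : Ω) (v : EuclideanSpace ℝ (Fin d)) : ℝ :=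
  inner ℝ (D.alpha n ω v) (D.U n ω)

open Classical in
/-- `‖∇α_n(v)‖` (operator norm), with the value `∞` where `α_n` is not differentiable. -/
def gradNorm (n : ℕ) (ω : Ω) (v : EuclideanSpace ℝ (Fin d)) : ℝ≥0∞ :=
  if DifferentiableAt ℝ (D.alpha n ω) v then ‖fderiv ℝ (D.alpha n ω) v‖ₑ else ⊤

/-- `sup_{v ∈ 𝓥} ‖∇α_n(v)‖`. -/
def supGradNorm (n : ℕ) (ω : Ω) : ℝ≥0∞ := ⨆ v ∈ D.𝓥, D.gradNorm n ω v

/-- `λ = - ∫ K(u) K''(u) du / ∫ K(u)² du`. -/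
def lam : ℝ := (- ∫ u, D.K u * deriv (deriv D.K) u) / ∫ u, D.K u ^ 2

/-- `a_n(V)`: the largest solution `a` of
`mes(V) h_n^{-d} λ^{d/2} (2π)^{-(d+1)/2} a^{d-1} exp(-a²/2) = 1`.
The solution set is closed and bounded above, and nonempty for large `n`
when `d ≥ 1`, `mes(V) > 0`, `λ > 0` and `h_n → 0`. -/
def a (n : ℕ) (V : Set (EuclideanSpace ℝ (Fin d))) : ℝ :=
  sSup {x : ℝ | volume.real V * (D.h n ^ d)⁻¹ * D.lam ^ ((d : ℝ) / 2)
    * (2 * Real.pi) ^ (-((d : ℝ) + 1) / 2) * x ^ (d - 1) * Real.exp (-x ^ 2 / 2) = 1}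

/-- Conditions on the kernel, the bandwidth, the design and the conditional variance.
The kernel is not identically zero, compactly supported and continuously differentiable (hence
it is bounded with a bounded derivative), with `K'` absolutely continuous so that `K''` in `λ`
makes sense. The conditions on `σ²` and `f_V` are required on a neighbourhood of `𝓥` only. -/
structure Regular [MeasurableSpace Ω] (P : Measure Ω) : Prop where
  kernel_ne_zero : ∃ u, D.K u ≠ 0
  kernel_compact : HasCompactSupport D.K
  kernel_smooth : ContDiff ℝ 1 D.K
  kernel_ac : ∀ x y, AbsolutelyContinuousOnInterval (deriv D.K) x y
  bandwidth_pos : ∀ n, 0 < D.h n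
  bandwidth_tendsto : Tendsto D.h atTop (𝓝 0)
  bandwidth_rate :
    Tendsto (fun n : ℕ => Real.log n / Real.sqrt (n * D.h n ^ d)) atTop (𝓝 0)
  design_measurable : ∀ i, Measurable (D.X i)
  design_indep : iIndepFun D.X P
  density_measurable : Measurable D.f
  density_nonneg : ∀ x, 0 ≤ D.f x
  design_law : ∀ i, P.map (D.X i) = volume.withDensity fun x => ENNReal.ofReal (D.f x)
  sigma_measurable : Measurable D.σ
  sigma_nonneg : ∀ x, 0 ≤ D.σ x
  local_regularity : ∃ η > 0, ∃ c > 0, ∃ C : ℝ,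
    UniformContinuousOn (fun x => D.σ x ^ 2) (Metric.thickening η D.𝓥) ∧
    DifferentiableOn ℝ D.f (Metric.thickening η D.𝓥) ∧
    ∀ x ∈ Metric.thickening η D.𝓥,
      c ≤ D.σ x ^ 2 ∧ D.σ x ^ 2 ≤ C ∧ c ≤ D.f x ∧ ‖fderiv ℝ D.f x‖ ≤ C

/-- Condition K.1: the regularity conditions, and the linearization and strong approximation
`(n h_n^d)^{1/2} (θ̂(v) - θ(v)) / ‖w_n(v)‖ =_d w_n(v)'U_n / ‖w_n(v)‖ + R_n(v)`
as processes on `𝓥`, where `U_n ~ N(0, I_n)` conditionally on the regressors and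
`sup_{v ∈ 𝓥} |R_n(v)| = o_p(a_n(V)⁻¹)`. -/
structure ConditionK1 [MeasurableSpace Ω] (P : Measure Ω) [IsFiniteMeasure P]
    (V : Set (EuclideanSpace ℝ (Fin d))) : Prop where
  regular : D.Regular P
  gauss_measurable : ∀ n, Measurable (D.U n)
  gauss_law : ∀ n,
    condDistrib (D.U n) (fun ω (i : Fin n) => D.X i ω) P
      =ᵐ[P.map fun ω (i : Fin n) => D.X i ω]
        fun _ => stdGaussian (EuclideanSpace ℝ (Fin n))
  strong_approx : ∃ R : ℕ → Ω → EuclideanSpace ℝ (Fin d) → ℝ,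
    (∀ n, 1 ≤ n → IdentDistrib
      (fun ω (v : D.𝓥) =>
        Real.sqrt (n * D.h n ^ d) * (D.θhat n ω v - D.θ v) / ‖D.w n ω v‖)
      (fun ω (v : D.𝓥) => D.Z' n ω v + R n ω v) P P) ∧
    TendsToZeroInProb P
      (fun n ω => ENNReal.ofReal (D.a n V) * ⨆ v ∈ D.𝓥, ‖R n ω v‖ₑ)

/-- Condition K.2: `s(v) = (n h_n^d)^{-1/2} ‖w_n(v)‖ (1 + o_p(1))` uniformly in `v ∈ 𝓥`. -/
def ConditionK2 [MeasurableSpace Ω] (P : Measure Ω) : Prop :=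
  TendsToZeroInProb P fun n ω =>
    ⨆ v ∈ D.𝓥, ‖D.s n ω v / (‖D.w n ω v‖ / Real.sqrt (n * D.h n ^ d)) - 1‖ₑ

/-- Condition K. -/
structure ConditionK [MeasurableSpace Ω] (P : Measure Ω) [IsFiniteMeasure P]
    (V : Set (EuclideanSpace ℝ (Fin d))) : Prop where
  k1 : D.ConditionK1 P V
  k2 : D.ConditionK2 P

/-- Condition N.2: Condition C.2 for the penultimate process `Z'_n`. -/
def ConditionN2 [MeasurableSpace Ω] (P : Measure Ω) (V : Set (EuclideanSpace ℝ (Fin d)))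
    (Vhat : ℕ → Ω → Set (EuclideanSpace ℝ (Fin d))) (r : ℕ → ℝ)
    (a b : ℕ → ℝ) (ahat bhat : ℕ → Ω → ℝ) : Prop :=
  ConditionC2 P D.𝓥 V Vhat r D.Z' a b ahat bhat

end KernelData

end KernelBounds

end

namespace KernelBounds

/-! ### Tail bounds for the standard normal law. -/

section GaussianTails

/-! Call a design good when the relevant balls of radius of order h_n near 𝓥 contain of order n
h_n^d design points. On a good design the curve v ↦ α_n(v) in the unit sphere is bi-Lipschitz at the
scale of the bandwidth: its increments are at most C‖v - w‖/h_n, and at least c‖v - w‖/h_n when ‖v -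
w‖ is below a small multiple of h_n (`GoodDesign.norm_avec_sub_le`, `GoodDesign.le_norm_avec_sub`).
Chernoff bounds over a finite net make the design good with probability tending to one
(`nonempty_designSetup`). The upper estimate gives claim (2). The lower one turns the gradient
hypothesis of claim (1) into the deterministic statement a_n(V) r_n / h_n → 0
(`DesignSetup.tendsto_of_supGradNorm`).

Write a for a_n(V) and h for h_n. Given the design, Z'_n is a Gaussian process of unit variance, and
the equation for a says that a grid of mesh h/a in V exceeds the level a a bounded number of times
on average. A second moment argument on such a grid then shows that Z'_n reaches u = a - k/a
somewhere in V, with probability close to one for large k (`exists_finset_forall_lt_le`).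

Next choose δ of order r_n + h/a², so that aδ/h → 0. On a cube of side of order δ the increments
have standard deviation of order δ/h, much smaller than 1/a. Projected orthogonally to the value at
a corner of the cube, they are independent of that value. By dyadic chaining, the probability that
the process reaches u on the cube and also oscillates by more than 3m, with m a small multiple of
1/a, is essentially a product: the Gaussian tail at u times exp(-c(h/(aδ))²)
(`stdGaussian_badSet_le`). There are of order δ^{-d} cubes, and by the equation for a the sum is of
order (h/(aδ))^d exp(-c(h/(aδ))²), which tends to zero.

Hence, with high probability, a point of V̂ either lies below some value taken on V, or has a point
of V within δ at which the process is lower by at most 3m. So the two suprema differ by a small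
multiple of 1/a, and replacing the constants a by a_n(V̂) costs a multiple of |a_n(V̂)² - a²|
(`abs_recentred_sub_le`). No extreme value limit theorem is needed. -/

theorem gaussianReal_real_Ici_eq (t : ℝ) :
    (gaussianReal 0 1).real (Ici t)
      = (√(2 * Real.pi))⁻¹ * ∫ x in Ioi t, Real.exp (-x ^ 2 / 2) := by
  rw [measureReal_def, gaussianReal_apply_eq_integral 0 one_ne_zero, ENNReal.toReal_ofReal]
  · rw [integral_Ici_eq_integral_Ioi, ← integral_const_mul]
    simp [gaussianPDFReal]
  · exact integral_nonneg fun x => gaussianPDFReal_nonneg _ _ _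

theorem integrable_exp_neg_sq_half : Integrable fun x : ℝ => Real.exp (-x ^ 2 / 2) := by
  have := integrable_exp_neg_mul_sq (b := 1 / 2) (by norm_num)
  refine this.congr (ae_of_all _ fun x => ?_)
  dsimp only
  ring_nf

theorem inv_sqrt_two_pi_le_one : (√(2 * Real.pi))⁻¹ ≤ 1 := by
  apply inv_le_one_of_one_le₀
  rw [Real.one_le_sqrt]
  nlinarith [Real.pi_gt_three]

/-- From (x - t)² ≥ 0, the density is dominated by an exponential in x, which integrates in closed
form. -/
theorem gaussianReal_real_Ici_le {t : ℝ} (ht : 0 < t) :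
    (gaussianReal 0 1).real (Ici t) ≤ Real.exp (-t ^ 2 / 2) / t := by
  rw [gaussianReal_real_Ici_eq]
  have hint : IntegrableOn (fun x => Real.exp (t ^ 2 / 2) * Real.exp (-t * x)) (Ioi t) :=
    (integrableOn_exp_mul_Ioi (neg_lt_zero.2 ht) t).const_mul _
  have h1 : ∫ x in Ioi t, Real.exp (-x ^ 2 / 2) ≤ Real.exp (-t ^ 2 / 2) / t := by
    calc ∫ x in Ioi t, Real.exp (-x ^ 2 / 2)
        ≤ ∫ x in Ioi t, Real.exp (t ^ 2 / 2) * Real.exp (-t * x) := by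
          apply setIntegral_mono integrable_exp_neg_sq_half.integrableOn hint
          intro x
          dsimp only
          rw [← Real.exp_add]
          gcongr
          nlinarith [sq_nonneg (x - t)]
      _ = Real.exp (-t ^ 2 / 2) / t := by
          rw [integral_const_mul, integral_exp_mul_Ioi (neg_lt_zero.2 ht), neg_div_neg_eq,
            mul_div_assoc', ← Real.exp_add]
          ring_nf
  have h0 : 0 ≤ Real.exp (-t ^ 2 / 2) / t := by positivity
  calc _ ≤ (√(2 * Real.pi))⁻¹ * (Real.exp (-t ^ 2 / 2) / t) := by gcongr
    _ ≤ 1 * (Real.exp (-t ^ 2 / 2) / t) := by gcongr; exact inv_sqrt_two_pi_le_one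
    _ = _ := one_mul _

/-- The constant in the lower Mills bound. -/
noncomputable def millsConst : ℝ := (√(2 * Real.pi))⁻¹ * Real.exp (-2)

theorem millsConst_pos : 0 < millsConst := by
  unfold millsConst
  positivity

/-- Keep only the interval of length 1/t to the right of t: there x² ≤ t² + 3, so the integrand
stays above e^{-2} times its value at t. -/
theorem le_gaussianReal_real_Ici {t : ℝ} (ht : 1 ≤ t) :
    millsConst * (Real.exp (-t ^ 2 / 2) / t) ≤ (gaussianReal 0 1).real (Ici t) := by
  rw [gaussianReal_real_Ici_eq, millsConst, mul_assoc]
  have ht0 : 0 < t := by linarith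
  gcongr
  have h1 : ∫ x in Ioc t (t + 1 / t), Real.exp (-2) * Real.exp (-t ^ 2 / 2)
      ≤ ∫ x in Ioc t (t + 1 / t), Real.exp (-x ^ 2 / 2) := by
    apply setIntegral_mono_on (integrableOn_const (by simp)) integrable_exp_neg_sq_half.integrableOn
      measurableSet_Ioc
    intro x hx
    rw [← Real.exp_add]
    gcongr
    have h2 : x ^ 2 ≤ (t + 1 / t) ^ 2 := by
      apply pow_le_pow_left₀ (by linarith [hx.1]) hx.2
    have h3 : (t + 1 / t) ^ 2 = t ^ 2 + 2 + (1 / t) ^ 2 := by field_simp; ring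
    have h4 : (1 / t) ^ 2 ≤ 1 := by
      rw [div_pow, one_pow, div_le_one (by positivity)]
      nlinarith
    linarith
  have h2 : ∫ x in Ioc t (t + 1 / t), Real.exp (-x ^ 2 / 2)
      ≤ ∫ x in Ioi t, Real.exp (-x ^ 2 / 2) := by
    apply setIntegral_mono_set integrable_exp_neg_sq_half.integrableOn
    · exact ae_of_all _ fun x => (Real.exp_pos _).le
    · exact LE.le.eventuallyLE Ioc_subset_Ioi_self
  refine le_trans (le_of_eq ?_) (h1.trans h2)
  rw [setIntegral_const, measureReal_def, Real.volume_Ioc, ENNReal.toReal_ofReal (by simp; linarith)]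
  simp
  ring

theorem gaussianReal_real_Ici_le_exp {t : ℝ} (ht : 0 ≤ t) :
    (gaussianReal 0 1).real (Ici t) ≤ Real.exp (-t ^ 2 / 2) := by
  have h := measure_ge_le_exp_mul_mgf (μ := gaussianReal 0 1) (X := id) (t := t) t ht
    (integrable_exp_mul_gaussianReal t)
  rw [mgf_id_gaussianReal, ← Real.exp_add] at h
  refine h.trans (le_of_eq ?_)
  congr 1
  simp
  ring

/-- Shifted tail bound, uniform in the shift. -/
theorem gaussianReal_real_Ici_sub_le {t y : ℝ} (ht : 1 ≤ t) (hy : 0 ≤ y) :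
    (gaussianReal 0 1).real (Ici (t - y)) ≤ 2 / t * Real.exp (-t ^ 2 / 2) * Real.exp (2 * t * y) := by
  have ht0 : 0 < t := by linarith
  rcases le_or_gt y (t / 2) with h | h
  -- Here t - y ≥ t/2, so the tail bound applies and 1/(t - y) ≤ 2/t.
  · refine (gaussianReal_real_Ici_le (by linarith)).trans ?_
    rw [mul_assoc, ← Real.exp_add, div_eq_inv_mul]
    gcongr
    · rw [inv_eq_one_div, div_le_div_iff₀ (by linarith) ht0]
      linarith
    · nlinarith [mul_nonneg hy ht0.le]
  -- Here the right side is at least (2/t)(1 + t²/2) ≥ 1, and the trivial bound is enough.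
  · refine measureReal_le_one.trans ?_
    rw [mul_assoc, ← Real.exp_add]
    have : 1 + t ^ 2 / 2 ≤ Real.exp (-t ^ 2 / 2 + 2 * t * y) := by
      refine le_trans ?_ (Real.exp_le_exp.2 (show t ^ 2 / 2 ≤ _ by nlinarith))
      linarith [Real.add_one_le_exp (t ^ 2 / 2)]
    calc (1 : ℝ) ≤ 2 / t * (1 + t ^ 2 / 2) := by
          rw [div_mul_eq_mul_div, le_div_iff₀ ht0]
          nlinarith [sq_nonneg (t - 1)]
      _ ≤ _ := by gcongr

end GaussianTails

/-! ### Linear projections of a standard Gaussian vector. -/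

section StdGaussian

variable {E : Type*} [NormedAddCommGroup E] [InnerProductSpace ℝ E] [FiniteDimensional ℝ E]
  [MeasurableSpace E] [BorelSpace E]

theorem stdGaussian_map_inner (a : E) :
    (stdGaussian E).map (fun u => inner ℝ a u) = gaussianReal 0 (‖a‖₊ ^ 2) := by
  have h := IsGaussian.map_eq_gaussianReal (μ := stdGaussian E) (innerSL ℝ a)
  rw [integral_strongDual_stdGaussian, variance_dual_stdGaussian, innerSL_apply_norm] at h
  convert h using 2
  · rfl
  rw [Real.toNNReal_pow (norm_nonneg a), norm_toNNReal]

theorem stdGaussian_real_le_inner {a : E} (ha : ‖a‖ = 1) (t : ℝ) :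
    (stdGaussian E).real {u | t ≤ inner ℝ a u} = (gaussianReal 0 1).real (Ici t) := by
  have h : (gaussianReal 0 1) = (stdGaussian E).map (fun u => inner ℝ a u) := by
    rw [stdGaussian_map_inner]
    congr
    ext
    simp [ha]
  rw [h, map_measureReal_apply (by fun_prop) measurableSet_Ici]
  rfl

theorem stdGaussian_real_le_inner_scaled {a : E} (ha : a ≠ 0) (t : ℝ) :
    (stdGaussian E).real {u | t ≤ inner ℝ a u} = (gaussianReal 0 1).real (Ici (t / ‖a‖)) := by
  have hn : 0 < ‖a‖ := norm_pos_iff.2 ha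
  rw [← stdGaussian_real_le_inner (a := ‖a‖⁻¹ • a) (by rw [norm_smul, norm_inv, norm_norm]; field_simp)]
  congr 1
  ext u
  simp only [mem_ofPred_eq, real_inner_smul_left]
  rw [div_le_iff₀ hn, mul_comm, ← mul_assoc, mul_inv_cancel₀ hn.ne', one_mul]

theorem stdGaussian_real_le_abs_inner_le {b : E} {s t : ℝ} (hb : ‖b‖ ≤ s) (ht : 0 < t) :
    (stdGaussian E).real {u | t ≤ |inner ℝ b u|} ≤ 2 * Real.exp (-(t / s) ^ 2 / 2) := by
  rcases eq_or_ne b 0 with rfl | hb0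
  · have : {u : E | t ≤ |inner ℝ (0 : E) u|} = ∅ := by
      ext u
      simp [ht]
    rw [this]
    simp
    positivity
  have key : ∀ c : E, c ≠ 0 → ‖c‖ ≤ s →
      (stdGaussian E).real {u | t ≤ inner ℝ c u} ≤ Real.exp (-(t / s) ^ 2 / 2) := by
    intro c hc hcs
    have hn : 0 < ‖c‖ := norm_pos_iff.2 hc
    rw [stdGaussian_real_le_inner_scaled hc]
    refine (gaussianReal_real_Ici_le_exp (by positivity)).trans ?_
    have : t / s ≤ t / ‖c‖ := by gcongr
    have h0 : 0 ≤ t / s := div_nonneg ht.le (hn.le.trans hcs)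
    gcongr
  have hsub : {u : E | t ≤ |inner ℝ b u|} ⊆ {u | t ≤ inner ℝ b u} ∪ {u | t ≤ inner ℝ (-b) u} := by
    intro u hu
    simp only [mem_ofPred_eq, mem_union, inner_neg_left] at hu ⊢
    exact le_abs.1 hu
  calc _ ≤ _ := measureReal_mono hsub
    _ ≤ _ := measureReal_union_le _ _
    _ ≤ _ := by
      rw [two_mul]
      exact add_le_add (key b hb0 hb) (key (-b) (neg_ne_zero.2 hb0) (by rwa [norm_neg]))

/-- If both projections reach t, so does the projection on the midpoint of a and b. Its squared norm
is 1 - ‖a - b‖²/4, and this shortening is what produces the extra exponential factor. -/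
theorem stdGaussian_real_le_inner_both {a b : E} (ha : ‖a‖ = 1) (hb : ‖b‖ = 1) {t : ℝ}
    (ht : 0 < t) :
    (stdGaussian E).real {u | t ≤ inner ℝ a u ∧ t ≤ inner ℝ b u}
      ≤ Real.exp (-t ^ 2 / 2) / t * Real.exp (-(t ^ 2 * ‖a - b‖ ^ 2 / 8)) := by
  set c : E := (2 : ℝ)⁻¹ • (a + b) with hc
  have hsub : {u : E | t ≤ inner ℝ a u ∧ t ≤ inner ℝ b u} ⊆ {u | t ≤ inner ℝ c u} := by
    intro u hu
    simp only [mem_ofPred_eq, hc, real_inner_smul_left, inner_add_left] at hu ⊢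
    linarith [hu.1, hu.2]
  refine (measureReal_mono hsub).trans ?_
  rcases eq_or_ne c 0 with h0 | h0
  · have : {u : E | t ≤ inner ℝ c u} = ∅ := by
      ext u
      simp [h0, ht]
    rw [this]
    simp
    positivity
  have hn : 0 < ‖c‖ := norm_pos_iff.2 h0
  have hsq : ‖c‖ ^ 2 = 1 - ‖a - b‖ ^ 2 / 4 := by
    have hp := parallelogram_law_with_norm ℝ a b
    rw [ha, hb] at hp
    rw [hc, norm_smul]
    norm_num
    nlinarith
  have hc1 : ‖c‖ ≤ 1 := by nlinarith [sq_nonneg ‖a - b‖]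
  rw [stdGaussian_real_le_inner_scaled h0]
  refine (gaussianReal_real_Ici_le (by positivity)).trans ?_
  have h1 : 1 + ‖a - b‖ ^ 2 / 4 ≤ 1 / ‖c‖ ^ 2 := by
    rw [le_div_iff₀ (by positivity), hsq]
    nlinarith [sq_nonneg (‖a - b‖ ^ 2)]
  have h2 : Real.exp (-(t / ‖c‖) ^ 2 / 2)
      ≤ Real.exp (-t ^ 2 / 2) * Real.exp (-(t ^ 2 * ‖a - b‖ ^ 2 / 8)) := by
    rw [← Real.exp_add]
    gcongr
    have : (t / ‖c‖) ^ 2 = t ^ 2 * (1 / ‖c‖ ^ 2) := by ring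
    rw [this]
    nlinarith [mul_le_mul_of_nonneg_left h1 (sq_nonneg t)]
  calc _ ≤ (Real.exp (-t ^ 2 / 2) * Real.exp (-(t ^ 2 * ‖a - b‖ ^ 2 / 8))) / (t / ‖c‖) := by gcongr
    _ ≤ (Real.exp (-t ^ 2 / 2) * Real.exp (-(t ^ 2 * ‖a - b‖ ^ 2 / 8))) / t := by
      gcongr
      rw [le_div_iff₀ hn]
      nlinarith
    _ = _ := by ring

theorem indepFun_inner_of_orthogonal {a b : E} (hab : inner ℝ a b = 0) :
    IndepFun (fun u => inner ℝ a u) (fun u => inner ℝ b u) (stdGaussian E) := by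
  apply HasGaussianLaw.indepFun_of_covariance_eq_zero
  · have h := (IsGaussian.hasGaussianLaw_id (μ := stdGaussian E)).map
      ((innerSL ℝ a).prod (innerSL ℝ b))
    exact h
  · have h := covarianceBilin_apply_eq_cov (μ := stdGaussian E) IsGaussian.memLp_two_id a b
    rw [covarianceBilin_stdGaussian, innerSL_apply_apply, hab] at h
    exact h.symm

theorem stdGaussian_real_inter_of_orthogonal {a b : E} (hab : inner ℝ a b = 0) {A B : Set ℝ}
    (hA : MeasurableSet A) (hB : MeasurableSet B) :
    (stdGaussian E).real ({u | inner ℝ a u ∈ A} ∩ {u | inner ℝ b u ∈ B})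
      = (stdGaussian E).real {u | inner ℝ a u ∈ A} * (stdGaussian E).real {u | inner ℝ b u ∈ B} := by
  have h := (indepFun_inner_of_orthogonal hab).measure_inter_preimage_eq_mul A B hA hB
  simp only [measureReal_def, ← ENNReal.toReal_mul]
  congr 1

end StdGaussian

/-! ### The second moment method. -/

section SecondMoment

/-- Second moment method: if the events `A i` have probability `p` and their positive correlations
are summable, then it is unlikely that none of them occurs. -/
theorem measureReal_forall_notMem_le {Ω ι : Type*} [MeasurableSpace Ω] {μ : Measure Ω}
    [IsProbabilityMeasure μ] {S : Finset ι} (hS : S.Nonempty) {A : ι → Set Ω}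
    (hA : ∀ i ∈ S, MeasurableSet (A i)) {p C : ℝ} (hp : 0 < p)
    (hAp : ∀ i ∈ S, μ.real (A i) = p)
    (hC : ∀ i ∈ S, ∑ j ∈ S, (μ.real (A i ∩ A j) - p ^ 2) ≤ C * p) :
    μ.real {ω | ∀ i ∈ S, ω ∉ A i} ≤ C / (S.card * p) := by
  classical
  set m : ℝ := (S.card : ℝ) with hm
  have hm0 : 0 < m := by rw [hm]; exact_mod_cast hS.card_pos
  set Y : Ω → ℝ := fun ω => ∑ i ∈ S, (A i).indicator 1 ω with hY
  have hint1 : ∀ i ∈ S, Integrable ((A i).indicator (1 : Ω → ℝ)) μ := fun i hi =>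
    (integrable_const (1 : ℝ)).indicator (hA i hi)
  have hint2 : ∀ i ∈ S, ∀ j ∈ S, Integrable ((A i ∩ A j).indicator (1 : Ω → ℝ)) μ :=
    fun i hi j hj => (integrable_const (1 : ℝ)).indicator ((hA i hi).inter (hA j hj))
  have hYsq : ∀ ω, (Y ω - m * p) ^ 2
      = ∑ i ∈ S, ∑ j ∈ S, (A i ∩ A j).indicator (1 : Ω → ℝ) ω
        - 2 * (m * p) * (∑ i ∈ S, (A i).indicator (1 : Ω → ℝ) ω) + (m * p) ^ 2 := by
    intro ω
    have : ∑ i ∈ S, ∑ j ∈ S, (A i ∩ A j).indicator (1 : Ω → ℝ) ω = Y ω * Y ω := by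
      rw [hY, Finset.sum_mul_sum]
      refine Finset.sum_congr rfl fun i _ => Finset.sum_congr rfl fun j _ => ?_
      rw [Set.inter_indicator_one]
      rfl
    rw [this]
    ring
  have hi1 : Integrable (fun ω => ∑ i ∈ S, ∑ j ∈ S, (A i ∩ A j).indicator (1 : Ω → ℝ) ω) μ :=
    integrable_finsetSum _ fun i hi => integrable_finsetSum _ fun j hj => hint2 i hi j hj
  have hi2 : Integrable (fun ω => 2 * (m * p) * (∑ i ∈ S, (A i).indicator (1 : Ω → ℝ) ω)) μ :=
    (integrable_finsetSum _ fun i hi => hint1 i hi).const_mul _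
  have hi3 : Integrable (fun ω => ∑ i ∈ S, ∑ j ∈ S, (A i ∩ A j).indicator (1 : Ω → ℝ) ω
      - 2 * (m * p) * (∑ i ∈ S, (A i).indicator (1 : Ω → ℝ) ω)) μ := hi1.sub hi2
  have hvar : ∫ ω, (Y ω - m * p) ^ 2 ∂μ ≤ m * (C * p) := by
    simp_rw [hYsq]
    rw [integral_add hi3 (integrable_const _), integral_sub hi1 hi2,
      integral_const_mul, integral_finsetSum _ (fun i hi => hint1 i hi),
      integral_finsetSum _ (fun i hi => integrable_finsetSum _ fun j hj => hint2 i hi j hj)]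
    have e1 : ∑ i ∈ S, ∫ ω, (A i).indicator (1 : Ω → ℝ) ω ∂μ = m * p := by
      rw [Finset.sum_congr rfl (g := fun _ => p), Finset.sum_const, nsmul_eq_mul]
      intro i hi
      rw [integral_indicator_one (hA i hi), hAp i hi]
    have e2 : ∑ i ∈ S, ∫ ω, ∑ j ∈ S, (A i ∩ A j).indicator (1 : Ω → ℝ) ω ∂μ
        = ∑ i ∈ S, ∑ j ∈ S, μ.real (A i ∩ A j) := by
      refine Finset.sum_congr rfl fun i hi => ?_
      rw [integral_finsetSum _ (fun j hj => hint2 i hi j hj)]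
      refine Finset.sum_congr rfl fun j hj => ?_
      rw [integral_indicator_one ((hA i hi).inter (hA j hj))]
    have e3 : ∑ i ∈ S, ∑ j ∈ S, (μ.real (A i ∩ A j) - p ^ 2) ≤ m * (C * p) := by
      refine (Finset.sum_le_sum hC).trans (le_of_eq ?_)
      rw [Finset.sum_const, nsmul_eq_mul]
    simp only [Finset.sum_sub_distrib, Finset.sum_const, nsmul_eq_mul] at e3
    rw [e1, e2]
    simp only [integral_const, probReal_univ, smul_eq_mul, one_mul]
    nlinarith
  -- Chebyshev's inequality: if no event occurs, the count Y is 0, at distance m p from its mean.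
  have hmarkov := mul_meas_ge_le_integral_of_nonneg (μ := μ) (f := fun ω => (Y ω - m * p) ^ 2)
    (ae_of_all _ fun ω => sq_nonneg _)
    (by
      simp_rw [hYsq]
      exact hi3.add (integrable_const _)) ((m * p) ^ 2)
  have hsub : {ω | ∀ i ∈ S, ω ∉ A i} ⊆ {ω | (m * p) ^ 2 ≤ (Y ω - m * p) ^ 2} := by
    intro ω hω
    have : Y ω = 0 := Finset.sum_eq_zero fun i hi => Set.indicator_of_notMem (hω i hi) _
    simp [this]
  have hle := measureReal_mono (μ := μ) hsub
  rw [le_div_iff₀ (by positivity)]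
  have h3 : (m * p) ^ 2 * μ.real {ω | ∀ i ∈ S, ω ∉ A i} ≤ m * (C * p) :=
    (mul_le_mul_of_nonneg_left hle (by positivity)).trans (hmarkov.trans hvar)
  have hmp : 0 < m * p := by positivity
  refine le_of_mul_le_mul_left ?_ hmp
  linarith

/-- Lower bound for the maximum of a Gaussian family in which non-orthogonal pairs are
well separated on the scale `1 / t`. -/
theorem stdGaussian_real_forall_inner_lt_le {E ι : Type*} [NormedAddCommGroup E]
    [InnerProductSpace ℝ E] [FiniteDimensional ℝ E] [MeasurableSpace E] [BorelSpace E]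
    {S : Finset ι} (hS : S.Nonempty) {a : ι → E} (ha : ∀ i ∈ S, ‖a i‖ = 1) {t C : ℝ}
    (ht : 1 ≤ t) (w : ι → ι → ℝ) (hw0 : ∀ i ∈ S, ∀ j ∈ S, 0 ≤ w i j)
    (hw : ∀ i ∈ S, ∀ j ∈ S, inner ℝ (a i) (a j) ≠ 0 →
      Real.exp (-(t ^ 2 * ‖a i - a j‖ ^ 2 / 8)) ≤ w i j)
    (hC : ∀ i ∈ S, ∑ j ∈ S, w i j ≤ C) :
    (stdGaussian E).real {u | ∀ i ∈ S, inner ℝ (a i) u < t}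
      ≤ C / millsConst ^ 2 / (S.card * (Real.exp (-t ^ 2 / 2) / t)) := by
  have ht0 : 0 < t := by linarith
  set p := (gaussianReal 0 1).real (Ici t) with hp
  have hplow := le_gaussianReal_real_Ici ht
  have hq : 0 < Real.exp (-t ^ 2 / 2) / t := by positivity
  have hc := millsConst_pos
  have hp0 : 0 < p := lt_of_lt_of_le (by positivity) hplow
  have hC0 : 0 ≤ C := by
    obtain ⟨i, hi⟩ := hS
    exact (Finset.sum_nonneg fun j hj => hw0 i hi j hj).trans (hC i hi)
  have hm0 : (0 : ℝ) < S.card := by exact_mod_cast hS.card_pos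
  have key := measureReal_forall_notMem_le (μ := stdGaussian E) hS
    (A := fun i => {u | t ≤ inner ℝ (a i) u}) (p := p) (C := C / millsConst)
    (fun i _ => measurableSet_le measurable_const (by fun_prop)) hp0
    (fun i hi => stdGaussian_real_le_inner (ha i hi) t) ?_
  · have e : {u | ∀ i ∈ S, inner ℝ (a i) u < t}
        = {u | ∀ i ∈ S, u ∉ (fun i => {u | t ≤ inner ℝ (a i) u}) i} := by
      ext u
      simp
    rw [e]
    -- One factor `millsConst` comes from bounding the joint probabilities by p, the other from
    -- bounding p below.
    refine key.trans ?_
    rw [div_div, div_div]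
    apply div_le_div_of_nonneg_left hC0 (by positivity)
    calc _ = millsConst * (S.card * (millsConst * (Real.exp (-t ^ 2 / 2) / t))) := by ring
      _ ≤ _ := by gcongr
  · intro i hi
    have hle : ∀ j ∈ S, (stdGaussian E).real ({u | t ≤ inner ℝ (a i) u} ∩ {u | t ≤ inner ℝ (a j) u})
        - p ^ 2 ≤ w i j * (p / millsConst) := by
      intro j hj
      have hr : 0 ≤ w i j * (p / millsConst) := mul_nonneg (hw0 i hi j hj) (by positivity)
      -- Orthogonal vectors give independent events, which add nothing to the variance; the midpoint
      -- bound treats the other pairs, the diagonal included.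
      by_cases h0 : inner ℝ (a i) (a j) = 0
      · have := stdGaussian_real_inter_of_orthogonal h0 (measurableSet_Ici (a := t))
          (measurableSet_Ici (a := t))
        simp only [mem_Ici] at this
        rw [this, stdGaussian_real_le_inner (ha i hi), stdGaussian_real_le_inner (ha j hj), ← hp]
        nlinarith
      · have h1 := stdGaussian_real_le_inner_both (ha i hi) (ha j hj) ht0
        have h2 : Real.exp (-t ^ 2 / 2) / t ≤ p / millsConst := by
          rw [le_div_iff₀ hc]
          linarith
        calc _ ≤ (stdGaussian E).real {u | t ≤ inner ℝ (a i) u ∧ t ≤ inner ℝ (a j) u} := by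
              have : 0 ≤ p ^ 2 := sq_nonneg _
              have e : {u | t ≤ inner ℝ (a i) u} ∩ {u | t ≤ inner ℝ (a j) u}
                = {u | t ≤ inner ℝ (a i) u ∧ t ≤ inner ℝ (a j) u} := rfl
              rw [e]
              linarith
          _ ≤ _ := h1
          _ ≤ (p / millsConst) * w i j := by gcongr; exact hw i hi j hj h0
          _ = _ := mul_comm _ _
    calc _ ≤ ∑ j ∈ S, w i j * (p / millsConst) := Finset.sum_le_sum hle
      _ = (∑ j ∈ S, w i j) * (p / millsConst) := by rw [Finset.sum_mul]
      _ ≤ C * (p / millsConst) := by gcongr; exact hC i hi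
      _ = _ := by ring

end SecondMoment

/-! ### Separated sets, nets, and classes of cubes. -/

section Packing

/-- The volume of the Euclidean unit ball. -/
noncomputable def unitBallVol (d : ℕ) : ℝ :=
  volume.real (Metric.ball (0 : EuclideanSpace ℝ (Fin d)) 1)

variable {d : ℕ}

theorem unitBallVol_pos : 0 < unitBallVol d := by
  unfold unitBallVol
  rw [measureReal_def]
  exact ENNReal.toReal_pos (Metric.measure_ball_pos _ _ one_pos).ne' measure_ball_lt_top.ne

theorem volume_ball_eq (x : EuclideanSpace ℝ (Fin d)) {r : ℝ} (hr : 0 < r) :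
    volume (Metric.ball x r) = ENNReal.ofReal (r ^ d * unitBallVol d) := by
  rw [Measure.addHaar_ball_of_pos volume x hr, ENNReal.ofReal_mul (by positivity), unitBallVol,
    ofReal_measureReal measure_ball_lt_top.ne, finrank_euclideanSpace_fin]

/-- A finite set whose points are at distance at least `s` from each other. -/
def SeparatedBy (s : ℝ) (N : Finset (EuclideanSpace ℝ (Fin d))) : Prop := (N : Set (EuclideanSpace ℝ (Fin d))).Pairwise fun x y => s ≤ dist x y

theorem SeparatedBy.card_mul_le {s : ℝ} (hs : 0 < s) {N : Finset (EuclideanSpace ℝ (Fin d))} (hN : SeparatedBy s N)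
    {W : Set (EuclideanSpace ℝ (Fin d))} (hW : ∀ x ∈ N, Metric.ball x (s / 2) ⊆ W) {M : ℝ} (hM : 0 ≤ M)
    (hWM : volume W ≤ ENNReal.ofReal M) :
    N.card * ((s / 2) ^ d * unitBallVol d) ≤ M := by
  have hdis : (N : Set (EuclideanSpace ℝ (Fin d))).PairwiseDisjoint fun x => Metric.ball x (s / 2) := by
    intro x hx y hy hxy
    apply Metric.ball_disjoint_ball
    linarith [hN hx hy hxy]
  have h1 := measure_biUnion_finset (μ := volume) hdis fun x _ => measurableSet_ball
  have h2 : volume (⋃ x ∈ N, Metric.ball x (s / 2)) ≤ ENNReal.ofReal M :=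
    (measure_mono (iUnion₂_subset hW)).trans hWM
  rw [h1, Finset.sum_congr rfl fun x _ => volume_ball_eq x (by positivity : (0 : ℝ) < s / 2),
    Finset.sum_const, nsmul_eq_mul, ← ENNReal.ofReal_natCast, ← ENNReal.ofReal_mul (by positivity),
    ENNReal.ofReal_le_ofReal_iff hM] at h2
  exact h2

/-- A separated subset of S of largest cardinality is a net, since otherwise a point could be added.
A largest one exists because the balls of radius s/2 are disjoint in W, which has finite volume. -/
theorem exists_separatedBy_net (S : Set (EuclideanSpace ℝ (Fin d))) {s : ℝ} (hs : 0 < s) {W : Set (EuclideanSpace ℝ (Fin d))}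
    (hW : ∀ x ∈ S, Metric.ball x (s / 2) ⊆ W) {M : ℝ} (hM : 0 ≤ M)
    (hWM : volume W ≤ ENNReal.ofReal M) :
    ∃ N : Finset (EuclideanSpace ℝ (Fin d)), (N : Set (EuclideanSpace ℝ (Fin d))) ⊆ S ∧ SeparatedBy s N ∧ (∀ x ∈ S, ∃ y ∈ N, dist x y < s) ∧
      N.card * ((s / 2) ^ d * unitBallVol d) ≤ M := by
  classical
  set T : Set ℕ := {k | ∃ N : Finset (EuclideanSpace ℝ (Fin d)), (N : Set (EuclideanSpace ℝ (Fin d))) ⊆ S ∧ SeparatedBy s N ∧ N.card = k} with hT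
  have hb : BddAbove T := by
    refine ⟨⌈M / ((s / 2) ^ d * unitBallVol d)⌉₊, ?_⟩
    rintro k ⟨N, hNS, hN, rfl⟩
    have h := hN.card_mul_le hs (fun x hx => hW x (hNS hx)) hM hWM
    have hpos : 0 < (s / 2) ^ d * unitBallVol d := mul_pos (by positivity) unitBallVol_pos
    rw [← le_div_iff₀ hpos] at h
    exact_mod_cast h.trans (Nat.le_ceil _)
  have hne : T.Nonempty := ⟨0, ∅, by simp, by simp [SeparatedBy], rfl⟩
  obtain ⟨N, hNS, hN, hk⟩ := Nat.sSup_mem hne hb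
  refine ⟨N, hNS, hN, fun x hx => ?_, hN.card_mul_le hs (fun x hx => hW x (hNS hx)) hM hWM⟩
  by_contra! hcon
  have hxN : x ∉ N := fun h => by
    have := hcon x h
    rw [dist_self] at this
    linarith
  have : (insert x N).card ∈ T := by
    refine ⟨insert x N, ?_, ?_, rfl⟩
    · rw [Finset.coe_insert]
      exact insert_subset hx hNS
    · unfold SeparatedBy
      rw [Finset.coe_insert]
      refine hN.insert fun y hy _ => ⟨hcon y hy, ?_⟩
      rw [dist_comm]
      exact hcon y hy
  have h2 := le_csSup hb this
  rw [Finset.card_insert_of_notMem hxN, hk] at h2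
  omega

theorem volume_le_of_net {S : Set (EuclideanSpace ℝ (Fin d))} {s : ℝ} (hs : 0 < s) {N : Finset (EuclideanSpace ℝ (Fin d))}
    (hN : ∀ x ∈ S, ∃ y ∈ N, dist x y < s) :
    volume S ≤ ENNReal.ofReal (N.card * (s ^ d * unitBallVol d)) := by
  have hsub : S ⊆ ⋃ y ∈ N, Metric.ball y s := by
    intro x hx
    obtain ⟨y, hy, h⟩ := hN x hx
    exact mem_iUnion₂.2 ⟨y, hy, h⟩
  refine (measure_mono hsub).trans ((measure_biUnion_finset_le _ _).trans (le_of_eq ?_))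
  rw [Finset.sum_congr rfl fun x _ => volume_ball_eq x hs, Finset.sum_const, nsmul_eq_mul,
    ← ENNReal.ofReal_natCast, ← ENNReal.ofReal_mul (by positivity)]

open Classical in
-- Volume comparison: the disjoint balls of radius s/2 fit into the ball of radius (2k + 1)s/2
-- around x.
theorem SeparatedBy.card_filter_le {s : ℝ} (hs : 0 < s) {N : Finset (EuclideanSpace ℝ (Fin d))} (hN : SeparatedBy s N)
    (x : EuclideanSpace ℝ (Fin d)) (k : ℕ) :
    ((N.filter fun y => dist x y < k * s).card : ℝ) ≤ (2 * k + 1) ^ d := by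
  have hsep : SeparatedBy s (N.filter fun y => dist x y < k * s) :=
    hN.mono (by exact_mod_cast Finset.filter_subset _ _)
  have h := hsep.card_mul_le hs (W := Metric.ball x ((2 * k + 1) * (s / 2)))
    (M := ((2 * k + 1) * (s / 2)) ^ d * unitBallVol d) ?_
    (mul_nonneg (by positivity) unitBallVol_pos.le) (volume_ball_eq x (by positivity)).le
  · rw [mul_pow, mul_assoc] at h
    exact le_of_mul_le_mul_right h (mul_pos (by positivity) unitBallVol_pos)
  · intro y hy
    apply Metric.ball_subset_ball'
    have := (Finset.mem_filter.1 hy).2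
    rw [dist_comm]
    linarith

/-- A convergent majorant for Gaussian sums over separated sets. -/
noncomputable def gaussSum (d : ℕ) (β : ℝ) : ℝ :=
  ∑' k : ℕ, (2 * (k : ℝ) + 3) ^ d * Real.exp (-(β * (k : ℝ) ^ 2))

theorem summable_gaussSum (d : ℕ) {β : ℝ} (hβ : 0 < β) :
    Summable fun k : ℕ => (2 * (k : ℝ) + 3) ^ d * Real.exp (-(β * (k : ℝ) ^ 2)) := by
  have h := (Real.summable_pow_mul_exp_neg_nat_mul d hβ).comp_injective
    (add_left_injective 1)
  refine Summable.of_norm_bounded (g := fun k : ℕ => 3 ^ d * Real.exp β *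
    (((k + 1 : ℕ) : ℝ) ^ d * Real.exp (-β * ((k + 1 : ℕ) : ℝ)))) (h.mul_left _) fun k => ?_
  rw [Real.norm_of_nonneg (by positivity)]
  have h1 : (2 * (k : ℝ) + 3) ^ d ≤ 3 ^ d * ((k + 1 : ℕ) : ℝ) ^ d := by
    rw [← mul_pow]
    gcongr
    push_cast
    linarith [(Nat.cast_nonneg k : (0 : ℝ) ≤ k)]
  have h2 : Real.exp (-(β * (k : ℝ) ^ 2)) ≤ Real.exp β * Real.exp (-β * ((k + 1 : ℕ) : ℝ)) := by
    rw [← Real.exp_add]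
    gcongr
    have : (k : ℝ) ≤ (k : ℝ) ^ 2 := by
      rcases k with _ | k
      · simp
      · push_cast
        nlinarith [(Nat.cast_nonneg k : (0 : ℝ) ≤ k)]
    push_cast
    nlinarith
  calc _ ≤ (3 ^ d * ((k + 1 : ℕ) : ℝ) ^ d) * (Real.exp β * Real.exp (-β * ((k + 1 : ℕ) : ℝ))) := by
        gcongr
    _ = _ := by ring

/-- Group the points by the integer part k of dist x y / s; the k-th shell has at most (2k + 3)^d
points. The bound does not depend on the size of N, which keeps the second moment under control. -/
theorem SeparatedBy.sum_exp_le {s : ℝ} (hs : 0 < s) {N : Finset (EuclideanSpace ℝ (Fin d))} (hN : SeparatedBy s N)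
    {β : ℝ} (hβ : 0 < β) (x : EuclideanSpace ℝ (Fin d)) :
    ∑ y ∈ N, Real.exp (-(β * (dist x y / s) ^ 2)) ≤ gaussSum d β := by
  classical
  set F : (EuclideanSpace ℝ (Fin d)) → ℕ := fun y => ⌊dist x y / s⌋₊ with hF
  have hmaps : ∀ y ∈ N, F y ∈ N.image F := fun y hy => Finset.mem_image_of_mem F hy
  rw [← Finset.sum_fiberwise_of_maps_to hmaps]
  refine le_trans (Finset.sum_le_sum fun k hk => ?_)
    ((summable_gaussSum d hβ).sum_le_tsum (N.image F) fun k _ => by positivity)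
  have hle : ∀ y ∈ N.filter (fun y => F y = k),
      Real.exp (-(β * (dist x y / s) ^ 2)) ≤ Real.exp (-(β * (k : ℝ) ^ 2)) := by
    intro y hy
    have h1 : (k : ℝ) ≤ dist x y / s := by
      rw [← (Finset.mem_filter.1 hy).2]
      exact Nat.floor_le (by positivity)
    gcongr
  refine (Finset.sum_le_sum hle).trans ?_
  rw [Finset.sum_const, nsmul_eq_mul]
  gcongr
  have hsub : N.filter (fun y => F y = k) ⊆ N.filter fun y => dist x y < ((k + 1 : ℕ) : ℝ) * s := by
    intro y hy
    rw [Finset.mem_filter] at hy ⊢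
    refine ⟨hy.1, ?_⟩
    rw [← div_lt_iff₀ hs, ← hy.2]
    push_cast
    exact Nat.lt_floor_add_one _
  refine le_trans (by exact_mod_cast Finset.card_le_card hsub)
    ((hN.card_filter_le hs x (k + 1)).trans (le_of_eq ?_))
  push_cast
  ring

/-- Among the `m ^ d` residue classes of cubes of side `ℓ`, one carries at least its share of the
volume of `V`: its points lie either in a common cube or far apart in some coordinate. -/
theorem exists_subset_cubes (V : Set (EuclideanSpace ℝ (Fin d))) {ℓ : ℝ} (hℓ : 0 < ℓ) {m : ℕ} (hm : 0 < m) :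
    ∃ V' ⊆ V, volume V ≤ (m : ℝ≥0∞) ^ d * volume V' ∧ ∀ v ∈ V', ∀ w ∈ V',
      (∀ k, |v k - w k| < ℓ) ∨ ∃ k, (m - 1 : ℝ) * ℓ < |v k - w k| := by
  have : NeZero m := ⟨hm.ne'⟩
  set Vc : (Fin d → ZMod m) → Set (EuclideanSpace ℝ (Fin d)) := fun c => {v ∈ V | ∀ k, ((⌊v k / ℓ⌋ : ℤ) : ZMod m) = c k}
    with hVc
  have hcov : V ⊆ ⋃ c, Vc c := fun v hv =>
    mem_iUnion.2 ⟨fun k => ((⌊v k / ℓ⌋ : ℤ) : ZMod m), hv, fun _ => rfl⟩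
  have hsum : volume V ≤ ∑ c, volume (Vc c) :=
    (measure_mono hcov).trans (measure_iUnion_fintype_le _ _)
  obtain ⟨c, -, hc⟩ := Finset.exists_max_image Finset.univ (fun c => volume (Vc c))
    Finset.univ_nonempty
  refine ⟨Vc c, fun v hv => hv.1, ?_, ?_⟩
  · refine hsum.trans ((Finset.sum_le_card_nsmul _ _ _ fun c' _ => hc c' (Finset.mem_univ _)).trans
      (le_of_eq ?_))
    rw [Finset.card_univ, Fintype.card_fun, ZMod.card, Fintype.card_fin, nsmul_eq_mul]
    push_cast
    rfl
  · intro v hv w hw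
    by_cases h : ∀ k, ⌊v k / ℓ⌋ = ⌊w k / ℓ⌋
    · left
      intro k
      have := Int.abs_sub_lt_one_of_floor_eq_floor (h k)
      rwa [← sub_div, abs_div, abs_of_pos hℓ, div_lt_one hℓ] at this
    · right
      push Not at h
      obtain ⟨k, hk⟩ := h
      refine ⟨k, ?_⟩
      -- Distinct congruent indices differ by at least m, and rounding loses less than one: hence
      -- the factor m - 1.
      have hdvd : (m : ℤ) ∣ ⌊w k / ℓ⌋ - ⌊v k / ℓ⌋ :=
        (ZMod.intCast_eq_intCast_iff_dvd_sub _ _ _).1 ((hv.2 k).trans (hw.2 k).symm)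
      have hge : (m : ℤ) ≤ |⌊w k / ℓ⌋ - ⌊v k / ℓ⌋| :=
        Int.le_of_dvd (abs_pos.2 (sub_ne_zero.2 (Ne.symm hk))) ((dvd_abs _ _).2 hdvd)
      have hgeR : (m : ℝ) ≤ |(⌊w k / ℓ⌋ : ℝ) - ⌊v k / ℓ⌋| := by exact_mod_cast hge
      have h1 := Int.floor_le (v k / ℓ)
      have h2 := Int.lt_floor_add_one (v k / ℓ)
      have h3 := Int.floor_le (w k / ℓ)
      have h4 := Int.lt_floor_add_one (w k / ℓ)
      have h5 : (m - 1 : ℝ) < |v k / ℓ - w k / ℓ| := by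
        rcases le_abs.1 hgeR with h | h
        · rw [lt_abs]; right; linarith
        · rw [lt_abs]; left; linarith
      rwa [← sub_div, abs_div, abs_of_pos hℓ, lt_div_iff₀ hℓ] at h5

end Packing

/-! ### Chaining along dyadic grids of the unit cube. -/

section Dyadic

variable {d : ℕ}

/-- Coordinatewise rounding down to the dyadic grid of level `k`. -/
noncomputable def dyadicFloor (k : ℕ) (t : Fin d → ℝ) : Fin d → ℝ :=
  fun i => (⌊t i * 2 ^ k⌋₊ : ℝ) / 2 ^ k

/-- The points of the dyadic grid of level `k` in `[0, 1)^d`. -/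
noncomputable def dyadicPoint (k : ℕ) (z : Fin d → Fin (2 ^ k)) : Fin d → ℝ :=
  fun i => (z i : ℝ) / 2 ^ k

/-- The half-open unit cube. -/
def unitCube (d : ℕ) : Set (Fin d → ℝ) := {t | ∀ i, 0 ≤ t i ∧ t i < 1}

theorem zero_mem_unitCube : (0 : Fin d → ℝ) ∈ unitCube d := fun i => by simp

theorem dyadicPoint_mem_unitCube (k : ℕ) (z : Fin d → Fin (2 ^ k)) :
    dyadicPoint k z ∈ unitCube d := fun i => by
  refine ⟨by unfold dyadicPoint; positivity, ?_⟩
  unfold dyadicPoint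
  rw [div_lt_one (by positivity)]
  exact_mod_cast (z i).2

theorem exists_dyadicPoint_eq {t : Fin d → ℝ} (ht : t ∈ unitCube d) (k : ℕ) :
    ∃ z, dyadicFloor k t = dyadicPoint k z := by
  refine ⟨fun i => ⟨⌊t i * 2 ^ k⌋₊, ?_⟩, rfl⟩
  rw [Nat.floor_lt (mul_nonneg (ht i).1 (by positivity))]
  push_cast
  have : (0 : ℝ) < 2 ^ k := by positivity
  nlinarith [(ht i).2]

theorem dyadicFloor_mem_unitCube {t : Fin d → ℝ} (ht : t ∈ unitCube d) (k : ℕ) :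
    dyadicFloor k t ∈ unitCube d := by
  obtain ⟨z, hz⟩ := exists_dyadicPoint_eq ht k
  rw [hz]
  exact dyadicPoint_mem_unitCube k z

theorem dyadicFloor_zero {t : Fin d → ℝ} (ht : t ∈ unitCube d) : dyadicFloor 0 t = 0 := by
  ext i
  have : ⌊t i⌋₊ = 0 := Nat.floor_eq_zero.2 (ht i).2
  simp [dyadicFloor, this]

theorem dyadicFloor_dyadicFloor_succ (k : ℕ) (t : Fin d → ℝ) :
    dyadicFloor k (dyadicFloor (k + 1) t) = dyadicFloor k t := by
  ext i
  unfold dyadicFloor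
  congr 2
  have h : (⌊t i * 2 ^ (k + 1)⌋₊ : ℝ) / 2 ^ (k + 1) * 2 ^ k = (⌊t i * 2 ^ (k + 1)⌋₊ : ℝ) / (2 : ℕ) := by
    rw [pow_succ]
    field_simp
    push_cast
    ring
  have h2 : t i * 2 ^ k = t i * 2 ^ (k + 1) / (2 : ℕ) := by
    rw [pow_succ]
    push_cast
    ring
  rw [h, h2, Nat.floor_div_natCast, Nat.floor_div_natCast, Nat.floor_natCast]

theorem norm_sub_dyadicFloor_le {t : Fin d → ℝ} (ht : ∀ i, 0 ≤ t i) (k : ℕ) :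
    ‖t - dyadicFloor k t‖ ≤ (1 / 2) ^ k := by
  rw [pi_norm_le_iff_of_nonneg (by positivity)]
  intro i
  have h0 : (0 : ℝ) < 2 ^ k := by positivity
  have h1 := Nat.floor_le (mul_nonneg (ht i) h0.le)
  have h2 := Nat.lt_floor_add_one (t i * 2 ^ k)
  have e : (t - dyadicFloor k t) i = (t i * 2 ^ k - ⌊t i * 2 ^ k⌋₊) / 2 ^ k := by
    simp only [Pi.sub_apply, dyadicFloor]
    field_simp
  rw [e, Real.norm_of_nonneg (div_nonneg (by linarith) h0.le), one_div_pow]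
  gcongr
  linarith

/-- Going down one level drops a single binary digit in each coordinate, so the step is half of the
rounding error at level k. -/
theorem norm_dyadicPoint_sub_floor_le (k : ℕ) (z : Fin d → Fin (2 ^ (k + 1))) :
    ‖dyadicPoint (k + 1) z - dyadicFloor k (dyadicPoint (k + 1) z)‖ ≤ (1 / 2) ^ (k + 1) := by
  rw [pi_norm_le_iff_of_nonneg (by positivity)]
  intro i
  have hd : ⌊(z i : ℝ) / 2 ^ (k + 1) * 2 ^ k⌋₊ = (z i : ℕ) / 2 := by
    have h : (z i : ℝ) / 2 ^ (k + 1) * 2 ^ k = ((z i : ℕ) : ℝ) / (2 : ℕ) := by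
      rw [pow_succ (2 : ℝ)]
      field_simp
      push_cast
      ring
    rw [h, Nat.floor_div_natCast, Nat.floor_natCast]
  have e : (dyadicPoint (k + 1) z - dyadicFloor k (dyadicPoint (k + 1) z)) i
      = (((z i : ℕ) % 2 : ℕ) : ℝ) / 2 ^ (k + 1) := by
    simp only [Pi.sub_apply, dyadicFloor, dyadicPoint]
    rw [hd]
    have h3 : ((z i : ℕ) : ℝ) = 2 * (((z i : ℕ) / 2 : ℕ) : ℝ) + (((z i : ℕ) % 2 : ℕ) : ℝ) := by
      exact_mod_cast (Nat.div_add_mod (z i : ℕ) 2).symm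
    rw [h3, pow_succ (2 : ℝ)]
    field_simp
    ring
  rw [e, Real.norm_of_nonneg (by positivity), one_div_pow]
  gcongr
  have : (z i : ℕ) % 2 ≤ 1 := by omega
  exact_mod_cast this

/-- Chaining along dyadic grids. -/
theorem abs_le_of_dyadic_increments {φ : (Fin d → ℝ) → ℝ} {m : ℝ}
    (h0 : φ 0 = 0)
    (hinc : ∀ k (z : Fin d → Fin (2 ^ (k + 1))),
      |φ (dyadicPoint (k + 1) z) - φ (dyadicFloor k (dyadicPoint (k + 1) z))|
        ≤ m * ((3 / 4) ^ k / 4))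
    {t : Fin d → ℝ} (ht : t ∈ unitCube d)
    (hlim : Tendsto (fun k => φ (dyadicFloor k t)) atTop (𝓝 (φ t))) :
    |φ t| ≤ m := by
  have hm : 0 ≤ m := by
    have := (abs_nonneg _).trans (hinc 0 0)
    simp at this
    linarith
  -- The allowances (3/4)^k / 4 sum to 1, with partial sums 1 - (3/4)^k.
  have hind : ∀ k, |φ (dyadicFloor k t)| ≤ m * (1 - (3 / 4) ^ k) := by
    intro k
    induction k with
    | zero => simp [dyadicFloor_zero ht, h0]
    | succ k ih =>
      obtain ⟨z, hz⟩ := exists_dyadicPoint_eq ht (k + 1)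
      have h1 := hinc k z
      rw [← hz, dyadicFloor_dyadicFloor_succ] at h1
      have h2 := abs_sub_abs_le_abs_sub (φ (dyadicFloor (k + 1) t)) (φ (dyadicFloor k t))
      have e : m * (1 - (3 / 4) ^ (k + 1)) = m * (1 - (3 / 4) ^ k) + m * ((3 / 4) ^ k / 4) := by
        ring
      linarith
  refine le_of_tendsto hlim.abs (Eventually.of_forall fun k => (hind k).trans ?_)
  have : (0 : ℝ) ≤ (3 / 4) ^ k := by positivity
  nlinarith

end Dyadic

/-! ### Reaching a level and oscillating on one small cube. -/

section CubeBound

variable {d : ℕ} {F : Type*} [NormedAddCommGroup F] [InnerProductSpace ℝ F]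

/-- The component of `x` orthogonal to the unit vector `e`. -/
noncomputable def perp (e x : F) : F := x - (inner ℝ e x : ℝ) • e

theorem inner_perp {e : F} (he : ‖e‖ = 1) (x : F) : inner ℝ e (perp e x) = (0 : ℝ) := by
  simp [perp, inner_sub_right, real_inner_smul_right, he]

theorem norm_perp_le {e : F} (he : ‖e‖ = 1) (x : F) : ‖perp e x‖ ≤ ‖x‖ := by
  have h : ‖x‖ ^ 2 = ‖perp e x‖ ^ 2 + (inner ℝ e x : ℝ) ^ 2 := by
    have e1 : x = perp e x + (inner ℝ e x : ℝ) • e := by simp [perp]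
    have h2 : inner ℝ (perp e x) ((inner ℝ e x : ℝ) • e) = (0 : ℝ) := by
      rw [real_inner_smul_right, real_inner_comm e, inner_perp he, mul_zero]
    have h3 := norm_add_sq_eq_norm_sq_add_norm_sq_of_inner_eq_zero _ _ h2
    rw [← e1, norm_smul, he] at h3
    simp only [mul_one, Real.norm_eq_abs] at h3
    rw [pow_two, h3, abs_mul_abs_self]
    ring
  nlinarith [norm_nonneg x, norm_nonneg (perp e x), sq_nonneg (inner ℝ e x : ℝ)]

theorem perp_sub (e x y : F) : perp e (x - y) = perp e x - perp e y := by
  simp only [perp, inner_sub_right, sub_smul]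
  abel

/-- The increment of the curve `c`, orthogonally to `c 0`, along a link of the dyadic chain. -/
noncomputable def linkVec (c : (Fin d → ℝ) → F) (k : ℕ) (z : Fin d → Fin (2 ^ (k + 1))) : F :=
  perp (c 0) (c (dyadicPoint (k + 1) z) - c (dyadicFloor k (dyadicPoint (k + 1) z)))

/-- Outside this set of `U`, the process `t ↦ ⟪c t, U⟫` on the unit cube either stays below `u` or
oscillates by at most `3 * m`. -/
def badSet (c : (Fin d → ℝ) → F) (a u m : ℝ) : Set F :=
  (⋃ (j : ℕ) (k : ℕ) (z : Fin d → Fin (2 ^ (k + 1))),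
    {U | u - 2 * (j + 2) * m ≤ inner ℝ (c 0) U} ∩
      {U | (j + 1) * m * ((3 / 4) ^ k / 4) ≤ |inner ℝ (linkVec c k z) U|}) ∪
    {U | 4 * a ≤ |inner ℝ (c 0) U|}

theorem norm_linkVec_le {c : (Fin d → ℝ) → F} {ε : ℝ} (h0 : ‖c 0‖ = 1)
    (hlip : ∀ t ∈ unitCube d, ∀ t' ∈ unitCube d, ‖c t - c t'‖ ≤ ε * ‖t - t'‖) (hε : 0 ≤ ε) (k : ℕ)
    (z : Fin d → Fin (2 ^ (k + 1))) : ‖linkVec c k z‖ ≤ ε * (1 / 2) ^ (k + 1) := by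
  refine (norm_perp_le h0 _).trans ((hlip _ (dyadicPoint_mem_unitCube _ _) _
    (dyadicFloor_mem_unitCube (dyadicPoint_mem_unitCube _ _) _)).trans ?_)
  gcongr
  exact norm_dyadicPoint_sub_floor_le k z

theorem norm_le_one_of_mem_unitCube {t : Fin d → ℝ} (ht : t ∈ unitCube d) : ‖t‖ ≤ 1 := by
  rw [pi_norm_le_iff_of_nonneg zero_le_one]
  intro i
  rw [Real.norm_of_nonneg (ht i).1]
  exact (ht i).2.le

/-- Unit vectors at distance at most ε have inner product at least 1 - ε²/2, so up to m/2 the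
process is s + φ, where s is its value at 0 and φ only sees the part orthogonal to c 0. Let J be the
least integer for which every link is below its allowance (J + 1) m (3/4)^k / 4; chaining gives |φ|
≤ (J + 1) m. If J = 0, the oscillation is at most 3m. If J ≥ 1, some link violates the allowance of
J - 1, and outside the bad set this forces s below u - 2(J + 1) m, so that the whole process stays
below u. -/
theorem of_notMem_badSet {c : (Fin d → ℝ) → F} {a u m ε : ℝ} (hm : 0 < m) (hε : 0 < ε)
    (hnorm : ∀ t ∈ unitCube d, ‖c t‖ = 1)
    (hlip : ∀ t ∈ unitCube d, ∀ t' ∈ unitCube d, ‖c t - c t'‖ ≤ ε * ‖t - t'‖)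
    (haε : 4 * a * ε ^ 2 ≤ m) {U : F} (hU : U ∉ badSet c a u m) :
    (∀ t ∈ unitCube d, inner ℝ (c t) U < u) ∨
      ((∀ t ∈ unitCube d, ∀ t' ∈ unitCube d, inner ℝ (c t) U - inner ℝ (c t') U ≤ 3 * m) ∧
        ∀ t ∈ unitCube d, inner ℝ (c t) U ≤ 4 * a + 2 * m) := by
  have h0 := hnorm 0 zero_mem_unitCube
  set s : ℝ := inner ℝ (c 0) U with hs
  simp only [badSet, mem_union, mem_iUnion, mem_inter_iff, mem_ofPred_eq, not_or, not_exists, not_and,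
    not_le] at hU
  obtain ⟨hU1, hU2⟩ := hU
  set φ : (Fin d → ℝ) → ℝ := fun t => inner ℝ (perp (c 0) (c t)) U with hφ
  have hφ0 : φ 0 = 0 := by
    simp [hφ, perp, h0]
  have hlink : ∀ k (z : Fin d → Fin (2 ^ (k + 1))), inner ℝ (linkVec c k z) U
      = φ (dyadicPoint (k + 1) z) - φ (dyadicFloor k (dyadicPoint (k + 1) z)) := by
    intro k z
    simp only [linkVec, perp_sub, inner_sub_left, hφ]
  have hdecomp : ∀ t ∈ unitCube d, |inner ℝ (c t) U - (s + φ t)| ≤ m / 2 := by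
    intro t ht
    have e1 : inner ℝ (c t) U - (s + φ t) = ((inner ℝ (c 0) (c t) : ℝ) - 1) * s := by
      simp only [hφ, perp, inner_sub_left, real_inner_smul_left, hs]
      ring
    have e2 : (inner ℝ (c 0) (c t) : ℝ) - 1 = -(‖c t - c 0‖ ^ 2 / 2) := by
      rw [norm_sub_sq_real, hnorm t ht, h0, real_inner_comm]
      ring
    have h1 : ‖c t - c 0‖ ≤ ε := by
      have := hlip t ht 0 zero_mem_unitCube
      rw [sub_zero] at this
      have h2 := norm_le_one_of_mem_unitCube ht
      nlinarith
    rw [e1, e2, abs_mul, abs_neg, abs_of_nonneg (by positivity)]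
    calc _ ≤ ε ^ 2 / 2 * (4 * a) := by gcongr
      _ ≤ m / 2 := by linarith
  have hlim : ∀ t ∈ unitCube d, Tendsto (fun k => φ (dyadicFloor k t)) atTop (𝓝 (φ t)) := by
    intro t ht
    rw [tendsto_iff_norm_sub_tendsto_zero]
    have hz : Tendsto (fun k : ℕ => ε * (1 / 2 : ℝ) ^ k * ‖U‖) atTop (𝓝 0) := by
      have := (tendsto_pow_atTop_nhds_zero_of_lt_one (r := (1 / 2 : ℝ)) (by norm_num)
        (by norm_num)).const_mul ε |>.mul_const ‖U‖
      simpa using this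
    refine squeeze_zero (fun _ => norm_nonneg _) (fun k => ?_) hz
    have e : φ (dyadicFloor k t) - φ t = inner ℝ (perp (c 0) (c (dyadicFloor k t) - c t)) U := by
      simp only [perp_sub, inner_sub_left, hφ]
    rw [e, Real.norm_eq_abs]
    refine (abs_real_inner_le_norm _ _).trans ?_
    gcongr
    refine (norm_perp_le h0 _).trans ((hlip _ (dyadicFloor_mem_unitCube ht k) _ ht).trans ?_)
    gcongr
    rw [norm_sub_rev]
    exact norm_sub_dyadicFloor_le (fun i => (ht i).1) k
  have hchain : ∀ J : ℕ, (∀ k (z : Fin d → Fin (2 ^ (k + 1))),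
      |inner ℝ (linkVec c k z) U| < (J + 1) * m * ((3 / 4) ^ k / 4)) →
      ∀ t ∈ unitCube d, |φ t| ≤ (J + 1) * m := by
    intro J hJ t ht
    refine abs_le_of_dyadic_increments hφ0 (fun k z => ?_) ht (hlim t ht)
    rw [← hlink]
    exact (hJ k z).le
  -- The links decay like 2^{-k}, faster than the allowances (3/4)^k, so a large J works at all
  -- levels at once.
  have hex : ∃ J : ℕ, ∀ k (z : Fin d → Fin (2 ^ (k + 1))),
      |inner ℝ (linkVec c k z) U| < (J + 1) * m * ((3 / 4) ^ k / 4) := by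
    obtain ⟨J, hJ⟩ := exists_nat_gt (4 * ε * ‖U‖ / m)
    refine ⟨J, fun k z => ?_⟩
    rw [div_lt_iff₀ hm] at hJ
    have h1 : ε * (1 / 2) ^ (k + 1) ≤ ε * (3 / 4) ^ k := by
      gcongr
      calc (1 / 2 : ℝ) ^ (k + 1) ≤ (1 / 2) ^ k :=
            pow_le_pow_of_le_one (by norm_num) (by norm_num) (by omega)
        _ ≤ _ := pow_le_pow_left₀ (by norm_num) (by norm_num) _
    have hp : (0 : ℝ) < (3 / 4) ^ k := by positivity
    calc |inner ℝ (linkVec c k z) U| ≤ ‖linkVec c k z‖ * ‖U‖ := abs_real_inner_le_norm _ _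
      _ ≤ ε * (3 / 4) ^ k * ‖U‖ := by
        gcongr
        exact (norm_linkVec_le h0 hlip hε.le k z).trans h1
      _ = (4 * ε * ‖U‖) * ((3 / 4) ^ k / 4) := by ring
      _ < (J * m) * ((3 / 4) ^ k / 4) := by gcongr
      _ ≤ _ := by gcongr; linarith
  classical
  set J := Nat.find hex with hJdef
  have hJ := Nat.find_spec hex
  rw [← hJdef] at hJ
  have hφJ := hchain J hJ
  rcases Nat.eq_zero_or_pos J with hJ0 | hJpos
  · right
    rw [hJ0] at hφJ
    have hb : ∀ t ∈ unitCube d, |inner ℝ (c t) U - s| ≤ 3 / 2 * m := by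
      intro t ht
      have h1 := abs_le.1 (hdecomp t ht)
      have h2 := abs_le.1 (hφJ t ht)
      simp only [Nat.cast_zero, zero_add, one_mul] at h2
      rw [abs_le]
      constructor <;> linarith [h1.1, h1.2, h2.1, h2.2]
    refine ⟨fun t ht t' ht' => ?_, fun t ht => ?_⟩
    · have h1 := abs_le.1 (hb t ht)
      have h2 := abs_le.1 (hb t' ht')
      linarith [h1.2, h2.1]
    · have h1 := abs_le.1 (hb t ht)
      linarith [h1.2, (abs_lt.1 hU2).2]
  · left
    intro t ht
    have hmin := Nat.find_min hex (m := J - 1) (by omega)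
    push Not at hmin
    obtain ⟨k, z, hkz⟩ := hmin
    have hs' : s < u - 2 * ((J - 1 : ℕ) + 2) * m := by
      by_contra! hcon
      exact absurd (hU1 (J - 1) k z hcon) (not_lt.2 hkz)
    have hJ1 : ((J - 1 : ℕ) : ℝ) = J - 1 := by
      rw [Nat.cast_sub hJpos]
      simp
    rw [hJ1] at hs'
    have h1 := abs_le.1 (hdecomp t ht)
    have h2 := abs_le.1 (hφJ t ht)
    have hJ2 : (1 : ℝ) ≤ J := by exact_mod_cast hJpos
    nlinarith [h1.2, h2.2]

variable [FiniteDimensional ℝ F] [MeasurableSpace F] [BorelSpace F]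

/-- The link vectors are orthogonal to c 0, so each event of the union has a product probability.
Lowering the level u by 2(j + 2) m costs at most e^{(j+1)X}. A link of level k has standard
deviation at most ε 2^{-(k+1)} against an allowance of order (3/4)^k; its tail exponent grows like
(9/4)^k H², which beats the 2^{(k+1)d} links of that level. The last term of the bound is the event
|⟪c 0, U⟫| ≥ 4a. -/
theorem stdGaussian_badSet_le {c : (Fin d → ℝ) → F} {a u m ε X : ℝ} (hm : 0 < m) (hε : 0 < ε)
    (hu : 1 ≤ u) (hua : u ≤ a) (hX : 8 * a * m ≤ X) (h0 : ‖c 0‖ = 1)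
    (hlip : ∀ t ∈ unitCube d, ∀ t' ∈ unitCube d, ‖c t - c t'‖ ≤ ε * ‖t - t'‖)
    (hH : 16 * (d + X + 1) ≤ (m / ε) ^ 2) :
    stdGaussian F (badSet c a u m) ≤ ENNReal.ofReal
      (2 ^ (d + 3) / u * Real.exp (-u ^ 2 / 2) * Real.exp (-(m / ε) ^ 2 / 16)
        + 2 * Real.exp (-(8 * a ^ 2))) := by
  set H := m / ε with hHdef
  have hu0 : 0 < u := by linarith
  have hX0 : 0 ≤ X := le_trans (by nlinarith) hX
  set Cst : ℝ := 2 ^ (d + 2) / u * Real.exp (-u ^ 2 / 2) * Real.exp (-H ^ 2 / 16) with hCst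
  have hCst0 : 0 ≤ Cst := by positivity
  have hterm : ∀ (j k : ℕ) (z : Fin d → Fin (2 ^ (k + 1))),
      stdGaussian F ({U | u - 2 * (j + 2) * m ≤ inner ℝ (c 0) U} ∩
        {U | (j + 1) * m * ((3 / 4) ^ k / 4) ≤ |inner ℝ (linkVec c k z) U|})
      ≤ ENNReal.ofReal (2 / u * Real.exp (-u ^ 2 / 2) * Real.exp ((j + 1) * X) *
        (2 * Real.exp (-((j + 1) ^ 2 * 2 ^ k * H ^ 2 / 8)))) := by
    intro j k z
    have hind := stdGaussian_real_inter_of_orthogonal (a := c 0) (b := linkVec c k z)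
      (inner_perp h0 _) (measurableSet_Ici (a := u - 2 * (j + 2) * m))
      (B := {y : ℝ | (j + 1) * m * ((3 / 4) ^ k / 4) ≤ |y|})
      (measurableSet_le measurable_const measurable_norm)
    rw [← ofReal_measureReal (measure_ne_top _ _)]
    apply ENNReal.ofReal_le_ofReal
    refine hind.le.trans ?_
    have h1 : (stdGaussian F).real {U | inner ℝ (c 0) U ∈ Ici (u - 2 * (j + 2) * m)}
        ≤ 2 / u * Real.exp (-u ^ 2 / 2) * Real.exp ((j + 1) * X) := by
      have e := stdGaussian_real_le_inner h0 (u - 2 * (j + 2) * m)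
      refine (e.le.trans (gaussianReal_real_Ici_sub_le hu (by positivity))).trans ?_
      gcongr _ * Real.exp ?_
      have hj : (0 : ℝ) ≤ j := Nat.cast_nonneg j
      calc 2 * u * (2 * (j + 2) * m) ≤ 2 * a * (2 * (j + 2) * m) := by gcongr
        _ ≤ (j + 1) * (8 * a * m) := by nlinarith [mul_nonneg hj (mul_nonneg (hu0.le.trans hua) hm.le)]
        _ ≤ _ := by gcongr
    have h2 : (stdGaussian F).real {U | inner ℝ (linkVec c k z) U ∈
        {y : ℝ | (j + 1) * m * ((3 / 4) ^ k / 4) ≤ |y|}}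
        ≤ 2 * Real.exp (-((j + 1) ^ 2 * 2 ^ k * H ^ 2 / 8)) := by
      refine (stdGaussian_real_le_abs_inner_le (norm_linkVec_le h0 hlip hε.le k z)
        (by positivity)).trans ?_
      have e : ((j + 1) * m * ((3 / 4) ^ k / 4) / (ε * (1 / 2) ^ (k + 1))) ^ 2
          = (j + 1) ^ 2 * (9 / 4) ^ k * H ^ 2 / 4 := by
        have e1 : (9 / 4 : ℝ) ^ k = ((3 / 4) ^ k) ^ 2 * (2 ^ k) ^ 2 := by
          rw [← pow_mul, ← pow_mul, mul_comm k 2, pow_mul, pow_mul, ← mul_pow]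
          norm_num
        rw [e1, hHdef, one_div_pow, pow_succ]
        field_simp
        ring
      rw [neg_div, e]
      gcongr 2 * Real.exp (-?_)
      have h3 : (2 : ℝ) ^ k ≤ (9 / 4) ^ k := pow_le_pow_left₀ (by norm_num) (by norm_num) _
      calc (j + 1) ^ 2 * 2 ^ k * H ^ 2 / 8 ≤ (j + 1) ^ 2 * (9 / 4) ^ k * H ^ 2 / 8 := by gcongr
        _ = _ := by ring
    exact mul_le_mul h1 h2 measureReal_nonneg (by positivity)
  have hlevel : ∀ j k : ℕ, stdGaussian F (⋃ z : Fin d → Fin (2 ^ (k + 1)),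
      {U | u - 2 * (j + 2) * m ≤ inner ℝ (c 0) U} ∩
        {U | (j + 1) * m * ((3 / 4) ^ k / 4) ≤ |inner ℝ (linkVec c k z) U|})
      ≤ ENNReal.ofReal Cst * ((2⁻¹ : ℝ≥0∞) ^ (j + 1) * 2⁻¹ ^ k) := by
    intro j k
    refine (measure_iUnion_fintype_le _ _).trans ((Finset.sum_le_sum fun z _ => hterm j k z).trans ?_)
    rw [Finset.sum_const, Finset.card_univ, Fintype.card_fun, Fintype.card_fin, Fintype.card_fin,
      nsmul_eq_mul]
    have e1 : (2⁻¹ : ℝ≥0∞) ^ (j + 1) * 2⁻¹ ^ k = ENNReal.ofReal ((1 / 2) ^ (j + 1) * (1 / 2) ^ k) := by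
      rw [ENNReal.ofReal_mul (by positivity), ENNReal.ofReal_pow (by norm_num),
        ENNReal.ofReal_pow (by norm_num), one_div, ENNReal.ofReal_inv_of_pos two_pos]
      simp
    rw [e1, ← ENNReal.ofReal_mul hCst0, ← ENNReal.ofReal_natCast,
      ← ENNReal.ofReal_mul (by positivity)]
    apply ENNReal.ofReal_le_ofReal
    have hj : (0 : ℝ) ≤ j := Nat.cast_nonneg j
    have hk : (0 : ℝ) ≤ k := Nat.cast_nonneg k
    have hexp2 : (2 : ℝ) ≤ Real.exp 1 := by linarith [Real.add_one_le_exp (1 : ℝ)]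
    have hA : ((2 ^ (k + 1)) ^ d : ℝ) ≤ 2 ^ d * Real.exp (k * d) := by
      have : ((2 : ℝ) ^ (k + 1)) ^ d = 2 ^ d * 2 ^ (k * d) := by
        rw [← pow_mul, ← pow_add]
        ring_nf
      rw [this]
      gcongr
      calc (2 : ℝ) ^ (k * d) ≤ (Real.exp 1) ^ (k * d) := by gcongr
        _ = Real.exp (k * d) := by rw [← Real.exp_nat_mul]; push_cast; ring_nf
    -- One half of H²/8 is kept as H²/16. The other half, by H² ≥ 16(d + X + 1) and (j + 1)² 2^k ≥ j
    -- + 1 + k, absorbs e^{kd + (j+1)X} and leaves a factor summable in j and k.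
    have hB : Real.exp (k * d) * Real.exp ((j + 1) * X) *
        Real.exp (-((j + 1) ^ 2 * 2 ^ k * H ^ 2 / 8))
        ≤ Real.exp (-H ^ 2 / 16) * ((1 / 2) ^ (j + 1) * (1 / 2) ^ k) := by
      have hhalf : ∀ i : ℕ, Real.exp (-(i : ℝ)) ≤ (1 / 2) ^ i := by
        intro i
        rw [one_div, inv_pow, Real.exp_neg]
        gcongr
        calc (2 : ℝ) ^ i ≤ (Real.exp 1) ^ i := by gcongr
          _ = Real.exp i := by rw [← Real.exp_nat_mul, mul_one]
      calc _ ≤ Real.exp (-H ^ 2 / 16) *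
            (Real.exp (-((j + 1 : ℕ) : ℝ)) * Real.exp (-(k : ℝ))) := by
            simp only [← Real.exp_add]
            rw [Real.exp_le_exp]
            have h2k : (k : ℝ) + 1 ≤ 2 ^ k := by exact_mod_cast Nat.lt_two_pow_self
            have h3 : (j : ℝ) + 1 + k ≤ (j + 1) ^ 2 * 2 ^ k := by
              calc (j : ℝ) + 1 + k ≤ (j + 1) ^ 2 * (k + 1) := by nlinarith [mul_nonneg hj hk]
                _ ≤ _ := by gcongr
            have h4 : ((j : ℝ) + 1 + k) * H ^ 2 ≤ (j + 1) ^ 2 * 2 ^ k * H ^ 2 := by gcongr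
            have h5 : ((j : ℝ) + 1 + k) * (16 * (d + X + 1)) ≤ ((j : ℝ) + 1 + k) * H ^ 2 := by gcongr
            have h6 : H ^ 2 ≤ ((j : ℝ) + 1 + k) * H ^ 2 := by nlinarith [sq_nonneg H]
            have hd0 : (0 : ℝ) ≤ d := Nat.cast_nonneg d
            push_cast
            nlinarith [mul_nonneg hj hd0, mul_nonneg hk hX0]
        _ ≤ _ := by
          gcongr
          · exact hhalf (j + 1)
          · exact hhalf k
    push_cast
    calc _ ≤ 2 ^ d * Real.exp (k * d) * (2 / u * Real.exp (-u ^ 2 / 2) * Real.exp ((j + 1) * X) *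
        (2 * Real.exp (-((j + 1) ^ 2 * 2 ^ k * H ^ 2 / 8)))) := by gcongr
      _ = 2 ^ (d + 2) / u * Real.exp (-u ^ 2 / 2) * (Real.exp (k * d) * Real.exp ((j + 1) * X) *
        Real.exp (-((j + 1) ^ 2 * 2 ^ k * H ^ 2 / 8))) := by ring
      _ ≤ 2 ^ (d + 2) / u * Real.exp (-u ^ 2 / 2) *
        (Real.exp (-H ^ 2 / 16) * ((1 / 2) ^ (j + 1) * (1 / 2) ^ k)) := by gcongr
      _ = _ := by rw [hCst]; ring
  have hunion : stdGaussian F (⋃ (j : ℕ) (k : ℕ) (z : Fin d → Fin (2 ^ (k + 1))),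
      {U | u - 2 * (j + 2) * m ≤ inner ℝ (c 0) U} ∩
        {U | (j + 1) * m * ((3 / 4) ^ k / 4) ≤ |inner ℝ (linkVec c k z) U|})
      ≤ ENNReal.ofReal (2 * Cst) := by
    calc _ ≤ ∑' j : ℕ, ∑' k : ℕ, ENNReal.ofReal Cst * ((2⁻¹ : ℝ≥0∞) ^ (j + 1) * 2⁻¹ ^ k) :=
          (measure_iUnion_le _).trans (ENNReal.tsum_le_tsum fun j =>
            (measure_iUnion_le _).trans (ENNReal.tsum_le_tsum fun k => hlevel j k))
      _ = ENNReal.ofReal Cst * 2 := by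
          simp_rw [ENNReal.tsum_mul_left, ENNReal.tsum_mul_right]
          rw [ENNReal.tsum_geometric_add_one, ENNReal.tsum_geometric, ENNReal.one_sub_inv_two,
            inv_inv, ENNReal.inv_mul_cancel two_ne_zero ENNReal.ofNat_ne_top, one_mul]
      _ = _ := by
          rw [mul_comm, ENNReal.ofReal_mul (zero_le_two : (0 : ℝ) ≤ 2), ENNReal.ofReal_ofNat]
  have htail : stdGaussian F {U | 4 * a ≤ |inner ℝ (c 0) U|}
      ≤ ENNReal.ofReal (2 * Real.exp (-(8 * a ^ 2))) := by
    rw [← ofReal_measureReal (measure_ne_top _ _)]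
    apply ENNReal.ofReal_le_ofReal
    refine (stdGaussian_real_le_abs_inner_le h0.le (by linarith)).trans (le_of_eq ?_)
    congr 2
    ring
  refine (measure_union_le _ _).trans ((add_le_add hunion htail).trans ?_)
  rw [← ENNReal.ofReal_add (by positivity) (by positivity)]
  apply ENNReal.ofReal_le_ofReal
  apply le_of_eq
  rw [hCst]
  ring

end CubeBound

/-! ### The product kernel and its logarithmic derivative. -/

section ProductKernel

variable {d : ℕ} {K : ℝ → ℝ}

/-- The product kernel on `ℝ^d` attached to a univariate kernel. -/
def prodK (K : ℝ → ℝ) (u : EuclideanSpace ℝ (Fin d)) : ℝ := ∏ i, K (u i)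

theorem contDiff_prodK (hK : ContDiff ℝ 1 K) :
    ContDiff ℝ 1 (prodK K : EuclideanSpace ℝ (Fin d) → ℝ) := by
  unfold prodK
  exact contDiff_prod fun i _ => hK.comp (EuclideanSpace.proj (𝕜 := ℝ) i).contDiff

theorem exists_support_bound (hc : HasCompactSupport K) :
    ∃ R > 0, ∀ x, R < |x| → K x = 0 := by
  obtain ⟨R, hR⟩ := hc.isCompact.isBounded.subset_closedBall (0 : ℝ)
  refine ⟨max R 1, by positivity, fun x hx => ?_⟩
  by_contra h
  have h1 := hR (subset_tsupport K (Function.mem_support.2 h))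
  rw [mem_closedBall_zero_iff, Real.norm_eq_abs] at h1
  exact absurd (h1.trans (le_max_left R 1)) (not_le.2 hx)

theorem prodK_eq_zero {R : ℝ} (hR : ∀ x, R < |x| → K x = 0) {u : EuclideanSpace ℝ (Fin d)} {k : Fin d}
    (hk : R < |u k|) : prodK K u = 0 :=
  Finset.prod_eq_zero (Finset.mem_univ k) (hR _ hk)

theorem norm_le_of_coord_le {u : EuclideanSpace ℝ (Fin d)} {R : ℝ} (hR : 0 ≤ R) (h : ∀ k, |u k| ≤ R) :
    ‖u‖ ≤ d * R := by
  have h1 : ‖u‖ ^ 2 ≤ (d * R) ^ 2 := by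
    rw [EuclideanSpace.real_norm_sq_eq]
    calc ∑ i, u i ^ 2 ≤ ∑ _i : Fin d, R ^ 2 := by
          refine Finset.sum_le_sum fun i _ => ?_
          rw [← sq_abs]
          exact pow_le_pow_left₀ (abs_nonneg _) (h i) 2
      _ = d * R ^ 2 := by simp
      _ ≤ (d * R) ^ 2 := by
        rw [mul_pow]
        gcongr
        rcases Nat.eq_zero_or_pos d with h0 | h0
        · simp [h0]
        · have : (1 : ℝ) ≤ d := by exact_mod_cast h0
          nlinarith
  exact (sq_le_sq₀ (norm_nonneg _) (by positivity)).1 h1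

theorem norm_le_of_prodK_ne_zero {R : ℝ} (hR0 : 0 ≤ R) (hR : ∀ x, R < |x| → K x = 0)
    {u : EuclideanSpace ℝ (Fin d)} (hu : prodK K u ≠ 0) : ‖u‖ ≤ d * R :=
  norm_le_of_coord_le hR0 fun _ => not_lt.1 fun hk => hu (prodK_eq_zero hR hk)

theorem hasCompactSupport_prodK (hc : HasCompactSupport K) :
    HasCompactSupport (prodK K : EuclideanSpace ℝ (Fin d) → ℝ) := by
  obtain ⟨R, hR0, hR⟩ := exists_support_bound hc
  refine HasCompactSupport.of_support_subset_isCompact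
    (isCompact_closedBall (0 : EuclideanSpace ℝ (Fin d)) (d * R)) fun u hu => ?_
  rw [mem_closedBall_zero_iff]
  exact norm_le_of_prodK_ne_zero hR0.le hR hu

theorem exists_lipschitz_prodK (hK : ContDiff ℝ 1 K) (hc : HasCompactSupport K) :
    ∃ L > 0, ∀ u v : EuclideanSpace ℝ (Fin d), |prodK K u - prodK K v| ≤ L * ‖u - v‖ := by
  obtain ⟨C, hC⟩ := (contDiff_prodK (d := d) hK).lipschitzWith_of_hasCompactSupport
    (hasCompactSupport_prodK hc) one_ne_zero
  refine ⟨C + 1, by positivity, fun u v => ?_⟩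
  have := hC.dist_le_mul u v
  rw [Real.dist_eq, dist_eq_norm] at this
  nlinarith [norm_nonneg (u - v)]

theorem exists_bound_prodK (hK : ContDiff ℝ 1 K) (hc : HasCompactSupport K) :
    ∃ B > 0, ∀ u : EuclideanSpace ℝ (Fin d), |prodK K u| ≤ B := by
  obtain ⟨B, hB⟩ := (hasCompactSupport_prodK (d := d) hc).exists_bound_of_continuous
    (contDiff_prodK hK).continuous
  exact ⟨max B 1, by positivity, fun u => (hB u).trans (le_max_left _ _)⟩

/-- K² attains its maximum, by compact support; the maximiser is such a point. -/
theorem exists_critical_point (hK : ContDiff ℝ 1 K) (hc : HasCompactSupport K) (h0 : ∃ u, K u ≠ 0) :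
    ∃ x, K x ≠ 0 ∧ deriv K x = 0 := by
  have hcont : Continuous fun x => -(K x ^ 2) := by
    have := hK.continuous
    fun_prop
  have hcs : HasCompactSupport fun x => -(K x ^ 2) :=
    hc.comp_left (g := fun y => -(y ^ 2)) (by simp)
  obtain ⟨x, hx⟩ := hcont.exists_forall_le_of_hasCompactSupport hcs
  obtain ⟨u, hu⟩ := h0
  have hxu := hx u
  have hKx : K x ≠ 0 := by
    intro h
    rw [h] at hxu
    have : 0 < K u ^ 2 := by positivity
    simp at hxu
    nlinarith
  refine ⟨x, hKx, ?_⟩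
  have hd : HasDerivAt K (deriv K x) x := (hK.differentiable one_ne_zero x).hasDerivAt
  have hd2 : HasDerivAt (fun x => -(K x ^ 2)) (-(2 * K x ^ 1 * deriv K x)) x := by
    exact (hd.pow 2).neg.congr_deriv (by push_cast; ring)
  have := IsLocalMin.hasDerivAt_eq_zero (Eventually.of_forall hx) hd2
  simpa [hKx] using this

/-- Otherwise K² has zero derivative everywhere, so it is constant, and compact support makes it
vanish. -/
theorem exists_noncritical_point (hK : ContDiff ℝ 1 K) (hc : HasCompactSupport K)
    (h0 : ∃ u, K u ≠ 0) : ∃ x, K x ≠ 0 ∧ deriv K x ≠ 0 := by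
  by_contra! hcon
  obtain ⟨u, hu⟩ := h0
  have hdiff : Differentiable ℝ K := hK.differentiable one_ne_zero
  have hd : ∀ x, deriv (fun x => K x ^ 2) x = 0 := by
    intro x
    have := ((hdiff x).hasDerivAt.pow 2).deriv
    rw [show (fun x => K x ^ 2) = K ^ 2 from rfl, this]
    by_cases h : K x = 0
    · simp [h]
    · simp [hcon x h]
  have hconst := is_const_of_deriv_eq_zero (f := fun x => K x ^ 2) (by fun_prop) hd
  obtain ⟨R, hR0, hR⟩ := exists_support_bound hc
  have h1 := hconst u (R + 1)
  have h2 : K (R + 1) = 0 := hR _ (by rw [abs_of_pos (by positivity)]; linarith)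
  simp only [h2] at h1
  exact hu (by simpa using h1)

/-- Strict differentiability makes the linear approximation uniform in base points y near u, and
design points are never exactly at u. -/
theorem HasStrictFDerivAt.eventually_approx {E : Type*} [NormedAddCommGroup E] [NormedSpace ℝ E]
    {f : E → ℝ} {A : E →L[ℝ] ℝ} {u : E} (h : HasStrictFDerivAt f A u) {c : ℝ} (hc : 0 < c) :
    ∀ᶠ r in 𝓝[>] (0 : ℝ), ∀ y t, dist y u < r → ‖t‖ ≤ r → |f (y + t) - f y - A t| ≤ c * ‖t‖ := by
  have h1 := h.isLittleO.def hc
  rw [Metric.eventually_nhds_iff] at h1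
  obtain ⟨ε, hε, h2⟩ := h1
  filter_upwards [Ioo_mem_nhdsGT (half_pos hε)] with r hr y t hy ht
  have h3 := h2 (y := (y + t, y)) ?_
  · simpa using h3
  · have hyt : dist (y + t) u < ε := by
      calc dist (y + t) u ≤ dist (y + t) y + dist y u := dist_triangle _ _ _
        _ < ε := by
          rw [dist_self_add_left]
          linarith [hr.2]
    rw [Prod.dist_eq]
    exact max_lt hyt (by linarith [hr.2])

theorem hasStrictFDerivAt_prodK (hK : ContDiff ℝ 1 K) (u : EuclideanSpace ℝ (Fin d)) :
    HasStrictFDerivAt (prodK K : EuclideanSpace ℝ (Fin d) → ℝ)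
      (∑ i, (∏ j ∈ Finset.univ.erase i, K (u j)) •
        (deriv K (u i) • EuclideanSpace.proj (𝕜 := ℝ) i)) u := by
  unfold prodK
  refine HasStrictFDerivAt.finsetProd fun i _ => ?_
  have h1 : HasStrictDerivAt K (deriv K (u i)) (u i) :=
    (hK.contDiffAt (x := u i)).hasStrictDerivAt one_ne_zero
  exact h1.comp_hasStrictFDerivAt u (EuclideanSpace.proj (𝕜 := ℝ) i).hasStrictFDerivAt

/-- Non-degeneracy of the logarithmic derivative of the product kernel: it is small near one point
and, in any given direction, large near another one. -/
theorem exists_kernel_separation (hd : 0 < d) (hK : ContDiff ℝ 1 K) (hc : HasCompactSupport K)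
    (h0 : ∃ u, K u ≠ 0) :
    ∃ (κ ρ m : ℝ) (c : Option (Fin d) → EuclideanSpace ℝ (Fin d)), 0 < κ ∧ 0 < ρ ∧ 0 < m ∧
      (∀ o, ∀ y ∈ Metric.ball (c o) ρ, m ≤ |prodK K y|) ∧
      ∀ t : EuclideanSpace ℝ (Fin d), ‖t‖ ≤ ρ →
        (∀ y ∈ Metric.ball (c none) ρ, |prodK K (y + t) - prodK K y| ≤ κ * ‖t‖ * |prodK K y|) ∧
        ∃ o, ∀ y ∈ Metric.ball (c o) ρ,
          3 * κ * ‖t‖ * |prodK K y| ≤ |prodK K (y + t) - prodK K y| := by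
  obtain ⟨x0, hx0, hx0'⟩ := exists_critical_point hK hc h0
  obtain ⟨x1, hx1, hx1'⟩ := exists_noncritical_point hK hc h0
  obtain ⟨B, hB0, hB⟩ := exists_bound_prodK (d := d) hK hc
  -- At `c none` all coordinates are critical and the gradient of the product kernel vanishes. At `c
  -- (some j)` only the j-th coordinate is non-critical, so the gradient is a nonzero multiple of
  -- the j-th coordinate form.
  set c : Option (Fin d) → EuclideanSpace ℝ (Fin d) := fun o =>
    WithLp.toLp 2 fun i => if o = some i then x1 else x0 with hcdef
  have hcne : ∀ o, prodK K (c o) ≠ 0 := by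
    intro o
    refine Finset.prod_ne_zero_iff.2 fun i _ => ?_
    simp only [hcdef]
    split_ifs <;> assumption
  obtain ⟨m, hm0, hm⟩ : ∃ m > 0, ∀ o, 2 * m ≤ |prodK K (c o)| := by
    obtain ⟨o, -, ho⟩ := Finset.exists_min_image Finset.univ (fun o => |prodK K (c o)|)
      Finset.univ_nonempty
    exact ⟨|prodK K (c o)| / 2, by have := abs_pos.2 (hcne o); positivity,
      fun o' => by linarith [ho o' (Finset.mem_univ _)]⟩
  set A : Option (Fin d) → (EuclideanSpace ℝ (Fin d) →L[ℝ] ℝ) := fun o =>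
    ∑ i, (∏ j ∈ Finset.univ.erase i, K (c o j)) •
        (deriv K (c o i) • EuclideanSpace.proj (𝕜 := ℝ) i) with hA
  have hAd : ∀ o, HasStrictFDerivAt (prodK K : EuclideanSpace ℝ (Fin d) → ℝ) (A o) (c o) :=
    fun o => hasStrictFDerivAt_prodK hK (c o)
  have hA0 : A none = 0 := by
    simp only [hA, hcdef]
    refine Finset.sum_eq_zero fun i _ => ?_
    simp [hx0']
  set q : ℝ := |K x0 ^ (d - 1) * deriv K x1| with hq
  have hq0 : 0 < q := abs_pos.2 (mul_ne_zero (pow_ne_zero _ hx0) hx1')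
  have hA1 : ∀ (j : Fin d) (t : EuclideanSpace ℝ (Fin d)), |A (some j) t| = q * |t j| := by
    intro j t
    have e : A (some j) t = K x0 ^ (d - 1) * deriv K x1 * t j := by
      simp only [hA]
      rw [sum_apply, Finset.sum_eq_single j]
      · have e1 : c (some j) j = x1 := by simp [hcdef]
        have e2 : ∏ i ∈ Finset.univ.erase j, K (c (some j) i) = K x0 ^ (d - 1) := by
          rw [Finset.prod_congr rfl (g := fun _ => K x0), Finset.prod_const]
          · simp
          · intro i hi
            have hne : j ≠ i := (Finset.ne_of_mem_erase hi).symm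
            simp [hcdef, hne]
        rw [e1, e2]
        simp
        ring
      · intro i _ hi
        have e1 : c (some j) i = x0 := by simp [hcdef, hi.symm]
        rw [e1, hx0']
        simp
      · simp
    rw [e, abs_mul]
  have hd0 : (0 : ℝ) < d := by exact_mod_cast hd
  -- The linear part has size at least (q/d)‖t‖ along the largest coordinate of t. The error ε takes
  -- at most half of it, and 3κB equals the remaining q/(2d).
  set κ : ℝ := q / (6 * d * B) with hκ
  have hκ0 : 0 < κ := by positivity
  set ε : ℝ := min (q / (2 * d)) (κ * m) with hε
  have hε0 : 0 < ε := by positivity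
  have hev1 : ∀ᶠ r in 𝓝[>] (0 : ℝ), ∀ o, ∀ y t, dist y (c o) < r → ‖t‖ ≤ r →
      |prodK K (y + t) - prodK K y - A o t| ≤ ε * ‖t‖ :=
    eventually_all.2 fun o => HasStrictFDerivAt.eventually_approx (hAd o) hε0
  have hev2 : ∀ᶠ r in 𝓝[>] (0 : ℝ), ∀ o, ∀ y ∈ Metric.ball (c o) r, m ≤ |prodK K y| := by
    refine eventually_all.2 fun o => ?_
    have h1 : ∀ᶠ y in 𝓝 (c o), m < |prodK K y| :=
      ((contDiff_prodK hK).continuous.abs.continuousAt).eventually_const_lt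
        (by linarith [hm o])
    obtain ⟨r, hr, h2⟩ := Metric.eventually_nhds_iff.1 h1
    filter_upwards [Ioo_mem_nhdsGT hr] with r' hr' y hy
    exact (h2 ((Metric.mem_ball.1 hy).trans hr'.2)).le
  obtain ⟨ρ, ⟨h1, h2⟩, hρ⟩ := ((hev1.and hev2).and self_mem_nhdsWithin).exists
  refine ⟨κ, ρ, m, c, hκ0, hρ, hm0, h2, fun t ht => ⟨fun y hy => ?_, ?_⟩⟩
  · have h3 := h1 none y t hy ht
    rw [hA0] at h3
    simp only [zero_apply, sub_zero] at h3
    refine h3.trans ?_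
    calc ε * ‖t‖ ≤ κ * m * ‖t‖ := by gcongr; exact min_le_right _ _
      _ ≤ κ * |prodK K y| * ‖t‖ := by gcongr; exact h2 none y hy
      _ = _ := by ring
  · have : Nonempty (Fin d) := ⟨⟨0, hd⟩⟩
    obtain ⟨j, -, hj⟩ := Finset.exists_max_image Finset.univ (fun j => |t j|) Finset.univ_nonempty
    have htj : ‖t‖ ≤ d * |t j| := norm_le_of_coord_le (abs_nonneg _) fun k => hj k (Finset.mem_univ k)
    refine ⟨some j, fun y hy => ?_⟩
    have h3 := h1 (some j) y t hy ht
    have h4 : |A (some j) t| - |prodK K (y + t) - prodK K y| ≤ ε * ‖t‖ := by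
      refine (abs_sub_abs_le_abs_sub _ _).trans ?_
      rwa [abs_sub_comm]
    have h5 : q / d * ‖t‖ ≤ |A (some j) t| := by
      rw [hA1, div_mul_eq_mul_div, div_le_iff₀ hd0]
      nlinarith
    have h6 : ε * ‖t‖ ≤ q / (2 * d) * ‖t‖ := by gcongr; exact min_le_left _ _
    have h7 : 3 * κ * ‖t‖ * |prodK K y| ≤ q / (2 * d) * ‖t‖ := by
      calc 3 * κ * ‖t‖ * |prodK K y| ≤ 3 * κ * ‖t‖ * B := by gcongr; exact hB y
        _ = q / (2 * d) * ‖t‖ := by rw [hκ]; field_simp; ring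
    have h8 : q / d * ‖t‖ = q / (2 * d) * ‖t‖ + q / (2 * d) * ‖t‖ := by field_simp; ring
    linarith

end ProductKernel

/-! ### Geometry of the normalised weights on a good design. -/

section Configurations

/-- Constants describing a product kernel on `ℝ^d`: a bound `R` for the support, a Lipschitz constant
`L`, a bound `B`, and the data of `exists_kernel_separation`. -/
structure KernelConst (d : ℕ) (K : ℝ → ℝ) where
  (R L B κ ρ m : ℝ)
  c : Option (Fin d) → EuclideanSpace ℝ (Fin d)
  R_pos : 0 < R
  L_pos : 0 < L
  B_pos : 0 < B
  κ_pos : 0 < κ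
  ρ_pos : 0 < ρ
  m_pos : 0 < m
  support : ∀ x, R < |x| → K x = 0
  lipschitz : ∀ u v : EuclideanSpace ℝ (Fin d), |prodK K u - prodK K v| ≤ L * ‖u - v‖
  bound : ∀ u : EuclideanSpace ℝ (Fin d), |prodK K u| ≤ B
  lower : ∀ o, ∀ y ∈ Metric.ball (c o) ρ, m ≤ |prodK K y|
  separation : ∀ t : EuclideanSpace ℝ (Fin d), ‖t‖ ≤ ρ →
    (∀ y ∈ Metric.ball (c none) ρ, |prodK K (y + t) - prodK K y| ≤ κ * ‖t‖ * |prodK K y|) ∧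
    ∃ o, ∀ y ∈ Metric.ball (c o) ρ, 3 * κ * ‖t‖ * |prodK K y| ≤ |prodK K (y + t) - prodK K y|

theorem nonempty_kernelConst {d : ℕ} {K : ℝ → ℝ} (hd : 0 < d) (hK : ContDiff ℝ 1 K)
    (hc : HasCompactSupport K) (h0 : ∃ u, K u ≠ 0) : Nonempty (KernelConst d K) := by
  obtain ⟨R, hR0, hR⟩ := exists_support_bound hc
  obtain ⟨L, hL0, hL⟩ := exists_lipschitz_prodK (d := d) hK hc
  obtain ⟨B, hB0, hB⟩ := exists_bound_prodK (d := d) hK hc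
  obtain ⟨κ, ρ, m, c, h1, h2, h3, h4, h5⟩ := exists_kernel_separation hd hK hc h0
  exact ⟨⟨R, L, B, κ, ρ, m, c, hR0, hL0, hB0, h1, h2, h3, hR, hL, hB, h4, h5⟩⟩

variable {d n : ℕ} {K : ℝ → ℝ} {σ : EuclideanSpace ℝ (Fin d) → ℝ}

/-- The kernel weights `σ(x_i) 𝐊((v - x_i) / h)` at the design points `x`. -/
noncomputable def gvec (K : ℝ → ℝ) (σ : EuclideanSpace ℝ (Fin d) → ℝ) (h : ℝ)
    (x : Fin n → EuclideanSpace ℝ (Fin d)) (v : EuclideanSpace ℝ (Fin d)) :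
    EuclideanSpace ℝ (Fin n) :=
  WithLp.toLp 2 fun i => σ (x i) * prodK K (h⁻¹ • (v - x i))

/-- The normalised kernel weights. -/
noncomputable def avec (K : ℝ → ℝ) (σ : EuclideanSpace ℝ (Fin d) → ℝ) (h : ℝ)
    (x : Fin n → EuclideanSpace ℝ (Fin d)) (v : EuclideanSpace ℝ (Fin d)) :
    EuclideanSpace ℝ (Fin n) :=
  ‖gvec K σ h x v‖⁻¹ • gvec K σ h x v

open Classical in
/-- The number of design points in `A`. -/
noncomputable def count (x : Fin n → EuclideanSpace ℝ (Fin d)) (A : Set (EuclideanSpace ℝ (Fin d))) :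
    ℕ := (Finset.univ.filter fun i => x i ∈ A).card

theorem count_mono (x : Fin n → EuclideanSpace ℝ (Fin d)) {A A' : Set (EuclideanSpace ℝ (Fin d))}
    (h : A ⊆ A') : count x A ≤ count x A' := by
  classical
  exact Finset.card_le_card fun i hi => by
    rw [Finset.mem_filter] at hi ⊢
    exact ⟨hi.1, h hi.2⟩

theorem count_mul_le_norm_sq {x : Fin n → EuclideanSpace ℝ (Fin d)}
    {A : Set (EuclideanSpace ℝ (Fin d))} {f : Fin n → ℝ} {b : ℝ}
    (hb : ∀ i, x i ∈ A → b ≤ f i ^ 2) : count x A * b ≤ ‖(WithLp.toLp 2 f : EuclideanSpace ℝ (Fin n))‖ ^ 2 := by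
  classical
  rw [EuclideanSpace.real_norm_sq_eq, count, ← nsmul_eq_mul]
  refine (Finset.card_nsmul_le_sum _ (fun i => f i ^ 2) b fun i hi =>
    hb i (Finset.mem_filter.1 hi).2).trans ?_
  exact Finset.sum_le_sum_of_subset_of_nonneg (Finset.filter_subset _ _) fun i _ _ => sq_nonneg _

theorem norm_sq_le_count_mul {x : Fin n → EuclideanSpace ℝ (Fin d)}
    {A : Set (EuclideanSpace ℝ (Fin d))} {f : Fin n → ℝ} {b : ℝ}
    (hb : ∀ i, x i ∈ A → f i ^ 2 ≤ b) (h0 : ∀ i, x i ∉ A → f i = 0) :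
    ‖(WithLp.toLp 2 f : EuclideanSpace ℝ (Fin n))‖ ^ 2 ≤ count x A * b := by
  classical
  rw [EuclideanSpace.real_norm_sq_eq, count, ← nsmul_eq_mul]
  refine le_trans (le_of_eq ?_) (Finset.sum_le_card_nsmul _ (fun i => f i ^ 2) b fun i hi =>
    hb i (Finset.mem_filter.1 hi).2)
  symm
  refine Finset.sum_subset (Finset.filter_subset _ _) fun i _ hi => ?_
  have hi' : x i ∉ A := fun h => hi (Finset.mem_filter.2 ⟨Finset.mem_univ _, h⟩)
  simp [h0 i hi']

theorem count_union_le (x : Fin n → EuclideanSpace ℝ (Fin d)) (A A' : Set (EuclideanSpace ℝ (Fin d))) :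
    count x (A ∪ A') ≤ count x A + count x A' := by
  classical
  unfold count
  refine (Finset.card_le_card ?_).trans (Finset.card_union_le _ _)
  intro i hi
  simpa [Finset.mem_union, Finset.mem_filter] using hi

/-- Design points whose local counts, at all `v ∈ S` and at the scale `h`, are between `lo`
and `hi`. -/
structure GoodDesign (κ : KernelConst d K) (S : Set (EuclideanSpace ℝ (Fin d))) (h lo hi : ℝ)
    (x : Fin n → EuclideanSpace ℝ (Fin d)) : Prop where
  lower : ∀ v ∈ S, ∀ o, lo ≤ count x (Metric.ball (v - h • κ.c o) (h * κ.ρ))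
  upper : ∀ v ∈ S, (count x (Metric.closedBall v (h * (d * κ.R))) : ℝ) ≤ hi

/-- Bounds for the conditional variance near `S`. -/
def VarBounds (κ : KernelConst d K) (σ : EuclideanSpace ℝ (Fin d) → ℝ)
    (S : Set (EuclideanSpace ℝ (Fin d))) (h sl sh : ℝ) : Prop :=
  ∀ v ∈ S, ∀ y, dist y v ≤ h * (d * κ.R) → sl ≤ σ y ^ 2 ∧ σ y ^ 2 ≤ sh

variable {κ : KernelConst d K} {S : Set (EuclideanSpace ℝ (Fin d))} {h lo hi sl sh q : ℝ}
  {x : Fin n → EuclideanSpace ℝ (Fin d)}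

theorem KernelConst.mem_closedBall_of_ne_zero (κ : KernelConst d K) (hh : 0 < h)
    {v y : EuclideanSpace ℝ (Fin d)} (hy : prodK K (h⁻¹ • (v - y)) ≠ 0) :
    dist y v ≤ h * (d * κ.R) := by
  have h1 := norm_le_of_prodK_ne_zero κ.R_pos.le κ.support hy
  rw [norm_smul, norm_inv, Real.norm_of_nonneg hh.le, inv_mul_le_iff₀ hh] at h1
  rwa [dist_comm, dist_eq_norm]

theorem KernelConst.mem_ball_scaled (κ : KernelConst d K) (hh : 0 < h) {o : Option (Fin d)}
    {v y : EuclideanSpace ℝ (Fin d)} (hy : y ∈ Metric.ball (v - h • κ.c o) (h * κ.ρ)) :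
    h⁻¹ • (v - y) ∈ Metric.ball (κ.c o) κ.ρ := by
  rw [Metric.mem_ball, dist_eq_norm] at hy ⊢
  have e : h⁻¹ • (v - y) - κ.c o = -(h⁻¹ • (y - (v - h • κ.c o))) := by
    rw [smul_sub h⁻¹ y, smul_sub h⁻¹ v (h • _), smul_smul, inv_mul_cancel₀ hh.ne', one_smul, smul_sub]
    abel
  rw [e, norm_neg, norm_smul, norm_inv, Real.norm_of_nonneg hh.le, inv_mul_lt_iff₀ hh]
  exact hy

theorem GoodDesign.le_norm_gvec_sq (hx : GoodDesign κ S h lo hi x) (hσ : VarBounds κ σ S h sl sh)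
    (hh : 0 < h) (hsl : 0 ≤ sl) {v : EuclideanSpace ℝ (Fin d)} (hv : v ∈ S) :
    lo * (sl * κ.m ^ 2) ≤ ‖gvec K σ h x v‖ ^ 2 := by
  have hm := κ.m_pos
  refine le_trans ?_ (count_mul_le_norm_sq (x := x) (A := Metric.ball (v - h • κ.c none) (h * κ.ρ))
    (b := sl * κ.m ^ 2) fun i hi => ?_)
  · gcongr
    exact hx.lower v hv none
  · have h1 := κ.lower none _ (κ.mem_ball_scaled hh hi)
    have h2 := (hσ v hv _ (κ.mem_closedBall_of_ne_zero hh (abs_pos.1 (hm.trans_le h1)))).1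
    rw [mul_pow]
    gcongr ?_ * ?_
    rw [← sq_abs (prodK K _)]
    gcongr

theorem GoodDesign.norm_gvec_sq_le (hx : GoodDesign κ S h lo hi x) (hσ : VarBounds κ σ S h sl sh)
    (hh : 0 < h) (hsh : 0 ≤ sh) {v : EuclideanSpace ℝ (Fin d)} (hv : v ∈ S) :
    ‖gvec K σ h x v‖ ^ 2 ≤ hi * (sh * κ.B ^ 2) := by
  have hB := κ.B_pos
  refine (norm_sq_le_count_mul (x := x) (A := Metric.closedBall v (h * (d * κ.R)))
    (b := sh * κ.B ^ 2) (fun i hi => ?_) fun i hi => ?_).trans ?_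
  · rw [mul_pow]
    gcongr ?_ * ?_
    · exact (hσ v hv _ hi).2
    · rw [← sq_abs (prodK K _)]
      gcongr
      exact κ.bound _
  · by_contra hne
    exact hi (κ.mem_closedBall_of_ne_zero hh (right_ne_zero_of_mul hne))
  · gcongr
    exact hx.upper v hv

/-- Only design points within the support radius of v or of w contribute, at most hi for each; hence
the factor 2. -/
theorem GoodDesign.norm_gvec_sub_sq_le (hx : GoodDesign κ S h lo hi x)
    (hσ : VarBounds κ σ S h sl sh) (hh : 0 < h) (hsh : 0 ≤ sh) {v w : EuclideanSpace ℝ (Fin d)}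
    (hv : v ∈ S) (hw : w ∈ S) :
    ‖gvec K σ h x v - gvec K σ h x w‖ ^ 2 ≤ 2 * hi * (sh * (κ.L * (h⁻¹ * ‖v - w‖)) ^ 2) := by
  have hL := κ.L_pos
  have e : gvec K σ h x v - gvec K σ h x w = WithLp.toLp 2 fun i =>
      σ (x i) * (prodK K (h⁻¹ • (v - x i)) - prodK K (h⁻¹ • (w - x i))) := by
    ext i
    simp [gvec, mul_sub]
  rw [e]
  refine (norm_sq_le_count_mul (x := x) (A := Metric.closedBall v (h * (d * κ.R)) ∪
    Metric.closedBall w (h * (d * κ.R))) (b := sh * (κ.L * (h⁻¹ * ‖v - w‖)) ^ 2)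
    (fun i hi => ?_) fun i hi => ?_).trans ?_
  · rw [mul_pow]
    gcongr ?_ * ?_
    · rcases hi with hi | hi
      · exact (hσ v hv _ hi).2
      · exact (hσ w hw _ hi).2
    · rw [← sq_abs]
      gcongr
      refine (κ.lipschitz _ _).trans (le_of_eq ?_)
      rw [← smul_sub, norm_smul, norm_inv, Real.norm_of_nonneg hh.le, sub_sub_sub_cancel_right]
  · rw [mem_union, not_or] at hi
    have h1 : prodK K (h⁻¹ • (v - x i)) = 0 := by
      by_contra hne
      exact hi.1 (κ.mem_closedBall_of_ne_zero hh hne)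
    have h2 : prodK K (h⁻¹ • (w - x i)) = 0 := by
      by_contra hne
      exact hi.2 (κ.mem_closedBall_of_ne_zero hh hne)
    rw [h1, h2, sub_zero, mul_zero]
  · gcongr
    have h1 : (count x (Metric.closedBall v (h * (d * κ.R)) ∪
        Metric.closedBall w (h * (d * κ.R))) : ℝ)
        ≤ count x (Metric.closedBall v (h * (d * κ.R)))
          + count x (Metric.closedBall w (h * (d * κ.R))) := by
      exact_mod_cast count_union_le x _ _
    linarith [hx.upper v hv, hx.upper w hw]

theorem norm_normalize_sub_le {F : Type*} [NormedAddCommGroup F] [NormedSpace ℝ F] {a b : F}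
    (ha : a ≠ 0) (hb : b ≠ 0) : ‖‖a‖⁻¹ • a - ‖b‖⁻¹ • b‖ ≤ 2 * ‖a - b‖ / ‖a‖ := by
  have ha' : 0 < ‖a‖ := norm_pos_iff.2 ha
  have hb' : 0 < ‖b‖ := norm_pos_iff.2 hb
  have e : ‖a‖⁻¹ • a - ‖b‖⁻¹ • b = ‖a‖⁻¹ • (a - b) + (‖a‖⁻¹ * (‖b‖ - ‖a‖) * ‖b‖⁻¹) • b := by
    have : ‖a‖⁻¹ * (‖b‖ - ‖a‖) * ‖b‖⁻¹ = ‖a‖⁻¹ - ‖b‖⁻¹ := by field_simp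
    rw [this, sub_smul, smul_sub]
    abel
  rw [e]
  refine (norm_add_le _ _).trans ?_
  rw [norm_smul, norm_smul, norm_mul, norm_mul, norm_inv, norm_inv, norm_norm, norm_norm, mul_assoc,
    inv_mul_cancel₀ hb'.ne', mul_one, Real.norm_eq_abs]
  have := abs_norm_sub_norm_le b a
  rw [norm_sub_rev] at this
  rw [two_mul, add_div, div_eq_inv_mul]
  gcongr

/-- Reduces the distance of two directions to one linear combination of the unnormalised vectors,
which can be bounded below coordinate by coordinate. -/
theorem norm_normalize_sub_ge {F : Type*} [NormedAddCommGroup F] [NormedSpace ℝ F] {a b : F}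
    (ha : a ≠ 0) (hb : b ≠ 0) :
    ‖a - (‖a‖ / ‖b‖) • b‖ / ‖a‖ = ‖‖a‖⁻¹ • a - ‖b‖⁻¹ • b‖ := by
  have ha' : 0 < ‖a‖ := norm_pos_iff.2 ha
  have hb' : 0 < ‖b‖ := norm_pos_iff.2 hb
  have e : ‖a‖⁻¹ • a - ‖b‖⁻¹ • b = ‖a‖⁻¹ • (a - (‖a‖ / ‖b‖) • b) := by
    rw [smul_sub, smul_smul]
    congr 2
    field_simp
  rw [e, norm_smul, norm_inv, norm_norm, div_eq_inv_mul]

theorem GoodDesign.gvec_ne_zero (hx : GoodDesign κ S h lo hi x) (hσ : VarBounds κ σ S h sl sh)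
    (hh : 0 < h) (hsl : 0 < sl) (hlo : 0 < lo) {v : EuclideanSpace ℝ (Fin d)} (hv : v ∈ S) :
    gvec K σ h x v ≠ 0 := by
  intro h0
  have h1 := hx.le_norm_gvec_sq hσ hh hsl.le hv
  rw [h0, norm_zero] at h1
  have hm := κ.m_pos
  have : 0 < lo * (sl * κ.m ^ 2) := by positivity
  norm_num at h1
  linarith

theorem GoodDesign.norm_avec (hx : GoodDesign κ S h lo hi x) (hσ : VarBounds κ σ S h sl sh)
    (hh : 0 < h) (hsl : 0 < sl) (hlo : 0 < lo) {v : EuclideanSpace ℝ (Fin d)} (hv : v ∈ S) :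
    ‖avec K σ h x v‖ = 1 := by
  rw [avec, norm_smul, norm_inv, norm_norm,
    inv_mul_cancel₀ (norm_ne_zero_iff.2 (hx.gvec_ne_zero hσ hh hsl hlo hv))]

/-- The Lipschitz constant of `avec` at unit bandwidth. -/
noncomputable def KernelConst.lipConst (κ : KernelConst d K) (sl sh q : ℝ) : ℝ :=
  2 * √(2 * q * sh / sl) * κ.L / κ.m

/-- The lower Lipschitz constant of `avec` at unit bandwidth. -/
noncomputable def KernelConst.sepConst (κ : KernelConst d K) (sl sh q : ℝ) : ℝ :=
  √(sl / (q * sh)) * κ.κ * κ.m / κ.B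

theorem KernelConst.lipConst_pos (κ : KernelConst d K) (hsl : 0 < sl) (hsh : 0 < sh) (hq : 0 < q) :
    0 < κ.lipConst sl sh q := by
  have := κ.L_pos
  have := κ.m_pos
  unfold lipConst
  positivity

theorem KernelConst.sepConst_pos (κ : KernelConst d K) (hsl : 0 < sl) (hsh : 0 < sh) (hq : 0 < q) :
    0 < κ.sepConst sl sh q := by
  have := κ.κ_pos
  have := κ.m_pos
  have := κ.B_pos
  unfold sepConst
  positivity

/-- Normalising at most doubles the relative increment. The counts behind the increment and behind
the norm are comparable up to q, so n and the number of points disappear. -/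
theorem GoodDesign.norm_avec_sub_le (hx : GoodDesign κ S h lo hi x) (hσ : VarBounds κ σ S h sl sh)
    (hh : 0 < h) (hsl : 0 < sl) (hsh : 0 < sh) (hlo : 0 < lo) (hhi : hi ≤ q * lo) (hq : 0 < q)
    {v w : EuclideanSpace ℝ (Fin d)} (hv : v ∈ S) (hw : w ∈ S) :
    ‖avec K σ h x v - avec K σ h x w‖ ≤ κ.lipConst sl sh q / h * ‖v - w‖ := by
  have hm := κ.m_pos
  have hL := κ.L_pos
  have hgv := hx.gvec_ne_zero hσ hh hsl hlo hv
  have hgw := hx.gvec_ne_zero hσ hh hsl hlo hw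
  refine (norm_normalize_sub_le hgv hgw).trans ?_
  have hn : 0 < ‖gvec K σ h x v‖ := norm_pos_iff.2 hgv
  rw [div_le_iff₀ hn]
  have h1 := hx.le_norm_gvec_sq hσ hh hsl.le hv
  have h2 := hx.norm_gvec_sub_sq_le hσ hh hsh.le hv hw
  have hΛ := κ.lipConst_pos hsl hsh hq
  rw [← sq_le_sq₀ (by positivity) (by positivity)]
  have h3 : (κ.lipConst sl sh q) ^ 2 = 4 * (2 * q * sh / sl) * κ.L ^ 2 / κ.m ^ 2 := by
    rw [KernelConst.lipConst, div_pow, mul_pow, mul_pow, Real.sq_sqrt (by positivity)]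
    norm_num
  calc (2 * ‖gvec K σ h x v - gvec K σ h x w‖) ^ 2
      = 4 * ‖gvec K σ h x v - gvec K σ h x w‖ ^ 2 := by ring
    _ ≤ 4 * (2 * (q * lo) * (sh * (κ.L * (h⁻¹ * ‖v - w‖)) ^ 2)) := by
        refine mul_le_mul_of_nonneg_left (h2.trans ?_) (by norm_num)
        gcongr
    _ = (κ.lipConst sl sh q) ^ 2 / h ^ 2 * ‖v - w‖ ^ 2 * (lo * (sl * κ.m ^ 2)) := by
        rw [h3]
        field_simp
    _ ≤ (κ.lipConst sl sh q) ^ 2 / h ^ 2 * ‖v - w‖ ^ 2 * ‖gvec K σ h x v‖ ^ 2 := by gcongr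
    _ = _ := by ring

/-- Normalisation could hide an increment that multiplies all weights by a common factor c. Two
families of design points exclude this. Near `c none` the kernel is almost stationary, so a factor
far from 1 is visible there; near a suitable `c o` the kernel changes so much that a factor close to
1 cannot compensate. Either family contains at least lo design points. -/
theorem GoodDesign.le_norm_avec_sub (hx : GoodDesign κ S h lo hi x) (hσ : VarBounds κ σ S h sl sh)
    (hh : 0 < h) (hsl : 0 < sl) (hsh : 0 < sh) (hlo : 0 < lo) (hhi : hi ≤ q * lo) (hq : 0 < q)
    {v w : EuclideanSpace ℝ (Fin d)} (hv : v ∈ S) (hw : w ∈ S) (hvw : ‖v - w‖ ≤ h * κ.ρ) :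
    κ.sepConst sl sh q / h * ‖v - w‖ ≤ ‖avec K σ h x v - avec K σ h x w‖ := by
  have hm := κ.m_pos
  have hB := κ.B_pos
  have hκ := κ.κ_pos
  have hgv := hx.gvec_ne_zero hσ hh hsl hlo hv
  have hgw := hx.gvec_ne_zero hσ hh hsl hlo hw
  have hn : 0 < ‖gvec K σ h x v‖ := norm_pos_iff.2 hgv
  unfold avec
  rw [← norm_normalize_sub_ge hgv hgw, le_div_iff₀ hn]
  set c : ℝ := ‖gvec K σ h x v‖ / ‖gvec K σ h x w‖ with hc
  set t := h⁻¹ • (v - w) with ht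
  have htn : ‖t‖ = h⁻¹ * ‖v - w‖ := by rw [ht, norm_smul, norm_inv, Real.norm_of_nonneg hh.le]
  have htρ : ‖t‖ ≤ κ.ρ := by
    rw [htn, inv_mul_le_iff₀ hh]
    exact hvw
  obtain ⟨hs1, o, hs2⟩ := κ.separation t htρ
  have hdec : ∀ i, h⁻¹ • (v - x i) = h⁻¹ • (w - x i) + t := fun i => by
    rw [ht, ← smul_add]
    congr 1
    abel
  have key : ∃ o, ∀ y ∈ Metric.ball (κ.c o) κ.ρ,
      κ.m * κ.κ * ‖t‖ ≤ |prodK K (y + t) - c * prodK K y| := by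
    -- The threshold lies midway between the relative changes κ‖t‖ and 3κ‖t‖ of the two families,
    -- which leaves κ‖t‖ in both cases.
    rcases le_or_gt |1 - c| (2 * κ.κ * ‖t‖) with h1 | h1
    · refine ⟨o, fun y hy => ?_⟩
      have h2 := hs2 y hy
      have h3 := κ.lower o y hy
      have e : prodK K (y + t) - prodK K y
          = (prodK K (y + t) - c * prodK K y) - (1 - c) * prodK K y := by ring
      rw [e] at h2
      have h4 := h2.trans (abs_sub _ _)
      rw [abs_mul (1 - c)] at h4
      have h5 : |1 - c| * |prodK K y| ≤ 2 * κ.κ * ‖t‖ * |prodK K y| := by gcongr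
      calc κ.m * κ.κ * ‖t‖ ≤ |prodK K y| * κ.κ * ‖t‖ := by gcongr
        _ ≤ _ := by linarith
    · refine ⟨none, fun y hy => ?_⟩
      have h2 := hs1 y hy
      have h3 := κ.lower none y hy
      have e : (1 - c) * prodK K y
          = (prodK K (y + t) - c * prodK K y) - (prodK K (y + t) - prodK K y) := by ring
      have h4 := (congrArg abs e).le.trans (abs_sub _ _)
      rw [abs_mul (1 - c)] at h4
      have h5 : 2 * κ.κ * ‖t‖ * |prodK K y| ≤ |1 - c| * |prodK K y| := by gcongr
      calc κ.m * κ.κ * ‖t‖ ≤ |prodK K y| * κ.κ * ‖t‖ := by gcongr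
        _ ≤ _ := by linarith
  obtain ⟨o', hkey⟩ := key
  have hlow : lo * (sl * (κ.m * κ.κ * ‖t‖) ^ 2) ≤ ‖gvec K σ h x v - c • gvec K σ h x w‖ ^ 2 := by
    have e : gvec K σ h x v - c • gvec K σ h x w = WithLp.toLp 2 fun i =>
        σ (x i) * (prodK K (h⁻¹ • (w - x i) + t) - c * prodK K (h⁻¹ • (w - x i))) := by
      ext i
      simp only [gvec, PiLp.sub_apply, PiLp.smul_apply, smul_eq_mul, hdec i]
      ring
    rw [e]
    refine le_trans ?_ (count_mul_le_norm_sq (x := x) (A := Metric.ball (w - h • κ.c o') (h * κ.ρ))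
      (b := sl * (κ.m * κ.κ * ‖t‖) ^ 2) fun i hi => ?_)
    · gcongr
      exact hx.lower w hw o'
    · have hy := κ.mem_ball_scaled hh hi
      have h1 := κ.lower o' _ hy
      have h2 := (hσ w hw _ (κ.mem_closedBall_of_ne_zero hh (abs_pos.1 (hm.trans_le h1)))).1
      rw [mul_pow (σ (x i))]
      gcongr ?_ * ?_
      rw [← sq_abs (prodK K _ - _)]
      gcongr
      exact hkey _ hy
  have hup := hx.norm_gvec_sq_le hσ hh hsh.le hv
  have hκ' := κ.sepConst_pos hsl hsh hq
  rw [← sq_le_sq₀ (by positivity) (by positivity)]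
  have h3 : (κ.sepConst sl sh q) ^ 2 = sl / (q * sh) * κ.κ ^ 2 * κ.m ^ 2 / κ.B ^ 2 := by
    rw [KernelConst.sepConst, div_pow, mul_pow, mul_pow, Real.sq_sqrt (by positivity)]
  refine le_trans ?_ hlow
  calc (κ.sepConst sl sh q / h * ‖v - w‖ * ‖gvec K σ h x v‖) ^ 2
      = (κ.sepConst sl sh q) ^ 2 * ‖t‖ ^ 2 * ‖gvec K σ h x v‖ ^ 2 := by rw [htn]; ring
    _ ≤ (κ.sepConst sl sh q) ^ 2 * ‖t‖ ^ 2 * ((q * lo) * (sh * κ.B ^ 2)) := by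
        refine mul_le_mul_of_nonneg_left (hup.trans ?_) (by positivity)
        gcongr
    _ = _ := by
        rw [h3]
        field_simp

/-- No design point can be within R h of both v and w in the coordinate k, so no index carries both
weights. Under a standard Gaussian vector the two values are then independent. -/
theorem inner_avec_eq_zero (κ : KernelConst d K) (hh : 0 < h) {v w : EuclideanSpace ℝ (Fin d)}
    {k : Fin d} (hk : 2 * κ.R * h < |v k - w k|) :
    inner ℝ (avec K σ h x v) (avec K σ h x w) = (0 : ℝ) := by
  unfold avec
  rw [real_inner_smul_left, real_inner_smul_right]
  have : inner ℝ (gvec K σ h x v) (gvec K σ h x w) = (0 : ℝ) := by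
    rw [PiLp.inner_apply]
    refine Finset.sum_eq_zero fun i _ => ?_
    have hprod : prodK K (h⁻¹ • (v - x i)) = 0 ∨ prodK K (h⁻¹ • (w - x i)) = 0 := by
      by_contra! hcon
      have h1 : |(h⁻¹ • (v - x i)) k| ≤ κ.R := not_lt.1 fun hk => hcon.1 (prodK_eq_zero κ.support hk)
      have h2 : |(h⁻¹ • (w - x i)) k| ≤ κ.R := not_lt.1 fun hk => hcon.2 (prodK_eq_zero κ.support hk)
      simp only [PiLp.smul_apply, PiLp.sub_apply, smul_eq_mul] at h1 h2
      rw [abs_mul, abs_inv, abs_of_pos hh, inv_mul_le_iff₀ hh] at h1 h2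
      have h3 := abs_sub (v k - x i k) (w k - x i k)
      rw [sub_sub_sub_cancel_right] at h3
      linarith
    rcases hprod with h0 | h0 <;> simp [gvec, h0]
  rw [this, mul_zero, mul_zero]

end Configurations

/-! ### Concentration of the local counts of design points. -/

section Concentration

variable {Ω : Type*} [MeasurableSpace Ω] {P : Measure Ω} [IsProbabilityMeasure P] {d : ℕ}
  {X : ℕ → Ω → EuclideanSpace ℝ (Fin d)}

theorem count_eq_sum_indicator {n : ℕ} (x : Fin n → EuclideanSpace ℝ (Fin d))
    (A : Set (EuclideanSpace ℝ (Fin d))) :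
    (count x A : ℝ) = ∑ i, A.indicator (1 : EuclideanSpace ℝ (Fin d) → ℝ) (x i) := by
  classical
  simp [count, Set.indicator_apply, Finset.sum_boole]

theorem measurable_count {n : ℕ} {A : Set (EuclideanSpace ℝ (Fin d))} (hA : MeasurableSet A) :
    Measurable fun x : Fin n → EuclideanSpace ℝ (Fin d) => (count x A : ℝ) := by
  simp_rw [count_eq_sum_indicator]
  exact Finset.measurable_sum _ fun i _ =>
    (measurable_one.indicator hA).comp (measurable_pi_apply i)

theorem mgf_indicator_le {Y : Ω → EuclideanSpace ℝ (Fin d)} (hY : Measurable Y)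
    {A : Set (EuclideanSpace ℝ (Fin d))} (hA : MeasurableSet A) (t : ℝ) :
    mgf (fun ω => A.indicator (1 : EuclideanSpace ℝ (Fin d) → ℝ) (Y ω)) P t
      ≤ Real.exp (P.real (Y ⁻¹' A) * (Real.exp t - 1)) := by
  have e : ∀ ω, Real.exp (t * A.indicator (1 : EuclideanSpace ℝ (Fin d) → ℝ) (Y ω))
      = 1 + (Y ⁻¹' A).indicator (1 : Ω → ℝ) ω * (Real.exp t - 1) := by
    intro ω
    by_cases h : Y ω ∈ A
    · have h' : ω ∈ Y ⁻¹' A := h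
      simp [h, h']
    · have h' : ω ∉ Y ⁻¹' A := h
      simp [h, h']
  have hi : Integrable ((Y ⁻¹' A).indicator (1 : Ω → ℝ)) P :=
    (integrable_const (1 : ℝ)).indicator (hY hA)
  unfold mgf
  simp_rw [e]
  rw [integral_add (integrable_const _) (hi.mul_const _), integral_mul_const,
    integral_indicator_one (hY hA)]
  simp only [integral_const, probReal_univ, smul_eq_mul, one_mul]
  linarith [Real.add_one_le_exp (P.real (Y ⁻¹' A) * (Real.exp t - 1))]

/-- Each indicator has moment generating function 1 + p(e^t - 1), at most the exponential of p(e^t -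
1); independence multiplies, which gives the Poisson bound. -/
theorem mgf_count_le (hind : iIndepFun X P) (hX : ∀ i, Measurable (X i))
    {A : Set (EuclideanSpace ℝ (Fin d))} (hA : MeasurableSet A) {p : ℝ}
    (hp : ∀ i, P.real (X i ⁻¹' A) = p) (n : ℕ) (t : ℝ) :
    mgf (fun ω => (count (fun i : Fin n => X i ω) A : ℝ)) P t
      ≤ Real.exp (n * (p * (Real.exp t - 1))) := by
  have hind' : iIndepFun (fun (i : Fin n) ω =>
      A.indicator (1 : EuclideanSpace ℝ (Fin d) → ℝ) (X i ω)) P :=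
    (hind.precomp (g := fun i : Fin n => (i : ℕ)) Fin.val_injective).comp
      (fun _ => A.indicator (1 : EuclideanSpace ℝ (Fin d) → ℝ)) fun _ => measurable_one.indicator hA
  have e : (fun ω => (count (fun i : Fin n => X i ω) A : ℝ))
      = ∑ i : Fin n, fun ω => A.indicator (1 : EuclideanSpace ℝ (Fin d) → ℝ) (X i ω) := by
    ext ω
    rw [count_eq_sum_indicator, Finset.sum_apply]
  rw [e, hind'.mgf_sum (fun i => (measurable_one.indicator hA).comp (hX i))]
  calc _ ≤ ∏ _i : Fin n, Real.exp (p * (Real.exp t - 1)) := by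
        refine Finset.prod_le_prod (fun i _ => mgf_nonneg) fun i _ => ?_
        have := mgf_indicator_le (P := P) (hX i) hA t
        rwa [hp i] at this
    _ = _ := by rw [Finset.prod_const, Finset.card_univ, Fintype.card_fin, ← Real.exp_nat_mul]

theorem integrable_exp_mul_count (hX : ∀ i, Measurable (X i))
    {A : Set (EuclideanSpace ℝ (Fin d))} (hA : MeasurableSet A) (n : ℕ) (t : ℝ) :
    Integrable (fun ω => Real.exp (t * (count (fun i : Fin n => X i ω) A : ℝ))) P := by
  have hm : Measurable fun ω => (count (fun i : Fin n => X i ω) A : ℝ) :=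
    (measurable_count hA).comp (measurable_pi_lambda _ fun i => hX i)
  refine integrable_exp_mul_of_mem_Icc (a := 0) (b := n) hm.aemeasurable (ae_of_all _ fun ω => ?_)
  refine ⟨Nat.cast_nonneg _, ?_⟩
  have : count (fun i : Fin n => X i ω) A ≤ (Finset.univ : Finset (Fin n)).card := by
    classical
    exact Finset.card_filter_le _ _
  rw [Finset.card_univ, Fintype.card_fin] at this
  exact_mod_cast this

/-- Chernoff's bound at t = 1, where e - 1 ≤ 2. -/
theorem measureReal_count_ge_le (hind : iIndepFun X P) (hX : ∀ i, Measurable (X i))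
    {A : Set (EuclideanSpace ℝ (Fin d))} (hA : MeasurableSet A) {p p1 : ℝ}
    (hp : ∀ i, P.real (X i ⁻¹' A) = p) (hp1 : p ≤ p1) (n : ℕ) :
    P.real {ω | 4 * (n * p1) ≤ count (fun i : Fin n => X i ω) A} ≤ Real.exp (-(n * p1)) := by
  have hp0 : 0 ≤ p := by rw [← hp 0]; exact measureReal_nonneg
  refine (measure_ge_le_exp_mul_mgf (4 * (n * p1)) zero_le_one
    (integrable_exp_mul_count hX hA n 1)).trans ?_
  refine (mul_le_mul_of_nonneg_left (mgf_count_le hind hX hA hp n 1) (Real.exp_pos _).le).trans ?_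
  rw [← Real.exp_add, Real.exp_le_exp]
  have he : Real.exp 1 - 1 ≤ 2 := by linarith [Real.exp_one_lt_d9]
  have hn : (0 : ℝ) ≤ n := Nat.cast_nonneg n
  have hp10 : 0 ≤ p1 := hp0.trans hp1
  have h1 : (n : ℝ) * (p * (Real.exp 1 - 1)) ≤ n * (p1 * 2) := by
    gcongr
    linarith [Real.add_one_le_exp (1 : ℝ)]
  nlinarith [mul_nonneg hn (hp0.trans hp1)]

/-- Chernoff's bound at t = -1, where e^{-1} - 1 ≤ -1/2. -/
theorem measureReal_count_le_le (hind : iIndepFun X P) (hX : ∀ i, Measurable (X i))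
    {A : Set (EuclideanSpace ℝ (Fin d))} (hA : MeasurableSet A) {p p0 : ℝ}
    (hp : ∀ i, P.real (X i ⁻¹' A) = p) (hp0 : 0 ≤ p0) (hpp : p0 ≤ p) (n : ℕ) :
    P.real {ω | (count (fun i : Fin n => X i ω) A : ℝ) ≤ n * p0 / 4} ≤ Real.exp (-(n * p0 / 4)) := by
  refine (measure_le_le_exp_mul_mgf (n * p0 / 4) (by norm_num : (-1 : ℝ) ≤ 0)
    (integrable_exp_mul_count hX hA n (-1))).trans ?_
  refine (mul_le_mul_of_nonneg_left (mgf_count_le hind hX hA hp n (-1)) (Real.exp_pos _).le).trans ?_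
  rw [← Real.exp_add, Real.exp_le_exp]
  have he : Real.exp (-1) - 1 ≤ -(1 / 2) := by
    have : Real.exp (-1) ≤ 1 / 2 := by
      rw [Real.exp_neg, inv_eq_one_div]
      apply one_div_le_one_div_of_le (by norm_num)
      linarith [Real.add_one_le_exp (1 : ℝ)]
    linarith
  have hn : (0 : ℝ) ≤ n := Nat.cast_nonneg n
  have h1 : (n : ℝ) * (p * (Real.exp (-1) - 1)) ≤ n * (p0 * -(1 / 2)) := by
    gcongr ?_ * ?_
    nlinarith
  nlinarith [mul_nonneg hn hp0]

/-- The two-sided bounds for a density on a set. -/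
theorem real_preimage_bounds {f : EuclideanSpace ℝ (Fin d) → ℝ} {Y : Ω → EuclideanSpace ℝ (Fin d)}
    (hY : Measurable Y) (hlaw : P.map Y = volume.withDensity fun x => ENNReal.ofReal (f x))
    {z : EuclideanSpace ℝ (Fin d)} {r cf F : ℝ} (hr : 0 < r) (hcf : 0 ≤ cf)
    (hf : ∀ y ∈ Metric.ball z r, cf ≤ f y ∧ f y ≤ F) :
    cf * (r ^ d * unitBallVol d) ≤ P.real (Y ⁻¹' Metric.ball z r) ∧
      P.real (Y ⁻¹' Metric.ball z r) ≤ F * (r ^ d * unitBallVol d) := by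
  have hF : 0 ≤ F := by
    have := hf z (Metric.mem_ball_self hr)
    linarith
  have hω := unitBallVol_pos (d := d)
  have e : P (Y ⁻¹' Metric.ball z r) = ∫⁻ y in Metric.ball z r, ENNReal.ofReal (f y) := by
    rw [← Measure.map_apply hY measurableSet_ball, hlaw, withDensity_apply _ measurableSet_ball]
  have hup : P (Y ⁻¹' Metric.ball z r) ≤ ENNReal.ofReal (F * (r ^ d * unitBallVol d)) := by
    rw [e, ENNReal.ofReal_mul hF, ← volume_ball_eq z hr, ← setLIntegral_const]
    exact setLIntegral_mono measurable_const fun y hy => ENNReal.ofReal_le_ofReal (hf y hy).2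
  have hlow : ENNReal.ofReal (cf * (r ^ d * unitBallVol d)) ≤ P (Y ⁻¹' Metric.ball z r) := by
    rw [e, ENNReal.ofReal_mul hcf, ← volume_ball_eq z hr, ← setLIntegral_const]
    exact setLIntegral_mono' measurableSet_ball fun y hy => ENNReal.ofReal_le_ofReal (hf y hy).1
  constructor
  · rw [measureReal_def]
    exact (ENNReal.ofReal_le_iff_le_toReal (measure_ne_top _ _)).1 hlow
  · rw [measureReal_def]
    exact ENNReal.toReal_le_of_le_ofReal (by positivity) hup

variable {K : ℝ → ℝ}

theorem KernelConst.norm_c_le (κ : KernelConst d K) (o : Option (Fin d)) : ‖κ.c o‖ ≤ d * κ.R := by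
  apply norm_le_of_prodK_ne_zero κ.R_pos.le κ.support
  exact abs_pos.1 (κ.m_pos.trans_le (κ.lower o _ (Metric.mem_ball_self κ.ρ_pos)))

/-- The constant in the lower bound for local counts. -/
noncomputable def KernelConst.countLow (κ : KernelConst d K) (cf : ℝ) : ℝ :=
  cf * ((κ.ρ / 2) ^ d * unitBallVol d) / 4

/-- The constant in the upper bound for local counts. -/
noncomputable def KernelConst.countHigh (κ : KernelConst d K) (F : ℝ) : ℝ :=
  4 * (F * ((d * κ.R + κ.ρ) ^ d * unitBallVol d))

theorem KernelConst.countLow_pos (κ : KernelConst d K) {cf : ℝ} (hcf : 0 < cf) :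
    0 < κ.countLow cf := by
  have := κ.ρ_pos
  have := unitBallVol_pos (d := d)
  unfold countLow
  positivity

theorem KernelConst.countHigh_pos (κ : KernelConst d K) {F : ℝ} (hF : 0 < F) :
    0 < κ.countHigh F := by
  have := κ.ρ_pos
  have := κ.R_pos
  have := unitBallVol_pos (d := d)
  unfold countHigh
  positivity

/-- With high probability the design is good at the scale `h`. -/
theorem exists_measurable_goodDesign (κ : KernelConst d K) (hind : iIndepFun X P)
    (hX : ∀ i, Measurable (X i)) {f : EuclideanSpace ℝ (Fin d) → ℝ}
    (hlaw : ∀ i, P.map (X i) = volume.withDensity fun x => ENNReal.ofReal (f x))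
    {S W : Set (EuclideanSpace ℝ (Fin d))} {h cf F M : ℝ} (hh : 0 < h) (hcf : 0 < cf) (hcF : cf ≤ F)
    (hf : ∀ v ∈ S, ∀ y, dist y v < h * (d * κ.R + κ.ρ) → y ∈ W ∧ cf ≤ f y ∧ f y ≤ F)
    (hM : 0 ≤ M) (hWM : volume W ≤ ENNReal.ofReal M) (n : ℕ) :
    ∃ G : Set (Fin n → EuclideanSpace ℝ (Fin d)), MeasurableSet G ∧
      (∀ x ∈ G, GoodDesign κ S h (κ.countLow cf * (n * h ^ d)) (κ.countHigh F * (n * h ^ d)) x) ∧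
      P {ω | (fun i : Fin n => X i ω) ∉ G} ≤ ENNReal.ofReal
        (M / ((h * κ.ρ / 4) ^ d * unitBallVol d) *
          ((d + 2) * Real.exp (-(κ.countLow cf * (n * h ^ d))))) := by
  have hρ := κ.ρ_pos
  have hR := κ.R_pos
  have hω := unitBallVol_pos (d := d)
  have hd0 : (0 : ℝ) ≤ d := Nat.cast_nonneg d
  -- Counts are tested only at the points of a finite net of mesh hρ/2, on shrunken inner balls and
  -- enlarged outer balls. This controls every v in S and keeps the event measurable.
  obtain ⟨N, hNS, -, hNnet, hNcard⟩ := exists_separatedBy_net S (s := h * κ.ρ / 2) (by positivity)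
    (W := W) (fun v hv y hy => (hf v hv y (by
      rw [Metric.mem_ball] at hy
      nlinarith [mul_pos hh hρ, mul_nonneg hh.le (mul_nonneg hd0 hR.le)])).1) hM hWM
  set A : EuclideanSpace ℝ (Fin d) → Option (Fin d) → Set (EuclideanSpace ℝ (Fin d)) :=
    fun v o => Metric.ball (v - h • κ.c o) (h * κ.ρ / 2) with hA
  set A' : EuclideanSpace ℝ (Fin d) → Set (EuclideanSpace ℝ (Fin d)) :=
    fun v => Metric.ball v (h * (d * κ.R + κ.ρ)) with hA'
  set G : Set (Fin n → EuclideanSpace ℝ (Fin d)) := ⋂ v ∈ N,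
    ((⋂ o, {x | κ.countLow cf * (n * h ^ d) < count x (A v o)}) ∩
      {x | (count x (A' v) : ℝ) < κ.countHigh F * (n * h ^ d)}) with hG
  have hmemG : ∀ x, x ∈ G ↔ ∀ v ∈ N, (∀ o, κ.countLow cf * (n * h ^ d) < count x (A v o)) ∧
      (count x (A' v) : ℝ) < κ.countHigh F * (n * h ^ d) := by
    intro x
    simp [hG]
  refine ⟨G, ?_, fun x hx => ?_, ?_⟩
  · refine N.measurableSet_biInter fun v _ => MeasurableSet.inter (MeasurableSet.iInter fun o => ?_) ?_
    · exact measurableSet_lt measurable_const (measurable_count measurableSet_ball)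
    · exact measurableSet_lt (measurable_count measurableSet_ball) measurable_const
  · rw [hmemG] at hx
    constructor
    · intro v hv o
      obtain ⟨y, hy, hvy⟩ := hNnet v hv
      refine ((hx y hy).1 o).le.trans ?_
      norm_cast
      apply count_mono
      apply Metric.ball_subset_ball'
      rw [dist_sub_right, dist_comm]
      linarith
    · intro v hv
      obtain ⟨y, hy, hvy⟩ := hNnet v hv
      refine le_trans ?_ ((hx y hy).2).le
      norm_cast
      apply count_mono
      intro z hz
      rw [Metric.mem_closedBall] at hz
      rw [hA', Metric.mem_ball]
      have := dist_triangle z v y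
      nlinarith [mul_pos hh hρ]
  · have hsub : {ω | (fun i : Fin n => X i ω) ∉ G} ⊆ ⋃ v ∈ N,
        ((⋃ o, {ω | (count (fun i : Fin n => X i ω) (A v o) : ℝ) ≤ κ.countLow cf * (n * h ^ d)}) ∪
        {ω | κ.countHigh F * (n * h ^ d) ≤ count (fun i : Fin n => X i ω) (A' v)}) := by
      intro ω hω'
      rw [mem_ofPred_eq, hmemG] at hω'
      push Not at hω'
      obtain ⟨v, hv, hv2⟩ := hω'
      refine mem_iUnion₂.2 ⟨v, hv, ?_⟩
      by_cases hc : ∀ o, κ.countLow cf * (n * h ^ d) < count (fun i : Fin n => X i ω) (A v o)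
      · exact Or.inr (hv2 hc)
      · push Not at hc
        obtain ⟨o, ho⟩ := hc
        exact Or.inl (mem_iUnion.2 ⟨o, ho⟩)
    set E : ℝ := Real.exp (-(κ.countLow cf * (n * h ^ d))) with hE
    have hsame : ∀ (B : Set (EuclideanSpace ℝ (Fin d))) (_ : MeasurableSet B) i,
        P.real (X i ⁻¹' B) = P.real (X 0 ⁻¹' B) := by
      intro B hB i
      rw [measureReal_def, measureReal_def, ← Measure.map_apply (hX i) hB,
        ← Measure.map_apply (hX 0) hB, hlaw, hlaw]
    have hlow : ∀ v ∈ N, ∀ o,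
        P {ω | (count (fun i : Fin n => X i ω) (A v o) : ℝ) ≤ κ.countLow cf * (n * h ^ d)}
          ≤ ENNReal.ofReal E := by
      intro v hv o
      rw [← ofReal_measureReal (measure_ne_top _ _)]
      apply ENNReal.ofReal_le_ofReal
      have hb := (real_preimage_bounds (hX 0) (hlaw 0) (z := v - h • κ.c o) (r := h * κ.ρ / 2)
        (cf := cf) (F := F) (by positivity) hcf.le (fun y hy => (hf v (hNS hv) y (by
          rw [Metric.mem_ball, dist_eq_norm] at hy
          have e : y - v = (y - (v - h • κ.c o)) - h • κ.c o := by abel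
          rw [dist_eq_norm, e]
          refine (norm_sub_le _ _).trans_lt ?_
          rw [norm_smul, Real.norm_of_nonneg hh.le]
          have h1 := mul_le_mul_of_nonneg_left (κ.norm_c_le o) hh.le
          nlinarith [mul_pos hh hρ])).2)).1
      have key := measureReal_count_le_le hind hX (A := A v o) measurableSet_ball
        (p0 := cf * ((h * κ.ρ / 2) ^ d * unitBallVol d)) (hsame _ measurableSet_ball)
        (by positivity) hb n
      have e : n * (cf * ((h * κ.ρ / 2) ^ d * unitBallVol d)) / 4 = κ.countLow cf * (n * h ^ d) := by
        rw [KernelConst.countLow, mul_div_assoc h, mul_pow]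
        ring
      rwa [e] at key
    have hup : ∀ v ∈ N,
        P {ω | κ.countHigh F * (n * h ^ d) ≤ count (fun i : Fin n => X i ω) (A' v)}
          ≤ ENNReal.ofReal E := by
      intro v hv
      rw [← ofReal_measureReal (measure_ne_top _ _)]
      apply ENNReal.ofReal_le_ofReal
      have hb := (real_preimage_bounds (hX 0) (hlaw 0) (z := v) (r := h * (d * κ.R + κ.ρ))
        (cf := cf) (F := F) (by positivity) hcf.le (fun y hy => (hf v (hNS hv) y hy).2)).2
      have key := measureReal_count_ge_le hind hX (A := A' v) measurableSet_ball
        (p1 := F * ((h * (d * κ.R + κ.ρ)) ^ d * unitBallVol d)) (hsame _ measurableSet_ball) hb n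
      have e : 4 * (n * (F * ((h * (d * κ.R + κ.ρ)) ^ d * unitBallVol d)))
          = κ.countHigh F * (n * h ^ d) := by
        rw [KernelConst.countHigh, mul_pow]
        ring
      rw [e] at key
      refine key.trans ?_
      rw [hE, Real.exp_le_exp, neg_le_neg_iff, KernelConst.countLow, mul_pow]
      have h1 : (κ.ρ / 2) ^ d ≤ (d * κ.R + κ.ρ) ^ d := by
        gcongr
        nlinarith [mul_nonneg hd0 hR.le]
      have hF0 : 0 ≤ F := hcf.le.trans hcF
      calc cf * ((κ.ρ / 2) ^ d * unitBallVol d) / 4 * (n * h ^ d)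
          ≤ F * ((d * κ.R + κ.ρ) ^ d * unitBallVol d) / 4 * (n * h ^ d) := by gcongr
        _ ≤ F * ((d * κ.R + κ.ρ) ^ d * unitBallVol d) * (n * h ^ d) := by
          have h2 : 0 ≤ F * ((d * κ.R + κ.ρ) ^ d * unitBallVol d) :=
            mul_nonneg (hcf.le.trans hcF) (by positivity)
          gcongr
          linarith
        _ = _ := by ring
    refine (measure_mono hsub).trans ((measure_biUnion_finset_le _ _).trans ?_)
    have hone : ∀ v ∈ N, P ((⋃ o, {ω | (count (fun i : Fin n => X i ω) (A v o) : ℝ)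
          ≤ κ.countLow cf * (n * h ^ d)}) ∪
        {ω | κ.countHigh F * (n * h ^ d) ≤ count (fun i : Fin n => X i ω) (A' v)})
        ≤ ENNReal.ofReal ((d + 2) * E) := by
      intro v hv
      refine (measure_union_le _ _).trans ((add_le_add ((measure_iUnion_fintype_le _ _).trans
        (Finset.sum_le_sum fun o _ => hlow v hv o)) (hup v hv)).trans (le_of_eq ?_))
      rw [Finset.sum_const, Finset.card_univ, Fintype.card_option, Fintype.card_fin, nsmul_eq_mul,
        ← ENNReal.ofReal_natCast, ← ENNReal.ofReal_mul (by positivity),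
        ← ENNReal.ofReal_add (by positivity) (by positivity)]
      congr 1
      push_cast
      ring
    refine (Finset.sum_le_sum hone).trans ?_
    rw [Finset.sum_const, nsmul_eq_mul, ← ENNReal.ofReal_natCast, ← ENNReal.ofReal_mul (by positivity)]
    apply ENNReal.ofReal_le_ofReal
    gcongr
    rw [le_div_iff₀ (by positivity)]
    refine le_trans (le_of_eq ?_) hNcard
    congr 3
    ring

/-- The density and the conditional variance are well behaved near `𝓥`. -/
theorem exists_local_bounds {f : EuclideanSpace ℝ (Fin d) → ℝ}
    {σ : EuclideanSpace ℝ (Fin d) → ℝ} {𝓥 : Set (EuclideanSpace ℝ (Fin d))}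
    (hlaw : P.map (X 0) = volume.withDensity fun x => ENNReal.ofReal (f x))
    (hX : Measurable (X 0)) {η c C : ℝ} (hη : 0 < η) (hc : 0 < c)
    (hfd : DifferentiableOn ℝ f (Metric.thickening η 𝓥))
    (hb : ∀ x ∈ Metric.thickening η 𝓥,
      c ≤ σ x ^ 2 ∧ σ x ^ 2 ≤ C ∧ c ≤ f x ∧ ‖fderiv ℝ f x‖ ≤ C) :
    ∃ F, c ≤ F ∧ (∀ x ∈ Metric.thickening (η / 2) 𝓥, f x ≤ F) ∧
      volume (Metric.thickening η 𝓥) ≤ ENNReal.ofReal (1 / c) := by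
  have hle1 : ∀ B : Set (EuclideanSpace ℝ (Fin d)), MeasurableSet B →
      ∫⁻ y in B, ENNReal.ofReal (f y) ≤ 1 := by
    intro B hB
    rw [← withDensity_apply _ hB, ← hlaw, Measure.map_apply hX hB]
    exact prob_le_one
  set v0 : ℝ := (η / 2) ^ d * unitBallVol d with hv0
  have hv0pos : 0 < v0 := mul_pos (by positivity) unitBallVol_pos
  refine ⟨max c (2 / v0 + C * (η / 2)), le_max_left _ _, fun x hx => le_max_of_le_right ?_, ?_⟩
  · have hsub : Metric.ball x (η / 2) ⊆ Metric.thickening η 𝓥 := by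
      intro y hy
      rw [Metric.mem_thickening_iff] at hx ⊢
      obtain ⟨z, hz, hxz⟩ := hx
      refine ⟨z, hz, ?_⟩
      have := dist_triangle y x z
      rw [Metric.mem_ball] at hy
      linarith
    -- A density cannot be at least 2/v0 on a ball of volume v0; the gradient bound carries the
    -- smaller value from w to x.
    have hex : ∃ w ∈ Metric.ball x (η / 2), f w < 2 / v0 := by
      by_contra! hcon
      have h1 : ENNReal.ofReal (2 / v0) * ENNReal.ofReal v0 ≤ 1 := by
        rw [hv0, ← volume_ball_eq x (by positivity : 0 < η / 2), ← hv0, ← setLIntegral_const]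
        exact (setLIntegral_mono' measurableSet_ball fun y hy =>
          ENNReal.ofReal_le_ofReal (hcon y hy)).trans (hle1 _ measurableSet_ball)
      rw [← ENNReal.ofReal_mul (by positivity), div_mul_cancel₀ _ hv0pos.ne'] at h1
      norm_num at h1
    obtain ⟨w, hw, hfw⟩ := hex
    have h2 := (convex_ball x (η / 2)).norm_image_sub_le_of_norm_fderiv_le (𝕜 := ℝ) (f := f) (C := C)
      (fun y hy => (hfd y (hsub hy)).differentiableAt
        (Metric.isOpen_thickening.mem_nhds (hsub hy)))
      (fun y hy => (hb y (hsub hy)).2.2.2) hw (Metric.mem_ball_self (by positivity))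
    have hC0 : 0 ≤ C := (norm_nonneg _).trans (hb w (hsub hw)).2.2.2
    rw [Real.norm_eq_abs] at h2
    have h3 : C * ‖x - w‖ ≤ C * (η / 2) := by
      gcongr
      rw [Metric.mem_ball, dist_comm, dist_eq_norm] at hw
      exact hw.le
    linarith [le_abs_self (f x - f w)]
  -- The volume is finite because the density is at least c there and has mass at most one;
  -- boundedness of 𝓥 is not assumed.
  · have h1 : ENNReal.ofReal c * volume (Metric.thickening η 𝓥) ≤ 1 := by
      rw [← setLIntegral_const]
      exact (setLIntegral_mono' Metric.isOpen_thickening.measurableSet fun y hy =>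
        ENNReal.ofReal_le_ofReal (hb y hy).2.2.1).trans
        (hle1 _ Metric.isOpen_thickening.measurableSet)
    rw [ENNReal.ofReal_div_of_pos hc, ENNReal.ofReal_one]
    rw [ENNReal.le_div_iff_mul_le (Or.inl (by simpa using hc)) (Or.inl ENNReal.ofReal_ne_top), mul_comm]
    exact h1

end Concentration

/-! ### The normalizing constants a_n(V). -/

section NormalizingConstants

theorem integral_sq_pos_of_continuous {g : ℝ → ℝ} (hg : Continuous g) (hc : HasCompactSupport g)
    (h0 : ∃ x, g x ≠ 0) : 0 < ∫ x, g x ^ 2 := by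
  have hgc : Continuous fun x => g x ^ 2 := by fun_prop
  obtain ⟨x, hx⟩ := h0
  exact Continuous.integral_pos_of_hasCompactSupport_nonneg_nonzero hgc
    (hc.comp_left (g := fun y => y ^ 2) (by simp)) (fun x => sq_nonneg _) (x := x) (by positivity)

/-- Integration by parts on an interval around the support, allowed by absolute continuity of K',
turns -∫ K K'' into ∫ K'², which is positive. -/
theorem lam_pos {K : ℝ → ℝ} (h0 : ∃ u, K u ≠ 0) (hc : HasCompactSupport K) (hK : ContDiff ℝ 1 K)
    (hac : ∀ x y, AbsolutelyContinuousOnInterval (deriv K) x y) :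
    0 < (-∫ u, K u * deriv (deriv K) u) / ∫ u, K u ^ 2 := by
  obtain ⟨R, hR0, hR⟩ := exists_support_bound hc
  have hsupp : ∀ (g : ℝ → ℝ), (Function.support g ⊆ Function.support K) →
      ∫ u, g u = ∫ u in (-(R + 1))..(R + 1), g u := by
    intro g hg
    symm
    apply intervalIntegral.integral_eq_integral_of_support_subset
    intro u hu
    have h1 : |u| ≤ R := not_lt.1 fun h => hg hu (hR u h)
    rw [abs_le] at h1
    constructor <;> linarith [h1.1, h1.2]
  have hdcont : Continuous (deriv K) := hK.continuous_deriv le_rfl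
  have hdsupp : HasCompactSupport (deriv K) := hc.deriv
  have hKac : AbsolutelyContinuousOnInterval K (-(R + 1)) (R + 1) :=
    (hK.contDiffOn (s := uIcc (-(R + 1)) (R + 1))).absolutelyContinuousOnInterval
  have hibp := hKac.integral_mul_deriv_eq_deriv_mul (hac (-(R + 1)) (R + 1))
  have e1 : K (R + 1) = 0 := hR _ (by rw [abs_of_pos (by linarith)]; linarith)
  have e2 : K (-(R + 1)) = 0 := hR _ (by rw [abs_neg, abs_of_pos (by linarith)]; linarith)
  rw [e1, e2] at hibp
  have hsq : ∫ u, deriv K u ^ 2 = ∫ u in (-(R + 1))..(R + 1), deriv K u * deriv K u := by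
    simp_rw [pow_two]
    symm
    apply intervalIntegral.integral_eq_integral_of_support_subset
    intro u hu
    have h1 : |u| ≤ R := by
      by_contra! h
      apply hu
      have : deriv K u = 0 := by
        have hev : K =ᶠ[𝓝 u] fun _ => 0 := by
          filter_upwards [(isOpen_lt continuous_const continuous_abs).mem_nhds h] with y hy
          exact hR y hy
        rw [hev.deriv_eq, deriv_const]
      simp [this]
    rw [abs_le] at h1
    constructor <;> linarith [h1.1, h1.2]
  rw [hsupp _ (fun u hu h => hu (by simp [h])), hibp, ← hsq]
  obtain ⟨x1, -, hx1⟩ := exists_noncritical_point hK hc h0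
  have p1 := integral_sq_pos_of_continuous hdcont hdsupp ⟨x1, hx1⟩
  have p2 := integral_sq_pos_of_continuous hK.continuous hc h0
  apply div_pos _ p2
  linarith

/-- The largest solution of `C x^k exp(-x²/2) = 1`. -/
noncomputable def largestRoot (C : ℝ) (k : ℕ) : ℝ :=
  sSup {x : ℝ | C * x ^ k * Real.exp (-x ^ 2 / 2) = 1}

/-- If x is a root then x^k > 0, so |x| is a root as well. For an empty or unbounded set of roots
`sSup` is 0, so nonnegativity also covers a_n of an arbitrary random set. -/
theorem largestRoot_nonneg {C : ℝ} (hC : 0 ≤ C) (k : ℕ) : 0 ≤ largestRoot C k := by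
  unfold largestRoot
  set T : Set ℝ := {x : ℝ | C * x ^ k * Real.exp (-x ^ 2 / 2) = 1} with hT
  rcases T.eq_empty_or_nonempty with h | ⟨x, hx⟩
  · rw [h, Real.sSup_empty]
  by_cases hb : BddAbove T
  · have hmem : |x| ∈ T := by
      rw [hT, mem_ofPred_eq] at hx ⊢
      have hxk : |x| ^ k = x ^ k := by
        rw [← abs_pow]
        apply abs_of_nonneg
        by_contra! hneg
        have : C * x ^ k ≤ 0 := mul_nonpos_of_nonneg_of_nonpos hC hneg.le
        have := mul_nonpos_of_nonpos_of_nonneg this (Real.exp_pos (-x ^ 2 / 2)).le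
        linarith
      rw [hxk, sq_abs, hx]
    exact (abs_nonneg x).trans (le_csSup hb hmem)
  · rw [Real.sSup_of_not_bddAbove hb]

theorem tendsto_pow_mul_exp_neg_sq_half (C : ℝ) (k : ℕ) :
    Tendsto (fun x : ℝ => C * x ^ k * Real.exp (-x ^ 2 / 2)) atTop (𝓝 0) := by
  have h1 := (Real.tendsto_pow_mul_exp_neg_atTop_nhds_zero k).const_mul |C|
  rw [mul_zero] at h1
  refine squeeze_zero_norm' ?_ h1
  filter_upwards [eventually_ge_atTop 2] with x hx
  rw [norm_mul, norm_mul, Real.norm_eq_abs, Real.norm_of_nonneg (by positivity),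
    Real.norm_of_nonneg (Real.exp_pos _).le, mul_assoc]
  gcongr
  nlinarith

/-- The function is at least 1 at B and tends to 0, so it takes the value 1 to the right of B. The
roots form a closed set bounded above, so the supremum is itself a root. -/
theorem largestRoot_spec {C B : ℝ} {k : ℕ} (hB : 1 ≤ C * B ^ k * Real.exp (-B ^ 2 / 2)) :
    B ≤ largestRoot C k ∧
      C * largestRoot C k ^ k * Real.exp (-largestRoot C k ^ 2 / 2) = 1 := by
  set φ : ℝ → ℝ := fun x => C * x ^ k * Real.exp (-x ^ 2 / 2) with hφ
  have hcont : Continuous φ := by fun_prop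
  have hlim := tendsto_pow_mul_exp_neg_sq_half C k
  have hev : ∀ᶠ x in atTop, φ x < 1 := hlim.eventually_lt_const one_pos
  obtain ⟨A, hA⟩ := eventually_atTop.1 hev
  set T : Set ℝ := {x : ℝ | φ x = 1} with hT
  have hbdd : BddAbove T := ⟨A, fun x hx => by
    by_contra! h
    exact (hA x h.le).ne hx⟩
  have hclosed : IsClosed T := isClosed_eq hcont continuous_const
  have hBA : B ≤ max A B := le_max_right _ _
  obtain ⟨x, hx, hx1⟩ : ∃ x ∈ Icc B (max A B), φ x = 1 := by
    have := intermediate_value_Icc' hBA hcont.continuousOn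
    obtain ⟨x, hx, h⟩ := this ⟨(hA _ (le_max_left _ _)).le, hB⟩
    exact ⟨x, hx, h⟩
  have hne : T.Nonempty := ⟨x, hx1⟩
  exact ⟨hx.1.trans (le_csSup hbdd hx1), hclosed.csSup_mem hne hbdd⟩

theorem tendsto_largestRoot {C : ℕ → ℝ} (hC : Tendsto C atTop atTop) (k : ℕ) :
    Tendsto (fun n => largestRoot (C n) k) atTop atTop ∧
      ∀ᶠ n in atTop, C n * largestRoot (C n) k ^ k * Real.exp (-largestRoot (C n) k ^ 2 / 2) = 1 := by
  have key : ∀ B : ℝ, 0 < B → ∀ᶠ n in atTop, 1 ≤ C n * B ^ k * Real.exp (-B ^ 2 / 2) := by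
    intro B hB
    have hpos : 0 < B ^ k * Real.exp (-B ^ 2 / 2) := by positivity
    filter_upwards [hC.eventually_ge_atTop (1 / (B ^ k * Real.exp (-B ^ 2 / 2)))] with n hn
    rw [div_le_iff₀ hpos] at hn
    linarith
  constructor
  · rw [tendsto_atTop]
    intro B
    filter_upwards [key (max B 1) (by positivity)] with n hn
    exact (le_max_left _ _).trans (largestRoot_spec hn).1
  · filter_upwards [key 1 one_pos] with n hn
    exact (largestRoot_spec hn).2

variable {Ω : Type*} {d : ℕ} (D : KernelData Ω d)

/-- The constant in the equation that defines `a_n(V)`. -/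
noncomputable def rootConst (V : Set (EuclideanSpace ℝ (Fin d))) : ℝ :=
  volume.real V * D.lam ^ ((d : ℝ) / 2) * (2 * Real.pi) ^ (-((d : ℝ) + 1) / 2)

theorem a_eq_largestRoot (n : ℕ) (V : Set (EuclideanSpace ℝ (Fin d))) :
    D.a n V = largestRoot (rootConst D V * (D.h n ^ d)⁻¹) (d - 1) := by
  unfold KernelData.a largestRoot rootConst
  congr 1
  ext x
  simp only [mem_ofPred_eq]
  ring_nf

theorem a_nonneg (hlam : 0 ≤ D.lam) (n : ℕ) (hh : 0 < D.h n) (V : Set (EuclideanSpace ℝ (Fin d))) :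
    0 ≤ D.a n V := by
  rw [a_eq_largestRoot]
  apply largestRoot_nonneg
  unfold rootConst
  have := Real.pi_pos
  positivity

theorem rootConst_pos (hlam : 0 < D.lam) {V : Set (EuclideanSpace ℝ (Fin d))} (hV : 0 < volume V)
    (hV' : volume V ≠ ∞) : 0 < rootConst D V := by
  unfold rootConst
  have h1 : 0 < volume.real V := ENNReal.toReal_pos hV.ne' hV'
  have := Real.pi_pos
  positivity

theorem tendsto_a (hd : 0 < d) (hlam : 0 < D.lam) {V : Set (EuclideanSpace ℝ (Fin d))}
    (hV : 0 < volume V) (hV' : volume V ≠ ∞) (hh : ∀ n, 0 < D.h n) (hh0 : Tendsto D.h atTop (𝓝 0)) :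
    Tendsto (fun n => D.a n V) atTop atTop ∧
      ∀ᶠ n in atTop, rootConst D V * (D.h n ^ d)⁻¹ * D.a n V ^ (d - 1)
        * Real.exp (-D.a n V ^ 2 / 2) = 1 := by
  simp_rw [a_eq_largestRoot]
  apply tendsto_largestRoot
  apply Tendsto.const_mul_atTop (rootConst_pos D hlam hV hV')
  have h1 : Tendsto (fun n => D.h n ^ d) atTop (𝓝[>] 0) := by
    rw [tendsto_nhdsWithin_iff]
    refine ⟨?_, Eventually.of_forall fun n => pow_pos (hh n) d⟩
    have := hh0.pow d
    rwa [zero_pow hd.ne'] at this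
  exact tendsto_inv_nhdsGT_zero.comp h1

end NormalizingConstants

/-! ### The process for a fixed design: maximum and oscillation. -/

section FixedSample

variable {d n : ℕ} {K : ℝ → ℝ} {σ : EuclideanSpace ℝ (Fin d) → ℝ} {κ : KernelConst d K}
  {S : Set (EuclideanSpace ℝ (Fin d))} {h lo hi sl sh q : ℝ}

/-- The number of residue classes of cubes used in the lower bound. -/
noncomputable def KernelConst.classes (κ : KernelConst d K) : ℕ := ⌈2 * κ.R * d / κ.ρ⌉₊ + 1

/-- The constant in the lower bound for the maximum of the process. -/
noncomputable def KernelConst.lowerConst (κ : KernelConst d K) (sl sh q : ℝ) : ℝ :=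
  gaussSum d (κ.sepConst sl sh q ^ 2 / 32) / millsConst ^ 2 * ((κ.classes : ℝ) ^ d * unitBallVol d)

/-- The maximum of the process over a set `V` of positive volume is large: there are finitely many
points of `V`, not depending on the design, at which the process is unlikely to stay below `u`. -/
theorem exists_finset_forall_lt_le (hd : 0 < d) (κ : KernelConst d K)
    (hσ : VarBounds κ σ S h sl sh) (hh : 0 < h) (hsl : 0 < sl) (hsh : 0 < sh) (hlo : 0 < lo)
    (hhi : hi ≤ q * lo) (hq : 0 < q) {V W : Set (EuclideanSpace ℝ (Fin d))} (hVS : V ⊆ S)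
    (hV : 0 < volume V) {a u M : ℝ} (ha : 0 < a) (hu : 1 ≤ u) (hau : a / 2 ≤ u)
    (hVW : ∀ v ∈ V, Metric.ball v (h / a / 2) ⊆ W) (hM : 0 ≤ M) (hWM : volume W ≤ ENNReal.ofReal M) :
    ∃ N : Finset (EuclideanSpace ℝ (Fin d)), (N : Set (EuclideanSpace ℝ (Fin d))) ⊆ V ∧
      ∀ x : Fin n → EuclideanSpace ℝ (Fin d), GoodDesign κ S h lo hi x →
        (stdGaussian (EuclideanSpace ℝ (Fin n))).real
          {U | ∀ v ∈ N, inner ℝ (avec K σ h x v) U < u}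
          ≤ κ.lowerConst sl sh q / volume.real V * (h ^ d / a ^ d * u * Real.exp (u ^ 2 / 2)) := by
  have hρ := κ.ρ_pos
  have hR := κ.R_pos
  have hω := unitBallVol_pos (d := d)
  have hd0 : (0 : ℝ) < d := by exact_mod_cast hd
  have hκ' := κ.sepConst_pos hsl hsh hq
  have hs : 0 < h / a := by positivity
  have hVfin : volume V ≠ ∞ := by
    refine ne_top_of_le_ne_top ENNReal.ofReal_ne_top ((measure_mono fun v hv => ?_).trans hWM)
    exact hVW v hv (Metric.mem_ball_self (by positivity))
  have hVr : 0 < volume.real V := ENNReal.toReal_pos hV.ne' hVfin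
  -- Two points in a common cube of this side are within hρ, the range of the lower increment bound.
  -- Two points in different cubes of a class are more than 2Rh apart in some coordinate, so their
  -- weights are orthogonal. No intermediate distance occurs.
  obtain ⟨V', hV'V, hvol, hcube⟩ := exists_subset_cubes V (ℓ := h * κ.ρ / d) (by positivity)
    (m := κ.classes) (Nat.succ_pos _)
  obtain ⟨N, hNV', hNsep, hNnet, -⟩ := exists_separatedBy_net V' hs
    (fun v hv => hVW v (hV'V hv)) hM hWM
  have hcard : volume.real V ≤ (κ.classes : ℝ) ^ d * (N.card * ((h / a) ^ d * unitBallVol d)) := by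
    have h1 := hvol.trans (mul_le_mul_right (volume_le_of_net hs hNnet) ((κ.classes : ℝ≥0∞) ^ d))
    rw [← ENNReal.ofReal_natCast, ← ENNReal.ofReal_pow (by positivity),
      ← ENNReal.ofReal_mul (by positivity)] at h1
    exact ENNReal.toReal_le_of_le_ofReal (by positivity) h1
  have hNne : N.Nonempty := by
    by_contra hne
    rw [Finset.not_nonempty_iff_eq_empty] at hne
    rw [hne] at hcard
    simp at hcard
    linarith
  have hN0 : (0 : ℝ) < N.card := by exact_mod_cast hNne.card_pos
  refine ⟨N, hNV'.trans hV'V, fun x hx => ?_⟩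
  -- The 32 is 8 from the midpoint bound times 4 from u² ≥ a²/4.
  set β : ℝ := κ.sepConst sl sh q ^ 2 / 32 with hβ
  have hβ0 : 0 < β := by positivity
  have key := stdGaussian_real_forall_inner_lt_le (S := N) hNne (a := fun v => avec K σ h x v)
    (fun v hv => hx.norm_avec hσ hh hsl hlo (hVS (hV'V (hNV' hv)))) hu
    (fun v w => Real.exp (-(β * (dist v w / (h / a)) ^ 2))) (fun _ _ _ _ => (Real.exp_pos _).le)
    (fun v hv w hw hne => ?_) (fun v hv => hNsep.sum_exp_le hs hβ0 v)
  · refine key.trans ?_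
    have hG : 0 ≤ gaussSum d β := tsum_nonneg fun k => by positivity
    have hm := millsConst_pos
    have e : κ.lowerConst sl sh q / volume.real V * (h ^ d / a ^ d * u * Real.exp (u ^ 2 / 2))
        = gaussSum d β / millsConst ^ 2 / (volume.real V / ((κ.classes : ℝ) ^ d * ((h / a) ^ d *
          unitBallVol d)) * (Real.exp (-u ^ 2 / 2) / u)) := by
      have hc : (0 : ℝ) < κ.classes := by exact_mod_cast Nat.succ_pos _
      rw [KernelConst.lowerConst, ← hβ, div_pow, neg_div, Real.exp_neg]
      field_simp
    rw [e]
    have hc : (0 : ℝ) < κ.classes := by exact_mod_cast Nat.succ_pos _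
    gcongr
    rw [div_le_iff₀ (by positivity)]
    linarith
  · rw [Real.exp_le_exp, neg_le_neg_iff]
    have hvS := hVS (hV'V (hNV' hv))
    have hwS := hVS (hV'V (hNV' hw))
    have hdist : ‖v - w‖ ≤ h * κ.ρ := by
      rcases hcube v (hNV' hv) w (hNV' hw) with hc | ⟨k, hk⟩
      · have := norm_le_of_coord_le (u := v - w) (R := h * κ.ρ / d) (by positivity)
          fun k => (hc k).le
        rwa [mul_div_cancel₀ _ hd0.ne'] at this
      · exfalso
        apply hne
        apply inner_avec_eq_zero κ hh (k := k)
        refine lt_of_le_of_lt ?_ hk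
        have h1 : 2 * κ.R * d / κ.ρ ≤ (κ.classes : ℝ) - 1 := by
          rw [KernelConst.classes]
          push_cast
          linarith [Nat.le_ceil (2 * κ.R * d / κ.ρ)]
        calc 2 * κ.R * h = 2 * κ.R * d / κ.ρ * (h * κ.ρ / d) := by field_simp
          _ ≤ _ := by gcongr
    have h1 := hx.le_norm_avec_sub hσ hh hsl hsh hlo hhi hq hvS hwS hdist
    have h2 : (κ.sepConst sl sh q / h * ‖v - w‖) ^ 2
        ≤ ‖avec K σ h x v - avec K σ h x w‖ ^ 2 := by
      gcongr
    have h3 : (a / 2) ^ 2 ≤ u ^ 2 := by gcongr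
    calc β * (dist v w / (h / a)) ^ 2
        = (a / 2) ^ 2 * (κ.sepConst sl sh q / h * ‖v - w‖) ^ 2 / 8 := by
          rw [hβ, dist_eq_norm]
          field_simp
          ring
      _ ≤ _ := by gcongr

/-- Parametrisation by the unit cube of a cube of side `5 * δ` around `v`. -/
noncomputable def cubePoint (v : EuclideanSpace ℝ (Fin d)) (δ : ℝ) (t : Fin d → ℝ) :
    EuclideanSpace ℝ (Fin d) := WithLp.toLp 2 fun i => v i + δ * (5 * t i - 2)

theorem norm_cubePoint_sub_le {v : EuclideanSpace ℝ (Fin d)} {δ : ℝ} (hδ : 0 ≤ δ) {t : Fin d → ℝ}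
    (ht : t ∈ unitCube d) : ‖cubePoint v δ t - v‖ ≤ d * (3 * δ) := by
  refine norm_le_of_coord_le (by positivity) fun k => ?_
  have h1 := ht k
  have e : (cubePoint v δ t - v) k = δ * (5 * t k - 2) := by simp [cubePoint]
  rw [e, abs_mul, abs_of_nonneg hδ, mul_comm]
  gcongr
  rw [abs_le]
  constructor <;> linarith [h1.1, h1.2]

theorem norm_cubePoint_sub_cubePoint_le (v : EuclideanSpace ℝ (Fin d)) {δ : ℝ} (hδ : 0 ≤ δ)
    (t t' : Fin d → ℝ) : ‖cubePoint v δ t - cubePoint v δ t'‖ ≤ d * (5 * δ * ‖t - t'‖) := by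
  refine norm_le_of_coord_le (by positivity) fun k => ?_
  have e : (cubePoint v δ t - cubePoint v δ t') k = 5 * δ * (t - t') k := by
    simp [cubePoint]
    ring
  rw [e, abs_mul, abs_of_nonneg (by positivity)]
  gcongr
  exact norm_le_pi_norm (t - t') k

theorem exists_cubePoint_eq {v w : EuclideanSpace ℝ (Fin d)} {δ : ℝ} (hδ : 0 < δ)
    (hw : dist w v < 2 * δ) : ∃ t ∈ unitCube d, cubePoint v δ t = w := by
  refine ⟨fun i => ((w i - v i) / δ + 2) / 5, fun i => ?_, ?_⟩
  · have h1 : |w i - v i| ≤ dist w v := by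
      rw [dist_eq_norm, ← Real.norm_eq_abs]
      exact PiLp.norm_apply_le (w - v) i
    have h2 : |(w i - v i) / δ| < 2 := by
      rw [abs_div, abs_of_pos hδ, div_lt_iff₀ hδ]
      linarith
    rw [abs_lt] at h2
    constructor
    · linarith [h2.1]
    · dsimp only
      linarith [h2.2]
  · ext i
    simp only [cubePoint]
    field_simp
    ring

/-- The event that, near some point of the net `N`, the process reaches `u` and oscillates. -/
def oscEvent (K : ℝ → ℝ) (σ : EuclideanSpace ℝ (Fin d) → ℝ) (h : ℝ)
    (N : Finset (EuclideanSpace ℝ (Fin d))) (δ a u m : ℝ) :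
    Set ((Fin n → EuclideanSpace ℝ (Fin d)) × EuclideanSpace ℝ (Fin n)) :=
  {p | ∃ v ∈ N, p.2 ∈ badSet (fun t => avec K σ h p.1 (cubePoint v δ t)) a u m}

/-- Some net point y is within δ of v, hence within 2δ of w. Both points lie in the cube around y,
where the dichotomy of `of_notMem_badSet` applies. -/
theorem of_notMem_oscEvent {x : Fin n → EuclideanSpace ℝ (Fin d)} (hx : GoodDesign κ S h lo hi x)
    (hσ : VarBounds κ σ S h sl sh) (hd : 0 < d) (hh : 0 < h) (hsl : 0 < sl) (hsh : 0 < sh)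
    (hlo : 0 < lo) (hhi : hi ≤ q * lo) (hq : 0 < q) {𝓥 : Set (EuclideanSpace ℝ (Fin d))}
    {N : Finset (EuclideanSpace ℝ (Fin d))} {δ a u m : ℝ} (hδ : 0 < δ) (hm : 0 < m)
    (hNS : ∀ v ∈ N, ∀ y, ‖y - v‖ ≤ d * (3 * δ) → y ∈ S)
    (hNnet : ∀ v ∈ 𝓥, ∃ y ∈ N, dist v y < δ)
    (haε : 4 * a * (κ.lipConst sl sh q / h * (d * (5 * δ))) ^ 2 ≤ m)
    {U : EuclideanSpace ℝ (Fin n)} (hU : (x, U) ∉ oscEvent K σ h N δ a u m)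
    {v : EuclideanSpace ℝ (Fin d)} (hv : v ∈ 𝓥) :
    inner ℝ (avec K σ h x v) U < u ∨
      ((∀ w, dist w v < δ → inner ℝ (avec K σ h x v) U - inner ℝ (avec K σ h x w) U ≤ 3 * m) ∧
        inner ℝ (avec K σ h x v) U ≤ 4 * a + 2 * m) := by
  obtain ⟨y, hy, hvy⟩ := hNnet v hv
  have hΛ := κ.lipConst_pos hsl hsh hq
  have hd0 : (0 : ℝ) < d := by exact_mod_cast hd
  have hUb : U ∉ badSet (fun t => avec K σ h x (cubePoint y δ t)) a u m := fun hb => hU ⟨y, hy, hb⟩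
  have hS : ∀ t ∈ unitCube d, cubePoint y δ t ∈ S := fun t ht =>
    hNS y hy _ (norm_cubePoint_sub_le hδ.le ht)
  have key := of_notMem_badSet (c := fun t => avec K σ h x (cubePoint y δ t)) (a := a) (u := u)
    (m := m) (ε := κ.lipConst sl sh q / h * (d * (5 * δ))) hm (by positivity)
    (fun t ht => hx.norm_avec hσ hh hsl hlo (hS t ht))
    (fun t ht t' ht' => by
      refine (hx.norm_avec_sub_le hσ hh hsl hsh hlo hhi hq (hS t ht) (hS t' ht')).trans ?_
      rw [mul_assoc]
      gcongr
      refine (norm_cubePoint_sub_cubePoint_le y hδ.le t t').trans (le_of_eq ?_)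
      ring) haε hUb
  obtain ⟨t, ht, htv⟩ := exists_cubePoint_eq (v := y) (w := v) hδ (by linarith)
  rcases key with h1 | ⟨h1, h2⟩
  · left
    have := h1 t ht
    rwa [htv] at this
  · right
    constructor
    · intro w hw
      have hwy : dist w y < 2 * δ := by
        have := dist_triangle w v y
        linarith
      obtain ⟨t', ht', htw⟩ := exists_cubePoint_eq (v := y) (w := w) hδ hwy
      have := h1 t ht t' ht'
      rwa [htv, htw] at this
    · have := h2 t ht
      rwa [htv] at this

theorem stdGaussian_oscEvent_le {x : Fin n → EuclideanSpace ℝ (Fin d)}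
    (hx : GoodDesign κ S h lo hi x)
    (hσ : VarBounds κ σ S h sl sh) (hd : 0 < d) (hh : 0 < h) (hsl : 0 < sl) (hsh : 0 < sh)
    (hlo : 0 < lo) (hhi : hi ≤ q * lo) (hq : 0 < q)
    {N : Finset (EuclideanSpace ℝ (Fin d))} {δ a u m Y : ℝ} (hδ : 0 < δ) (hm : 0 < m)
    (hNS : ∀ v ∈ N, ∀ y, ‖y - v‖ ≤ d * (3 * δ) → y ∈ S) (hu : 1 ≤ u) (hua : u ≤ a)
    (hY : 8 * a * m ≤ Y)
    (hH : 16 * (d + Y + 1) ≤ (m / (κ.lipConst sl sh q / h * (d * (5 * δ)))) ^ 2) :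
    stdGaussian (EuclideanSpace ℝ (Fin n)) (Prod.mk x ⁻¹' oscEvent K σ h N δ a u m)
      ≤ ENNReal.ofReal (N.card * (2 ^ (d + 3) / u * Real.exp (-u ^ 2 / 2) *
        Real.exp (-(m / (κ.lipConst sl sh q / h * (d * (5 * δ)))) ^ 2 / 16)
        + 2 * Real.exp (-(8 * a ^ 2)))) := by
  have hΛ := κ.lipConst_pos hsl hsh hq
  have hd0 : (0 : ℝ) < d := by exact_mod_cast hd
  have e : Prod.mk x ⁻¹' oscEvent K σ h N δ a u m
      = ⋃ v ∈ N, badSet (fun t => avec K σ h x (cubePoint v δ t)) a u m := by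
    ext U
    simp [oscEvent]
  rw [e]
  refine (measure_biUnion_finset_le _ _).trans ((Finset.sum_le_sum fun v hv => ?_).trans
    (le_of_eq (?_ : ∑ _v ∈ N, ENNReal.ofReal (2 ^ (d + 3) / u * Real.exp (-u ^ 2 / 2) *
        Real.exp (-(m / (κ.lipConst sl sh q / h * (d * (5 * δ)))) ^ 2 / 16)
        + 2 * Real.exp (-(8 * a ^ 2))) = _)))
  · have hS : ∀ t ∈ unitCube d, cubePoint v δ t ∈ S := fun t ht =>
      hNS v hv _ (norm_cubePoint_sub_le hδ.le ht)
    exact stdGaussian_badSet_le (c := fun t => avec K σ h x (cubePoint v δ t)) hm (by positivity) hu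
      hua hY (hx.norm_avec hσ hh hsl hlo (hS 0 zero_mem_unitCube))
      (fun t ht t' ht' => by
        refine (hx.norm_avec_sub_le hσ hh hsl hsh hlo hhi hq (hS t ht) (hS t' ht')).trans ?_
        rw [mul_assoc]
        gcongr
        refine (norm_cubePoint_sub_cubePoint_le v hδ.le t t').trans (le_of_eq ?_)
        ring) hH
  · rw [Finset.sum_const, nsmul_eq_mul, ← ENNReal.ofReal_natCast, ← ENNReal.ofReal_mul (by positivity)]

theorem measurable_avec (hK : Continuous K) (hσm : Measurable σ) (h : ℝ)
    (v : EuclideanSpace ℝ (Fin d)) :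
    Measurable fun x : Fin n → EuclideanSpace ℝ (Fin d) => avec K σ h x v := by
  have hprod : Continuous (prodK K : EuclideanSpace ℝ (Fin d) → ℝ) := by
    unfold prodK
    exact continuous_finsetProd _ fun i _ => hK.comp (EuclideanSpace.proj (𝕜 := ℝ) i).continuous
  have hg : Measurable fun x : Fin n → EuclideanSpace ℝ (Fin d) => gvec K σ h x v := by
    unfold gvec
    refine (WithLp.measurable_toLp 2 (Fin n → ℝ)).comp ?_
    rw [measurable_pi_iff]
    intro i
    have hi : Measurable fun x : Fin n → EuclideanSpace ℝ (Fin d) => x i := measurable_pi_apply i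
    exact (hσm.comp hi).mul (hprod.measurable.comp ((hi.const_sub v).fun_const_smul h⁻¹))
  exact hg.norm.inv.smul hg

/-- Only countably many inner products enter the bad event, so it is jointly measurable in design
and Gaussian vector, as Fubini requires. A supremum over v would not be visibly measurable. -/
theorem measurableSet_oscEvent (hK : Continuous K) (hσm : Measurable σ) (h : ℝ)
    (N : Finset (EuclideanSpace ℝ (Fin d))) (δ a u m : ℝ) :
    MeasurableSet (oscEvent (n := n) K σ h N δ a u m) := by
  have hm : ∀ v, Measurable fun p : (Fin n → EuclideanSpace ℝ (Fin d)) × EuclideanSpace ℝ (Fin n) =>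
      avec K σ h p.1 v := fun v => (measurable_avec hK hσm h v).comp measurable_fst
  have e : oscEvent (n := n) K σ h N δ a u m
      = ⋃ v ∈ N, {p | p.2 ∈ badSet (fun t => avec K σ h p.1 (cubePoint v δ t)) a u m} := by
    ext p
    simp [oscEvent]
  rw [e]
  refine N.measurableSet_biUnion fun v _ => ?_
  have h0 : Measurable fun p : (Fin n → EuclideanSpace ℝ (Fin d)) × EuclideanSpace ℝ (Fin n) =>
      (inner ℝ (avec K σ h p.1 (cubePoint v δ 0)) p.2 : ℝ) := (hm _).inner measurable_snd
  have hlink : ∀ k (z : Fin d → Fin (2 ^ (k + 1))),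
      Measurable fun p : (Fin n → EuclideanSpace ℝ (Fin d)) × EuclideanSpace ℝ (Fin n) =>
      (inner ℝ (linkVec (fun t => avec K σ h p.1 (cubePoint v δ t)) k z) p.2 : ℝ) := by
    intro k z
    refine Measurable.inner ?_ measurable_snd
    unfold linkVec perp
    have h1 : Measurable fun p : (Fin n → EuclideanSpace ℝ (Fin d)) × EuclideanSpace ℝ (Fin n) =>
        avec K σ h p.1 (cubePoint v δ (dyadicPoint (k + 1) z))
          - avec K σ h p.1 (cubePoint v δ (dyadicFloor k (dyadicPoint (k + 1) z))) :=
      (hm _).sub (hm _)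
    have h2 : Measurable fun p : (Fin n → EuclideanSpace ℝ (Fin d)) × EuclideanSpace ℝ (Fin n) =>
        (inner ℝ (avec K σ h p.1 (cubePoint v δ 0))
          (avec K σ h p.1 (cubePoint v δ (dyadicPoint (k + 1) z))
          - avec K σ h p.1 (cubePoint v δ (dyadicFloor k (dyadicPoint (k + 1) z)))) : ℝ) :=
      (hm _).inner h1
    exact h1.sub (h2.smul (hm _))
  have e2 : {p : (Fin n → EuclideanSpace ℝ (Fin d)) × EuclideanSpace ℝ (Fin n) |
      p.2 ∈ badSet (fun t => avec K σ h p.1 (cubePoint v δ t)) a u m}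
      = (⋃ (j : ℕ) (k : ℕ) (z : Fin d → Fin (2 ^ (k + 1))),
        {p | u - 2 * (j + 2) * m ≤ inner ℝ (avec K σ h p.1 (cubePoint v δ 0)) p.2} ∩
          {p | (j + 1) * m * ((3 / 4) ^ k / 4)
            ≤ |inner ℝ (linkVec (fun t => avec K σ h p.1 (cubePoint v δ t)) k z) p.2|}) ∪
        {p | 4 * a ≤ |inner ℝ (avec K σ h p.1 (cubePoint v δ 0)) p.2|} := by
    ext p
    simp [badSet]
  rw [e2]
  refine MeasurableSet.union (MeasurableSet.iUnion fun j => MeasurableSet.iUnion fun k =>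
    MeasurableSet.iUnion fun z => MeasurableSet.inter ?_ ?_) ?_
  · exact measurableSet_le measurable_const h0
  · exact measurableSet_le measurable_const (hlink k z).norm
  · exact measurableSet_le measurable_const h0.norm

end FixedSample

/-! ### Integrating conditional bounds over the design. -/

section JointLaw

variable {Ω : Type*} [MeasurableSpace Ω] {P : Measure Ω} [IsProbabilityMeasure P]
  {α β : Type*} [MeasurableSpace α] [MeasurableSpace β] [StandardBorelSpace β] [Nonempty β]

/-- If `Y` is independent of `X`, in the sense of regular conditional distributions, then
bounds on the sections of an event give a bound on its probability. -/
theorem measure_mem_le_of_condDistrib {X : Ω → α} {Y : Ω → β} (hX : Measurable X)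
    (hY : Measurable Y) {γ : Measure β} [IsProbabilityMeasure γ]
    (hlaw : condDistrib Y X P =ᵐ[P.map X] fun _ => γ) {G : Set α} (hG : MeasurableSet G)
    {B : Set (α × β)} (hB : MeasurableSet B) {b : ℝ≥0∞} (hb : ∀ x ∈ G, γ (Prod.mk x ⁻¹' B) ≤ b) :
    P {ω | X ω ∈ G ∧ (X ω, Y ω) ∈ B} ≤ b := by
  have : IsProbabilityMeasure (P.map X) := Measure.isProbabilityMeasure_map hX.aemeasurable
  have hjoint : P.map (fun ω => (X ω, Y ω)) = (P.map X).prod γ := by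
    rw [← compProd_map_condDistrib (X := X) hY.aemeasurable,
      Measure.compProd_congr (η := Kernel.const α γ) hlaw, Measure.compProd_const]
  have hGB : MeasurableSet ((G ×ˢ univ) ∩ B) := (hG.prod MeasurableSet.univ).inter hB
  have e : {ω | X ω ∈ G ∧ (X ω, Y ω) ∈ B} = (fun ω => (X ω, Y ω)) ⁻¹' ((G ×ˢ univ) ∩ B) := by
    ext ω
    simp
  rw [e, ← Measure.map_apply (hX.prodMk hY) hGB, hjoint, Measure.prod_apply hGB]
  calc _ ≤ ∫⁻ _x, b ∂(P.map X) := by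
        refine lintegral_mono fun x => ?_
        by_cases hx : x ∈ G
        · refine (measure_mono fun y hy => ?_).trans (hb x hx)
          exact hy.2
        · have : Prod.mk x ⁻¹' ((G ×ˢ univ) ∩ B) = ∅ := by
            ext y
            simp [hx]
          rw [this]
          simp
    _ = b := by simp

end JointLaw

/-! ### Good designs with probability tending to one, and the gradient of α_n. -/

section DesignSetup

variable {Ω : Type*} [MeasurableSpace Ω] {d : ℕ}

/-- Constants and events that describe good designs for the data `D`. -/
structure DesignSetup (P : Measure Ω) (D : KernelData Ω d) where
  κ : KernelConst d D.K
  (sl sh q M η : ℝ)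
  (lo hi : ℕ → ℝ)
  G : (n : ℕ) → Set (Fin n → EuclideanSpace ℝ (Fin d))
  sl_pos : 0 < sl
  sh_pos : 0 < sh
  q_pos : 0 < q
  M_pos : 0 < M
  η_pos : 0 < η
  f_pos : ∀ v ∈ Metric.thickening (η / 4) D.𝓥, 0 < D.f v
  volume_le : volume (Metric.thickening η D.𝓥) ≤ ENNReal.ofReal M
  measurable_G : ∀ n, MeasurableSet (G n)
  tendsto_G : Tendsto (fun n => P {ω | (fun i : Fin n => D.X i ω) ∉ G n}) atTop (𝓝 0)
  good : ∀ᶠ n in atTop, 0 < n ∧ 0 < lo n ∧ hi n ≤ q * lo n ∧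
    VarBounds κ D.σ (Metric.thickening (η / 4) D.𝓥) (D.h n) sl sh ∧
    ∀ x ∈ G n, GoodDesign κ (Metric.thickening (η / 4) D.𝓥) (D.h n) (lo n) (hi n) x

/-- Eventually log n ≤ (n h^d)^{1/2}, so the exponential is at most exp(-c log² n) ≤ n⁻², while
h^{-d} ≤ n. The factor h^{-d} is the order of the size of the net in the union bound. -/
theorem tendsto_inv_mul_exp_of_rate {h : ℕ → ℝ} (hh : ∀ n, 0 < h n) {c : ℝ} (hc : 0 < c)
    (hrate : Tendsto (fun n : ℕ => Real.log n / Real.sqrt (n * h n ^ d)) atTop (𝓝 0)) :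
    Tendsto (fun n : ℕ => (h n ^ d)⁻¹ * Real.exp (-(c * (n * h n ^ d)))) atTop (𝓝 0) := by
  have hlog : Tendsto (fun n : ℕ => Real.log n) atTop atTop :=
    Real.tendsto_log_atTop.comp tendsto_natCast_atTop_atTop
  refine squeeze_zero' (g := fun n : ℕ => ((n : ℝ))⁻¹)
    (Eventually.of_forall fun n => by have := hh n; positivity) ?_ tendsto_inv_atTop_nhds_zero_nat
  filter_upwards [hrate.eventually (ge_mem_nhds (zero_lt_one : (0 : ℝ) < 1)),
    hlog.eventually_ge_atTop (2 / c), hlog.eventually_ge_atTop 1, eventually_gt_atTop 0]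
    with n h1 h2 h3 h4
  have hn : (0 : ℝ) < n := by exact_mod_cast h4
  have hhd : 0 < h n ^ d := pow_pos (hh n) d
  have hy : 0 < n * h n ^ d := by positivity
  have h5 : Real.log n ≤ Real.sqrt (n * h n ^ d) := by
    rwa [div_le_one (Real.sqrt_pos.2 hy)] at h1
  have h6 : Real.log n ^ 2 ≤ n * h n ^ d := by
    rw [← Real.sq_sqrt hy.le]
    gcongr
  have h7 : 2 * Real.log n ≤ c * (n * h n ^ d) := by
    rw [div_le_iff₀ hc] at h2
    nlinarith
  have h8 : Real.exp (-(c * (n * h n ^ d))) ≤ (n : ℝ)⁻¹ * (n : ℝ)⁻¹ := by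
    calc _ ≤ Real.exp (-(2 * Real.log n)) := by gcongr
      _ = _ := by
        rw [Real.exp_neg, two_mul, Real.exp_add, Real.exp_log hn, mul_inv]
  have h9 : (h n ^ d)⁻¹ ≤ n := by
    rw [inv_le_iff_one_le_mul₀ hhd]
    nlinarith
  calc _ ≤ (n : ℝ) * ((n : ℝ)⁻¹ * (n : ℝ)⁻¹) := by gcongr
    _ = _ := by field_simp

theorem nonempty_designSetup {P : Measure Ω} [IsProbabilityMeasure P] (hd : 0 < d)
    {D : KernelData Ω d} (hR : D.Regular P) : Nonempty (DesignSetup P D) := by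
  obtain ⟨κ⟩ := nonempty_kernelConst hd hR.kernel_smooth hR.kernel_compact hR.kernel_ne_zero
  obtain ⟨η, hη, c, hc, C, -, hfd, hb⟩ := hR.local_regularity
  obtain ⟨F, hcF, hF, hvol⟩ := exists_local_bounds (X := D.X) (hR.design_law 0)
    (hR.design_measurable 0) hη hc hfd hb
  have hFp : 0 < F := hc.trans_le hcF
  have hlow := κ.countLow_pos hc
  have hhigh := κ.countHigh_pos hFp
  have hρ := κ.ρ_pos
  have hκR := κ.R_pos
  have hω := unitBallVol_pos (d := d)
  have hd0 : (0 : ℝ) < d := by exact_mod_cast hd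
  have hev : ∀ᶠ n in atTop, D.h n * (d * κ.R + κ.ρ) ≤ η / 4 := by
    have h1 : Tendsto (fun n => D.h n * (d * κ.R + κ.ρ)) atTop (𝓝 0) := by
      simpa using hR.bandwidth_tendsto.mul_const (d * κ.R + κ.ρ)
    exact h1.eventually (ge_mem_nhds (by positivity))
  have hnear : ∀ v ∈ Metric.thickening (η / 4) D.𝓥, ∀ y, dist y v < η / 4 →
      y ∈ Metric.thickening (η / 2) D.𝓥 := by
    intro v hv y hy
    rw [Metric.mem_thickening_iff] at hv ⊢
    obtain ⟨z, hz, hvz⟩ := hv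
    exact ⟨z, hz, by linarith [dist_triangle y v z]⟩
  have hmono : Metric.thickening (η / 2) D.𝓥 ⊆ Metric.thickening η D.𝓥 :=
    Metric.thickening_mono (by linarith) _
  have hmono' : Metric.thickening (η / 4) D.𝓥 ⊆ Metric.thickening η D.𝓥 :=
    Metric.thickening_mono (by linarith) _
  have hG : ∀ n, ∃ G : Set (Fin n → EuclideanSpace ℝ (Fin d)), MeasurableSet G ∧
      (D.h n * (d * κ.R + κ.ρ) ≤ η / 4 →
        (∀ x ∈ G, GoodDesign κ (Metric.thickening (η / 4) D.𝓥) (D.h n)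
          (κ.countLow c * (n * D.h n ^ d)) (κ.countHigh F * (n * D.h n ^ d)) x) ∧
        P {ω | (fun i : Fin n => D.X i ω) ∉ G} ≤ ENNReal.ofReal
          ((1 / c) / ((D.h n * κ.ρ / 4) ^ d * unitBallVol d) *
          ((d + 2) * Real.exp (-(κ.countLow c * (n * D.h n ^ d)))))) := by
    intro n
    by_cases hn : D.h n * (d * κ.R + κ.ρ) ≤ η / 4
    · obtain ⟨G, hGm, hG1, hG2⟩ := exists_measurable_goodDesign κ hR.design_indep
        hR.design_measurable hR.design_law (S := Metric.thickening (η / 4) D.𝓥)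
        (W := Metric.thickening η D.𝓥) (M := 1 / c) (hR.bandwidth_pos n) hc hcF
        (fun v hv y hy => by
          have h1 := hnear v hv y (hy.trans_le hn)
          exact ⟨hmono h1, (hb y (hmono h1)).2.2.1, hF y h1⟩) (by positivity) hvol n
      exact ⟨G, hGm, fun _ => ⟨hG1, hG2⟩⟩
    · exact ⟨∅, MeasurableSet.empty, fun h => absurd h hn⟩
  choose G hGm hG using hG
  refine ⟨⟨κ, c, max c C, κ.countHigh F / κ.countLow c, 1 / c, η,
    fun n => κ.countLow c * (n * D.h n ^ d), fun n => κ.countHigh F * (n * D.h n ^ d), G, hc,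
    lt_max_of_lt_left hc, by positivity, by positivity, hη,
    fun v hv => hc.trans_le (hb v (hmono' hv)).2.2.1, hvol, hGm, ?_, ?_⟩⟩
  · have h1 := (tendsto_inv_mul_exp_of_rate hR.bandwidth_pos hlow hR.bandwidth_rate).const_mul
      ((1 / c) / ((κ.ρ / 4) ^ d * unitBallVol d) * (d + 2))
    rw [mul_zero] at h1
    have h2 := ENNReal.tendsto_ofReal h1
    rw [ENNReal.ofReal_zero] at h2
    refine tendsto_of_tendsto_of_tendsto_of_le_of_le' tendsto_const_nhds h2
      (Eventually.of_forall fun _ => zero_le) ?_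
    filter_upwards [hev] with n hn
    refine (hG n hn).2.trans (le_of_eq ?_)
    congr 1
    have := hR.bandwidth_pos n
    rw [mul_div_assoc, mul_pow]
    field_simp
  · filter_upwards [hev, eventually_gt_atTop 0] with n hn hn0
    have hhn := hR.bandwidth_pos n
    have hn' : (0 : ℝ) < n := by exact_mod_cast hn0
    refine ⟨hn0, by positivity, le_of_eq (by field_simp), fun v hv y hy => ?_, (hG n hn).1⟩
    have h1 := hnear v hv y (hy.trans_lt (lt_of_lt_of_le (by
      rw [mul_add]
      linarith [mul_pos hhn hρ]) hn))
    have h2 := hb y (hmono h1)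
    exact ⟨h2.1, h2.2.1.trans (le_max_right _ _)⟩

variable {D : KernelData Ω d}

theorem alpha_eq_avec {Ω : Type*} {D : KernelData Ω d} {n : ℕ} (hn : 0 < n) (hh : 0 < D.h n) (ω : Ω) {v : EuclideanSpace ℝ (Fin d)}
    (hf : 0 < D.f v) :
    D.alpha n ω v = avec D.K D.σ (D.h n) (fun i : Fin n => D.X i ω) v := by
  have hn' : (0 : ℝ) < n := by exact_mod_cast hn
  have hc : 0 < Real.sqrt (n * D.h n ^ d) * D.f v := by
    have := pow_pos hh d
    positivity
  have hw : D.w n ω v = (Real.sqrt (n * D.h n ^ d) * D.f v)⁻¹ •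
      gvec D.K D.σ (D.h n) (fun i : Fin n => D.X i ω) v := by
    ext i
    simp [KernelData.w, gvec, KernelData.prodKernel, prodK, div_eq_inv_mul]
  rw [KernelData.alpha, avec, hw, norm_smul, smul_smul, norm_inv, Real.norm_of_nonneg hc.le]
  congr 1
  field_simp

theorem differentiableAt_avec {n : ℕ} {K : ℝ → ℝ} {σ : EuclideanSpace ℝ (Fin d) → ℝ} {h : ℝ}
    {x : Fin n → EuclideanSpace ℝ (Fin d)} {v : EuclideanSpace ℝ (Fin d)} (hK : ContDiff ℝ 1 K)
    (hv : gvec K σ h x v ≠ 0) : DifferentiableAt ℝ (avec K σ h x) v := by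
  have hP := (contDiff_prodK (d := d) hK).differentiable (by norm_num)
  have hg : DifferentiableAt ℝ (gvec K σ h x) v := by
    rw [differentiableAt_euclidean]
    intro i
    unfold gvec
    have h1 : DifferentiableAt ℝ (fun w : EuclideanSpace ℝ (Fin d) => h⁻¹ • (w - x i)) v :=
      (differentiableAt_id.sub_const (x i)).const_smul h⁻¹
    exact ((hP _).comp v h1).const_mul _
  exact ((hg.norm ℝ hv).inv (norm_ne_zero_iff.2 hv)).smul hg

theorem le_norm_of_hasFDerivAt {E F : Type*} [NormedAddCommGroup E] [NormedSpace ℝ E]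
    [Nontrivial E] [NormedAddCommGroup F] [NormedSpace ℝ F] {φ : E → F} {φ' : E →L[ℝ] F} {v : E}
    (hφ : HasFDerivAt φ φ' v) {c : ℝ} (hc : ∀ᶠ w in 𝓝 v, c * ‖w - v‖ ≤ ‖φ w - φ v‖) :
    c ≤ ‖φ'‖ := by
  refine le_of_forall_pos_le_add fun ε hε => ?_
  have h1 := hφ.isLittleO.def hε
  obtain ⟨w, ⟨hw1, hw2⟩, hwv⟩ := ((((hc.and h1).filter_mono nhdsWithin_le_nhds).and
    (self_mem_nhdsWithin (s := {v}ᶜ) (a := v)))).exists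
  have hpos : 0 < ‖w - v‖ := norm_pos_iff.2 (sub_ne_zero.2 hwv)
  have h2 := norm_le_norm_add_norm_sub' (φ w - φ v) (φ' (w - v))
  have h3 := φ'.le_opNorm (w - v)
  have h4 : c * ‖w - v‖ ≤ (‖φ'‖ + ε) * ‖w - v‖ := by linarith
  exact le_of_mul_le_mul_right h4 hpos

variable {P : Measure Ω} {n : ℕ} {ω : Ω}

/-- The Lipschitz constant of the normalised weights at the scale of the bandwidth. -/
noncomputable def DesignSetup.lip (T : DesignSetup P D) : ℝ := T.κ.lipConst T.sl T.sh T.q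

/-- The constant in the lower bound for the increments of the normalised weights. -/
noncomputable def DesignSetup.sep (T : DesignSetup P D) : ℝ := T.κ.sepConst T.sl T.sh T.q

theorem DesignSetup.lip_pos (T : DesignSetup P D) : 0 < T.lip :=
  T.κ.lipConst_pos T.sl_pos T.sh_pos T.q_pos

theorem DesignSetup.sep_pos (T : DesignSetup P D) : 0 < T.sep :=
  T.κ.sepConst_pos T.sl_pos T.sh_pos T.q_pos

/-- Around 𝓥 the map α_n coincides with `avec`, because f_V and (n h^d)^{1/2} cancel in the
normalisation; the two-sided increment bounds then pass to the derivative. -/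
theorem DesignSetup.eventually_gradNorm (T : DesignSetup P D) (hd : 0 < d) (hR : D.Regular P) :
    ∀ᶠ n in atTop, ∀ ω, (fun i : Fin n => D.X i ω) ∈ T.G n →
      ∀ v ∈ D.𝓥, D.gradNorm n ω v ≤ ENNReal.ofReal (T.lip * (D.h n)⁻¹) ∧
        ENNReal.ofReal (T.sep * (D.h n)⁻¹) ≤ D.gradNorm n ω v := by
  filter_upwards [T.good] with n ⟨hn, hlo, hhi, hσ, hG⟩ ω hω v hv
  have hh := hR.bandwidth_pos n
  have : Nonempty (Fin d) := ⟨⟨0, hd⟩⟩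
  have hx := hG _ hω
  have hS : Metric.thickening (T.η / 4) D.𝓥 ∈ 𝓝 v :=
    Metric.isOpen_thickening.mem_nhds (Metric.self_subset_thickening (by linarith [T.η_pos]) _ hv)
  have hvS := mem_of_mem_nhds hS
  have hev : D.alpha n ω =ᶠ[𝓝 v] avec D.K D.σ (D.h n) (fun i : Fin n => D.X i ω) := by
    filter_upwards [hS] with w hw
    exact alpha_eq_avec hn hh ω (T.f_pos w hw)
  have hdiff : DifferentiableAt ℝ (avec D.K D.σ (D.h n) (fun i : Fin n => D.X i ω)) v :=
    differentiableAt_avec hR.kernel_smooth (hx.gvec_ne_zero hσ hh T.sl_pos hlo hvS)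
  have hL := T.lip_pos
  have hρ := T.κ.ρ_pos
  rw [KernelData.gradNorm, if_pos (hev.differentiableAt_iff.2 hdiff), hev.fderiv_eq,
    ← ofReal_norm]
  constructor
  · refine ENNReal.ofReal_le_ofReal ?_
    refine hdiff.hasFDerivAt.le_of_lip' (by positivity) ?_
    filter_upwards [hS] with w hw
    exact hx.norm_avec_sub_le hσ hh T.sl_pos T.sh_pos hlo hhi T.q_pos hw hvS
  · refine ENNReal.ofReal_le_ofReal (le_norm_of_hasFDerivAt hdiff.hasFDerivAt ?_)
    filter_upwards [hS, Metric.closedBall_mem_nhds v (mul_pos hh hρ)] with w hw hw'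
    rw [Metric.mem_closedBall, dist_eq_norm] at hw'
    exact hx.le_norm_avec_sub hσ hh T.sl_pos T.sh_pos hlo hhi T.q_pos hw hvS hw'

theorem DesignSetup.isBigOInProb_supGradNorm (T : DesignSetup P D) (hd : 0 < d)
    (hR : D.Regular P) : IsBigOInProb P D.supGradNorm (fun n => (D.h n)⁻¹) := by
  intro ε hε
  have hL := T.lip_pos
  refine ⟨Real.toNNReal T.lip, ?_⟩
  filter_upwards [T.eventually_gradNorm hd hR, T.tendsto_G.eventually (ge_mem_nhds hε)]
    with n hn hP
  refine (measure_mono fun ω hω => ?_).trans hP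
  intro hG
  refine (not_le.2 hω) (iSup₂_le fun v hv => (hn ω hG v hv).1.trans (le_of_eq ?_))
  rw [ENNReal.ofReal_mul hL.le]
  rfl

/-- The sequence b_n / h_n is deterministic, so for each large n a single ω suffices. Two
exceptional events of probability below 1/2 leave one, with a good design and a small product; there
the gradient is at least `T.sep` / h_n. -/
theorem DesignSetup.tendsto_of_supGradNorm [IsProbabilityMeasure P] (T : DesignSetup P D)
    (hd : 0 < d) (hR : D.Regular P) (hne : D.𝓥.Nonempty) {b : ℕ → ℝ} (hb : ∀ n, 0 ≤ b n)
    (h : TendsToZeroInProb P fun n ω => ENNReal.ofReal (b n) * D.supGradNorm n ω) :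
    Tendsto (fun n => b n / D.h n) atTop (𝓝 0) := by
  have hs := T.sep_pos
  obtain ⟨v, hv⟩ := hne
  rw [tendsto_order]
  refine ⟨fun c hc => Eventually.of_forall fun n => hc.trans_le
    (div_nonneg (hb n) (hR.bandwidth_pos n).le), fun ε hε => ?_⟩
  have hhalf : (0 : ℝ≥0∞) < 1 / 2 := by simp
  filter_upwards [T.eventually_gradNorm hd hR, T.tendsto_G.eventually_lt_const hhalf,
    (h (ENNReal.ofReal (ε * T.sep)) (ENNReal.ofReal_pos.2 (mul_pos hε hs))).eventually_lt_const
      hhalf] with n hn h1 h2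
  have hh := hR.bandwidth_pos n
  have h3 : P ({ω | (fun i : Fin n => D.X i ω) ∉ T.G n} ∪
      {ω | ENNReal.ofReal (ε * T.sep) ≤ ENNReal.ofReal (b n) * D.supGradNorm n ω}) < 1 :=
    (measure_union_le _ _).trans_lt ((ENNReal.add_lt_add h1 h2).trans_le (by
      rw [ENNReal.add_halves]))
  obtain ⟨ω, hω⟩ : ∃ ω, ω ∉ ({ω | (fun i : Fin n => D.X i ω) ∉ T.G n} ∪
      {ω | ENNReal.ofReal (ε * T.sep) ≤ ENNReal.ofReal (b n) * D.supGradNorm n ω}) := by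
    by_contra! hall
    rw [eq_univ_of_forall hall, measure_univ] at h3
    exact lt_irrefl _ h3
  rw [mem_union, not_or] at hω
  have hG := not_not.1 hω.1
  have h4 : ENNReal.ofReal (b n) * D.supGradNorm n ω < ENNReal.ofReal (ε * T.sep) :=
    not_le.1 hω.2
  have h5 : ENNReal.ofReal (b n) * ENNReal.ofReal (T.sep * (D.h n)⁻¹)
      < ENNReal.ofReal (ε * T.sep) := by
    refine lt_of_le_of_lt ?_ h4
    gcongr
    exact (hn ω hG v hv).2.trans (le_iSup₂ (f := fun v (_ : v ∈ D.𝓥) => D.gradNorm n ω v) v hv)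
  rw [← ENNReal.ofReal_mul (hb n), ENNReal.ofReal_lt_ofReal_iff (mul_pos hε hs)] at h5
  have h6 : b n / D.h n * T.sep < ε * T.sep := by
    rw [div_eq_mul_inv]
    linarith
  exact lt_of_mul_lt_mul_right h6 hs.le

end DesignSetup

/-! ### Consequences of the equation that defines a_n(V). -/

section Scales

variable {d : ℕ} {h a k ρ : ℝ}

/-- Equivalently, (a/h)^d cells of mesh h/a times the Gaussian tail order e^{-a²/2}/a give exactly
1/ρ: a bounded mean number of exceedances of a. -/
theorem inv_pow_eq_of_root (hd : 0 < d) (hh : 0 < h) (ha : 0 < a)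
    (heq : ρ * (h ^ d)⁻¹ * a ^ (d - 1) * Real.exp (-a ^ 2 / 2) = 1) :
    h ^ d * a / a ^ d = ρ * Real.exp (-a ^ 2 / 2) := by
  have hp : a ^ d = a ^ (d - 1) * a := by
    rw [← pow_succ, Nat.sub_add_cancel hd]
  have hhd := pow_pos hh d
  rw [hp]
  field_simp
  field_simp at heq
  linarith

theorem sub_div_bounds (ha : 1 ≤ a) (hk : 0 ≤ k) (hka : 2 * k ≤ a) :
    a / 2 ≤ a - k / a ∧ a - k / a ≤ a ∧ a ^ 2 - 2 * k ≤ (a - k / a) ^ 2 ∧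
      (a - k / a) ^ 2 ≤ a ^ 2 - 2 * k + 1 := by
  have ha0 : 0 < a := by linarith
  have h1 : k / a ≤ 1 / 2 := by
    rw [div_le_div_iff₀ ha0 two_pos]
    linarith
  have h2 : 0 ≤ k / a := by positivity
  have e : (a - k / a) ^ 2 = a ^ 2 - 2 * k + (k / a) ^ 2 := by
    field_simp
    ring
  refine ⟨by linarith, by linarith, ?_, ?_⟩
  · rw [e]
    nlinarith
  · rw [e]
    nlinarith

/-- Lowering the level from a to a - k/a multiplies the mean number of exceedances by about e^k; the
second moment bound is the reciprocal of that number. -/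
theorem lower_scale_le (hd : 0 < d) (hh : 0 < h) (ha : 1 ≤ a) (hk : 0 ≤ k) (hka : 2 * k ≤ a)
    (heq : ρ * (h ^ d)⁻¹ * a ^ (d - 1) * Real.exp (-a ^ 2 / 2) = 1) :
    h ^ d / a ^ d * (a - k / a) * Real.exp ((a - k / a) ^ 2 / 2) ≤ ρ * Real.exp (1 / 2 - k) := by
  have ha0 : 0 < a := by linarith
  obtain ⟨h1, h2, h3, h4⟩ := sub_div_bounds ha hk hka
  calc h ^ d / a ^ d * (a - k / a) * Real.exp ((a - k / a) ^ 2 / 2)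
      ≤ h ^ d / a ^ d * a * Real.exp ((a ^ 2 - 2 * k + 1) / 2) := by gcongr
    _ = h ^ d * a / a ^ d * Real.exp ((a ^ 2 - 2 * k + 1) / 2) := by ring
    _ = ρ * Real.exp (1 / 2 - k) := by
      rw [inv_pow_eq_of_root hd hh ha0 heq, mul_assoc, ← Real.exp_add]
      ring_nf

/-- Here c is the size of a δ-net. Up to constants, the defining equation turns δ^{-d} into
(h/(aδ))^d a e^{a²/2}, and the tail at a - k/a gives back e^{-a²/2}/a at the cost of e^k. The
hypothesis h/a² ≤ δ bounds h/(aδ) by a, so the term e^{-8a²} beats the number of cubes. -/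
theorem upper_scale_le (hd : 0 < d) (hh : 0 < h) (ha : 1 ≤ a) (hk : 0 ≤ k) (hka : 2 * k ≤ a)
    (hρ : 0 < ρ) (heq : ρ * (h ^ d)⁻¹ * a ^ (d - 1) * Real.exp (-a ^ 2 / 2) = 1)
    {c δ M ω b : ℝ} (hδ : h / a ^ 2 ≤ δ) (hω : 0 < ω)
    (hc0 : 0 ≤ c) (hc : c * ((δ / 2) ^ d * ω) ≤ M) :
    c * (2 ^ (d + 3) / (a - k / a) * Real.exp (-(a - k / a) ^ 2 / 2) * Real.exp (-b)
        + 2 * Real.exp (-(8 * a ^ 2)))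
      ≤ M * 2 ^ d / (ω * ρ) * (2 ^ (d + 4) * Real.exp k * ((h / (a * δ)) ^ d * Real.exp (-b))
        + 2 * (a ^ (d + 1) * Real.exp (-a ^ 2 / 2))) := by
  have ha0 : 0 < a := by linarith
  have hδ0 : 0 < δ := lt_of_lt_of_le (by positivity) hδ
  obtain ⟨h1, h2, h3, h4⟩ := sub_div_bounds ha hk hka
  have h0 : 0 < a - k / a := by linarith
  have hM : 0 ≤ M := le_trans (by positivity) hc
  have hroot := inv_pow_eq_of_root hd hh ha0 heq
  set B : ℝ := M * 2 ^ d / (ω * ρ) with hB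
  have hB0 : 0 ≤ B := by positivity
  set y : ℝ := h / (a * δ) with hy
  have hy0 : 0 < y := by positivity
  have hya : y ≤ a := by
    rw [hy, div_le_iff₀ (by positivity)]
    rw [div_le_iff₀ (by positivity)] at hδ
    linarith
  have hcB : c ≤ B * (a * Real.exp (a ^ 2 / 2)) * y ^ d := by
    have e : B * (a * Real.exp (a ^ 2 / 2)) * y ^ d = M / ((δ / 2) ^ d * ω) := by
      have h5 : h ^ d = ρ * Real.exp (-a ^ 2 / 2) * a ^ d / a := by
        rw [← hroot]
        field_simp
      rw [hy, div_pow, h5, hB, neg_div, Real.exp_neg, mul_pow, div_pow]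
      field_simp
    rw [e, le_div_iff₀ (by positivity)]
    exact hc
  have h5 : c * (2 ^ (d + 3) / (a - k / a) * Real.exp (-(a - k / a) ^ 2 / 2) * Real.exp (-b))
      ≤ B * (2 ^ (d + 4) * Real.exp k * (y ^ d * Real.exp (-b))) := by
    calc _ ≤ B * (a * Real.exp (a ^ 2 / 2)) * y ^ d *
          (2 ^ (d + 3) / (a / 2) * Real.exp (-(a ^ 2 - 2 * k) / 2) * Real.exp (-b)) := by
          gcongr
      _ = B * (2 ^ (d + 4) * (Real.exp (a ^ 2 / 2) * Real.exp (-(a ^ 2 - 2 * k) / 2)) *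
          (y ^ d * Real.exp (-b))) := by
          field_simp
          ring
      _ = _ := by
          rw [← Real.exp_add]
          ring_nf
  have h6 : c * (2 * Real.exp (-(8 * a ^ 2))) ≤ B * (2 * (a ^ (d + 1) * Real.exp (-a ^ 2 / 2))) := by
    calc _ ≤ B * (a * Real.exp (a ^ 2 / 2)) * a ^ d * (2 * Real.exp (-a ^ 2)) := by
          gcongr
          · exact hcB.trans (by gcongr)
          · nlinarith
      _ = B * (2 * (a ^ (d + 1) * (Real.exp (a ^ 2 / 2) * Real.exp (-a ^ 2)))) := by ring
      _ = _ := by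
          rw [← Real.exp_add]
          ring_nf
  rw [mul_add, mul_add]
  exact add_le_add h5 h6

theorem tendsto_pow_mul_exp_neg_sq (d : ℕ) {c : ℝ} (hc : 0 < c) :
    Tendsto (fun y : ℝ => y ^ d * Real.exp (-(c * y) ^ 2 / 16)) atTop (𝓝 0) := by
  have h1 : Tendsto (fun y : ℝ => c / Real.sqrt 8 * y) atTop atTop :=
    Tendsto.const_mul_atTop (by positivity) tendsto_id
  refine ((tendsto_pow_mul_exp_neg_sq_half ((Real.sqrt 8 / c) ^ d) d).comp h1).congr fun y => ?_
  have h8 : Real.sqrt 8 ^ 2 = 8 := Real.sq_sqrt (by norm_num)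
  have e1 : Real.sqrt 8 / c * (c / Real.sqrt 8 * y) = y := by field_simp
  have e2 : (c / Real.sqrt 8 * y) ^ 2 = (c * y) ^ 2 / 8 := by
    rw [mul_pow, div_pow, h8]
    ring
  simp only [Function.comp_apply]
  rw [← mul_pow, e1, e2]
  ring_nf

end Scales

/-! ### Oscillation near the maximum, with probability close to one. -/

section Oscillation

variable {Ω : Type*} [MeasurableSpace Ω] {d : ℕ} {D : KernelData Ω d} {P : Measure Ω}

theorem KernelConst.lowerConst_nonneg {K : ℝ → ℝ} (κ : KernelConst d K) (sl sh q : ℝ) :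
    0 ≤ κ.lowerConst sl sh q := by
  have hG : 0 ≤ gaussSum d (κ.sepConst sl sh q ^ 2 / 32) := tsum_nonneg fun k => by positivity
  have hω := unitBallVol_pos (d := d)
  unfold lowerConst
  positivity

set_option maxHeartbeats 1000000 in
/-- At the scale `δ = o(h / a)` the process does not move by more than a multiple of `1 / a` near
points where it is close to its maximum over `V`. -/
theorem DesignSetup.eventually_oscillation [IsProbabilityMeasure P] (T : DesignSetup P D)
    (hd : 0 < d) {V : Set (EuclideanSpace ℝ (Fin d))} (hVV : V ⊆ D.𝓥) (hV : 0 < volume V)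
    (hK : D.ConditionK1 P V) {δ : ℕ → ℝ} (hδ : ∀ᶠ n in atTop, D.h n / D.a n V ^ 2 ≤ δ n)
    (hδ0 : Tendsto (fun n => D.a n V * δ n / D.h n) atTop (𝓝 0)) {x : ℝ} (hx : 0 < x) {e : ℝ≥0∞}
    (he : 0 < e) :
    ∀ᶠ n in atTop, P {ω | ¬ ((∃ v ∈ V, 0 ≤ D.Z' n ω v) ∧
      ∀ v ∈ D.𝓥, D.Z' n ω v ≤ 4 * D.a n V + 2 * (x / (8 * D.a n V)) ∧
        ((∃ w ∈ V, D.Z' n ω v ≤ D.Z' n ω w) ∨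
          ∀ w ∈ D.𝓥, dist w v < δ n → D.Z' n ω v - D.Z' n ω w ≤ 3 * (x / (8 * D.a n V))))}
      ≤ e := by
  have hR := hK.regular
  have hlam : 0 < D.lam := lam_pos hR.kernel_ne_zero hR.kernel_compact hR.kernel_smooth hR.kernel_ac
  have hηpos := T.η_pos
  have hself : D.𝓥 ⊆ Metric.thickening (T.η / 4) D.𝓥 :=
    Metric.self_subset_thickening (by linarith) _
  have hVfin : volume V ≠ ∞ := ne_top_of_le_ne_top ENNReal.ofReal_ne_top
    ((measure_mono (hVV.trans (Metric.self_subset_thickening hηpos _))).trans T.volume_le)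
  obtain ⟨hainf, haeq⟩ := tendsto_a D hd hlam hV hVfin hR.bandwidth_pos hR.bandwidth_tendsto
  have hρ := rootConst_pos D hlam hV hVfin
  set ρ := rootConst D V with hρdef
  have hω := unitBallVol_pos (d := d)
  have hL := T.lip_pos
  have hd0 : (0 : ℝ) < d := by exact_mod_cast hd
  have he3 : 0 < e / 3 := ENNReal.div_pos he.ne' (by simp)
  have hsub : ∀ v ∈ D.𝓥, ∀ r, r ≤ T.η → Metric.ball v r ⊆ Metric.thickening T.η D.𝓥 :=
    fun v hv r hr y hy => Metric.mem_thickening_iff.2 ⟨v, hv, (Metric.mem_ball.1 hy).trans_le hr⟩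
  -- the constant in the lower bound
  obtain ⟨k, hk0, hk⟩ : ∃ k : ℝ, 0 ≤ k ∧ ENNReal.ofReal
      (T.κ.lowerConst T.sl T.sh T.q / volume.real V * (ρ * Real.exp (1 / 2 - k))) ≤ e / 3 := by
    have h1 : Tendsto (fun k : ℝ => T.κ.lowerConst T.sl T.sh T.q / volume.real V *
        (ρ * Real.exp (1 / 2 - k))) atTop (𝓝 0) := by
      have h2 : Tendsto (fun k : ℝ => 1 / 2 - k) atTop atBot := by
        simpa [sub_eq_add_neg] using tendsto_atBot_add_const_left atTop (1 / 2 : ℝ)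
          tendsto_neg_atTop_atBot
      simpa using ((Real.tendsto_exp_atBot.comp h2).const_mul ρ).const_mul
        (T.κ.lowerConst T.sl T.sh T.q / volume.real V)
    have h3 := ENNReal.tendsto_ofReal h1
    rw [ENNReal.ofReal_zero] at h3
    obtain ⟨k, h4, h5⟩ := ((h3.eventually (ge_mem_nhds he3)).and (eventually_ge_atTop 0)).exists
    exact ⟨k, h5, h4⟩
  -- the scale of the net
  set c : ℝ := x / (40 * d * T.lip) with hc
  have hc0 : 0 < c := by positivity
  have hηpos' : ∀ᶠ n in atTop, 0 < D.a n V * δ n / D.h n := by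
    filter_upwards [hδ, hainf.eventually_gt_atTop 0] with n h1 h2
    have hh := hR.bandwidth_pos n
    have : 0 < δ n := lt_of_lt_of_le (by positivity) h1
    positivity
  have hyinf : Tendsto (fun n => D.h n / (D.a n V * δ n)) atTop atTop := by
    refine (tendsto_inv_nhdsGT_zero.comp (tendsto_nhdsWithin_iff.2 ⟨hδ0, hηpos'⟩)).congr fun n => ?_
    simp
  have hδlim : Tendsto δ atTop (𝓝 0) := by
    have h1 : Tendsto (fun n => D.a n V * δ n / D.h n * (D.h n * (D.a n V)⁻¹)) atTop (𝓝 0) := by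
      simpa using hδ0.mul (hR.bandwidth_tendsto.mul hainf.inv_tendsto_atTop)
    refine h1.congr' ?_
    filter_upwards [hainf.eventually_gt_atTop 0] with n h2
    have hh := hR.bandwidth_pos n
    field_simp
  have hupper : Tendsto (fun n => ENNReal.ofReal (T.M * 2 ^ d / (unitBallVol d * ρ) *
      (2 ^ (d + 4) * Real.exp k * ((D.h n / (D.a n V * δ n)) ^ d *
        Real.exp (-(c * (D.h n / (D.a n V * δ n))) ^ 2 / 16))
      + 2 * (D.a n V ^ (d + 1) * Real.exp (-D.a n V ^ 2 / 2))))) atTop (𝓝 0) := by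
    have h1 := ((tendsto_pow_mul_exp_neg_sq d hc0).comp hyinf).const_mul (2 ^ (d + 4) * Real.exp k)
    have h2 := ((tendsto_pow_mul_exp_neg_sq_half 1 (d + 1)).comp hainf).const_mul 2
    have h3 := ENNReal.tendsto_ofReal ((h1.add h2).const_mul (T.M * 2 ^ d / (unitBallVol d * ρ)))
    simpa [Function.comp_def] using h3
  filter_upwards [T.good, T.tendsto_G.eventually (ge_mem_nhds he3), haeq, hδ,
    hainf.eventually_ge_atTop 2, hainf.eventually_ge_atTop (2 * k),
    hupper.eventually (ge_mem_nhds he3),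
    (hδlim.eventually_lt_const (show 0 < T.η / (12 * d) by positivity)),
    (hR.bandwidth_tendsto.eventually_lt_const hηpos),
    hyinf.eventually_ge_atTop (16 * (d + x + 1) / c), hyinf.eventually_ge_atTop (1 / c),
    hyinf.eventually_ge_atTop (30 * d * T.lip / x), hyinf.eventually_ge_atTop (30 * d * T.lip)]
    with n ⟨hn, hlo, hhi, hσ, hG⟩ hPG heq hδn ha2 hak hup hδη hhη hy1 hy2 hy3 hy4
  have hh := hR.bandwidth_pos n
  set a := D.a n V with hadef
  set y := D.h n / (a * δ n) with hydef
  have ha0 : 0 < a := by linarith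
  have hδpos : 0 < δ n := lt_of_lt_of_le (by positivity) hδn
  have hy0 : 0 < y := by positivity
  obtain ⟨hu1, hu2, hu3, hu4⟩ := sub_div_bounds (by linarith : 1 ≤ a) hk0 hak
  set u := a - k / a with hu
  set m := x / (8 * a) with hm
  have hm0 : 0 < m := by positivity
  have hδη' : d * (3 * δ n) < T.η / 4 := by
    rw [lt_div_iff₀ (by positivity)] at hδη
    linarith
  have hd1 : (1 : ℝ) ≤ d := by exact_mod_cast hd
  have hδη'' : δ n ≤ T.η := by nlinarith
  -- the finite sets
  obtain ⟨N₁, hN₁V, hN₁⟩ := exists_finset_forall_lt_le (n := n) hd T.κ hσ hh T.sl_pos T.sh_pos hlo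
    hhi T.q_pos (hVV.trans hself) hV ha0 (by linarith : 1 ≤ u) hu1
    (fun v hv => hsub v (hVV hv) (D.h n / a / 2) (by
      rw [div_div, div_le_iff₀ (by positivity)]
      nlinarith)) T.M_pos.le T.volume_le
  obtain ⟨N₂, hN₂V, -, hN₂net, hN₂card⟩ := exists_separatedBy_net D.𝓥 hδpos
    (fun v hv => hsub v hv (δ n / 2) (by linarith)) T.M_pos.le T.volume_le
  -- The ratio of m to the Lipschitz bound on a cube of side 5δ is a multiple of y = h/(aδ), which
  -- tends to infinity.
  have hεeq : m / (T.lip / D.h n * (d * (5 * δ n))) = c * y := by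
    rw [hm, hc, hydef]
    field_simp
    norm_num
  set X : Ω → Fin n → EuclideanSpace ℝ (Fin d) := fun ω i => D.X i ω with hX
  have hXm : Measurable X := measurable_pi_lambda _ fun i => hR.design_measurable i
  set B₁ : Set ((Fin n → EuclideanSpace ℝ (Fin d)) × EuclideanSpace ℝ (Fin n)) :=
    {p | ∀ v ∈ N₁, inner ℝ (avec D.K D.σ (D.h n) p.1 v) p.2 < u} with hB₁
  have hB₁m : MeasurableSet B₁ := by
    have e1 : B₁ = ⋂ v ∈ N₁, {p | inner ℝ (avec D.K D.σ (D.h n) p.1 v) p.2 < u} := by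
      ext p
      simp [hB₁]
    rw [e1]
    refine N₁.measurableSet_biInter fun v _ => measurableSet_lt (Measurable.inner ?_ measurable_snd)
      measurable_const
    exact (measurable_avec hR.kernel_smooth.continuous hR.sigma_measurable _ v).comp measurable_fst
  have hP1 : P {ω | X ω ∈ T.G n ∧ (X ω, D.U n ω) ∈ B₁} ≤ e / 3 := by
    refine (measure_mem_le_of_condDistrib hXm (hK.gauss_measurable n) (hK.gauss_law n)
      (T.measurable_G n) hB₁m fun p hp => ?_).trans hk
    rw [← ofReal_measureReal]
    refine ENNReal.ofReal_le_ofReal ((hN₁ p (hG p hp)).trans ?_)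
    exact mul_le_mul_of_nonneg_left (lower_scale_le hd hh (by linarith) hk0 hak heq)
      (div_nonneg (T.κ.lowerConst_nonneg _ _ _) measureReal_nonneg)
  have hP2 : P {ω | X ω ∈ T.G n ∧ (X ω, D.U n ω) ∈ oscEvent D.K D.σ (D.h n) N₂ (δ n) a u m} ≤ e / 3 := by
    refine (measure_mem_le_of_condDistrib hXm (hK.gauss_measurable n) (hK.gauss_law n)
      (T.measurable_G n) (measurableSet_oscEvent hR.kernel_smooth.continuous hR.sigma_measurable _ N₂
        (δ n) a u m) fun p hp => ?_).trans hup
    refine (stdGaussian_oscEvent_le (hG p hp) hσ hd hh T.sl_pos T.sh_pos hlo hhi T.q_pos (Y := x)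
      hδpos hm0 (fun v hv w hw => ?_) (by linarith) hu2 (le_of_eq ?_) ?_).trans
      (ENNReal.ofReal_le_ofReal ?_)
    · exact Metric.mem_thickening_iff.2 ⟨v, hN₂V hv, by
        rw [dist_eq_norm]
        exact hw.trans_lt hδη'⟩
    · rw [hm]
      field_simp
    · change _ ≤ (m / (T.lip / D.h n * (d * (5 * δ n)))) ^ 2
      rw [hεeq]
      rw [div_le_iff₀ hc0, mul_comm] at hy1 hy2
      calc 16 * (d + x + 1) ≤ c * y * 1 := by linarith
        _ ≤ c * y * (c * y) := by gcongr
        _ = (c * y) ^ 2 := by ring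
    · change _ * (_ * Real.exp (-(m / (T.lip / D.h n * (d * (5 * δ n)))) ^ 2 / 16) + _) ≤ _
      rw [hεeq, neg_div (16 : ℝ) ((c * y) ^ 2)]
      exact upper_scale_le hd hh (by linarith) hk0 hak hρ heq hδn hω (Nat.cast_nonneg _) hN₂card
  refine (measure_mono (t := {ω | X ω ∉ T.G n} ∪ ({ω | X ω ∈ T.G n ∧ (X ω, D.U n ω) ∈ B₁} ∪
    {ω | X ω ∈ T.G n ∧ (X ω, D.U n ω) ∈ oscEvent D.K D.σ (D.h n) N₂ (δ n) a u m}))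
    fun ω hω => ?_).trans ((measure_union_le _ _).trans ((add_le_add hPG ((measure_union_le _ _).trans
      (add_le_add hP1 hP2))).trans (le_of_eq ?_)))
  · by_contra hbad
    rw [mem_union, mem_union, not_or, not_or] at hbad
    obtain ⟨hb1, hb2, hb3⟩ := hbad
    have hXG : X ω ∈ T.G n := not_not.1 hb1
    have hb2' : (X ω, D.U n ω) ∉ B₁ := fun h => hb2 ⟨hXG, h⟩
    have hb3' : (X ω, D.U n ω) ∉ oscEvent D.K D.σ (D.h n) N₂ (δ n) a u m := fun h => hb3 ⟨hXG, h⟩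
    have hZ : ∀ v ∈ D.𝓥, D.Z' n ω v = inner ℝ (avec D.K D.σ (D.h n) (X ω) v) (D.U n ω) := by
      intro v hv
      rw [KernelData.Z', alpha_eq_avec hn hh ω (T.f_pos v (hself hv))]
    simp only [hB₁, mem_ofPred_eq, not_forall, not_lt] at hb2'
    obtain ⟨v₀, hv₀, hvu⟩ := hb2'
    have hv₀V : v₀ ∈ V := hN₁V hv₀
    rw [← hZ v₀ (hVV hv₀V)] at hvu
    apply hω
    constructor
    · exact ⟨v₀, hv₀V, le_trans (by linarith) hvu⟩
    · intro v hv
      have key := of_notMem_oscEvent (hG _ hXG) hσ hd hh T.sl_pos T.sh_pos hlo hhi T.q_pos hδpos hm0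
        (fun v hv w hw => Metric.mem_thickening_iff.2 ⟨v, hN₂V hv, by
          rw [dist_eq_norm]
          exact hw.trans_lt hδη'⟩) hN₂net (by
          change 4 * a * (T.lip / D.h n * (d * (5 * δ n))) ^ 2 ≤ m
          have e1 : T.lip / D.h n * (d * (5 * δ n)) = 5 * d * T.lip / (a * y) := by
            rw [hydef]
            field_simp
          rw [e1, hm, div_pow, mul_div_assoc', div_le_div_iff₀ (by positivity) (by positivity)]
          rw [div_le_iff₀ hx] at hy3
          have h7 : (30 * d * T.lip) * (30 * d * T.lip) ≤ (y * x) * y := by gcongr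
          calc 4 * a * (5 * d * T.lip) ^ 2 * (8 * a)
              = a ^ 2 * (30 * d * T.lip * (30 * d * T.lip)) * (8 / 9) := by ring
            _ ≤ a ^ 2 * (y * x * y) * 1 := by
              gcongr
              norm_num
            _ = x * (a * y) ^ 2 := by ring) hb3' hv
      rw [← hZ v hv] at key
      -- Either the value at v is below u, hence below the value at v₀ ∈ V, or the process moves by
      -- at most 3m within δ of v.
      rcases key with h1 | ⟨h1, h2⟩
      · exact ⟨by linarith, Or.inl ⟨v₀, hv₀V, h1.le.trans hvu⟩⟩
      · refine ⟨h2, Or.inr fun w hw hwv => ?_⟩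
        rw [hZ w hw]
        exact h1 w hwv
  · rw [← add_assoc, ENNReal.add_thirds]

end Oscillation

/-! ### Deterministic comparison of the two suprema. -/

section Supremum

variable {E : Type*} [PseudoMetricSpace E]

/-- A point of W is either dominated by a point of V, or has a point of V within δ at which Z is
lower by at most m. The bound b keeps the images bounded above, so that `sSup` is a true supremum.
-/
theorem csSup_image_superset_bounds {𝓥 V W : Set E} {Z : E → ℝ} {b δ m : ℝ} (hV : V ⊆ W)
    (hW : W ⊆ 𝓥) (hdist : Metric.hausdorffEDist W V < ENNReal.ofReal δ) (hm : 0 ≤ m)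
    (h0 : ∃ v ∈ V, 0 ≤ Z v)
    (hZ : ∀ v ∈ 𝓥, Z v ≤ b ∧ ((∃ w ∈ V, Z v ≤ Z w) ∨ ∀ w ∈ 𝓥, dist w v < δ → Z v - Z w ≤ m)) :
    sSup (Z '' V) ≤ sSup (Z '' W) ∧ sSup (Z '' W) ≤ sSup (Z '' V) + m ∧ 0 ≤ sSup (Z '' W) ∧
      sSup (Z '' W) ≤ b := by
  obtain ⟨v₀, hv₀, hz₀⟩ := h0
  have hbW : BddAbove (Z '' W) := ⟨b, by
    rintro _ ⟨v, hv, rfl⟩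
    exact (hZ v (hW hv)).1⟩
  have hbV : BddAbove (Z '' V) := hbW.mono (image_mono hV)
  have hneV : (Z '' V).Nonempty := ⟨_, v₀, hv₀, rfl⟩
  have hneW : (Z '' W).Nonempty := hneV.mono (image_mono hV)
  refine ⟨csSup_le_csSup hbW hneV (image_mono hV), csSup_le hneW ?_,
    hz₀.trans (le_csSup hbW ⟨v₀, hV hv₀, rfl⟩), csSup_le hneW ?_⟩
  · rintro _ ⟨v, hv, rfl⟩
    rcases (hZ v (hW hv)).2 with ⟨w, hw, hle⟩ | h
    · have := le_csSup hbV ⟨w, hw, rfl⟩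
      linarith
    · obtain ⟨w, hw, hvw⟩ := Metric.exists_edist_lt_of_hausdorffEDist_lt hv hdist
      rw [edist_comm, edist_lt_ofReal] at hvw
      have h1 := h w (hW (hV hw)) hvw
      have h2 := le_csSup hbV ⟨w, hw, rfl⟩
      linarith
  · rintro _ ⟨v, hv, rfl⟩
    exact (hZ v (hW hv)).1

/-- The difference equals (a' - a)S' + a(S' - S) - (a'² - a²). Since 0 ≤ S' ≤ 5a ≤ 5(a + a'), the
first term is at most 5|a'² - a²|, so only the squares of the constants need to be close. -/
theorem abs_recentred_sub_le {a a' S S' x : ℝ} (ha : 0 < a) (ha' : 0 ≤ a')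
    (hxa : x ≤ a ^ 2) (h1 : S ≤ S') (h2 : S' ≤ S + 3 * (x / (8 * a))) (h3 : 0 ≤ S')
    (h4 : S' ≤ 4 * a + 2 * (x / (8 * a))) :
    |a' * (S' - a') - a * (S - a)| ≤ 6 * |a' ^ 2 - a ^ 2| + 3 / 8 * x := by
  have e : a' * (S' - a') - a * (S - a) = (a' - a) * S' + a * (S' - S) - (a' ^ 2 - a ^ 2) := by ring
  have h5 : x / (8 * a) ≤ a / 8 := by
    rw [div_le_div_iff₀ (by positivity) (by norm_num)]
    nlinarith
  have h6 : |(a' - a) * S'| ≤ 5 * |a' ^ 2 - a ^ 2| := by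
    have e2 : a' ^ 2 - a ^ 2 = (a' - a) * (a' + a) := by ring
    rw [e2, abs_mul, abs_mul, abs_of_nonneg h3, abs_of_nonneg (by positivity : 0 ≤ a' + a)]
    have h7 : S' ≤ 5 * (a' + a) := by linarith
    nlinarith [abs_nonneg (a' - a)]
  have h8 : |a * (S' - S)| ≤ 3 / 8 * x := by
    rw [abs_of_nonneg (mul_nonneg ha.le (by linarith))]
    calc a * (S' - S) ≤ a * (3 * (x / (8 * a))) := by gcongr; linarith
      _ = 3 / 8 * x := by field_simp
  rw [e]
  have h9 := abs_sub ((a' - a) * S' + a * (S' - S)) (a' ^ 2 - a ^ 2)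
  have h10 := abs_add_le ((a' - a) * S') (a * (S' - S))
  linarith

end Supremum

/-! ### Assembly of Condition N.2. -/

section Insensitivity

variable {Ω : Type*} [MeasurableSpace Ω] {P : Measure Ω} [IsProbabilityMeasure P] {d : ℕ}
  {D : KernelData Ω d} {V : Set (EuclideanSpace ℝ (Fin d))}

theorem DesignSetup.conditionN2 (T : DesignSetup P D) (hd : 0 < d) (hVV : V ⊆ D.𝓥)
    (hV : 0 < volume V) (hK : D.ConditionK1 P V)
    {Vhat : ℕ → Ω → Set (EuclideanSpace ℝ (Fin d))} {r : ℕ → ℝ}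
    (ha : TendstoInMeasure P (fun n ω => D.a n (Vhat n ω) ^ 2 - D.a n V ^ 2) atTop fun _ => 0)
    (hr : TendsToZeroInProb P
      fun n ω => ENNReal.ofReal (D.a n V * r n) * D.supGradNorm n ω) :
    D.ConditionN2 P V Vhat r (fun n => D.a n V) (fun n => D.a n V)
      (fun n ω => D.a n (Vhat n ω)) (fun n ω => D.a n (Vhat n ω)) := by
  intro hsup
  have hR := hK.regular
  have hlam : 0 < D.lam := lam_pos hR.kernel_ne_zero hR.kernel_compact hR.kernel_smooth hR.kernel_ac
  have hanonneg := fun n W => a_nonneg D hlam.le n (hR.bandwidth_pos n) W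
  have hVfin : volume V ≠ ∞ := ne_top_of_le_ne_top ENNReal.ofReal_ne_top
    ((measure_mono (hVV.trans (Metric.self_subset_thickening T.η_pos _))).trans T.volume_le)
  have hainf := (tendsto_a D hd hlam hV hVfin hR.bandwidth_pos hR.bandwidth_tendsto).1
  have hne : D.𝓥.Nonempty := (nonempty_of_measure_ne_zero hV.ne').mono hVV
  have hrate := T.tendsto_of_supGradNorm hd hR hne
    (fun n => mul_nonneg (hanonneg n V) (hsup.rate_nonneg n)) hr
  rw [tendstoInMeasure_iff_norm] at ha ⊢
  intro ε hε
  rw [ENNReal.tendsto_nhds_zero]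
  intro e he
  have he4 : 0 < e / 4 := ENNReal.div_pos he.ne' (by simp)
  obtain ⟨M, hM⟩ := hsup.rate (e / 4) he4
  -- The first term dominates the Hausdorff distance with high probability. The second makes δ
  -- positive even if r_n = 0, keeps the number of cubes under control, and adds only 1/a to aδ/h.
  set δ : ℕ → ℝ := fun n => M * r n + D.h n / D.a n V ^ 2 with hδ
  have hδ0 : Tendsto (fun n => D.a n V * δ n / D.h n) atTop (𝓝 0) := by
    have h1 : Tendsto (fun n => M * (D.a n V * r n / D.h n) + (D.a n V)⁻¹) atTop (𝓝 0) := by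
      simpa using (hrate.const_mul (M : ℝ)).add hainf.inv_tendsto_atTop
    refine h1.congr' ?_
    filter_upwards [hainf.eventually_gt_atTop 0] with n hn
    have hh := hR.bandwidth_pos n
    rw [hδ]
    field_simp
  have hosc := T.eventually_oscillation hd hVV hV hK (δ := δ) (Eventually.of_forall fun n => by
    have := mul_nonneg M.coe_nonneg (hsup.rate_nonneg n)
    simp only [hδ]
    linarith) hδ0 hε he4
  filter_upwards [hosc, hM, hsup.contains.eventually (ge_mem_nhds he4),
    (ha (ε / 16) (by positivity)).eventually (ge_mem_nhds he4), hainf.eventually_gt_atTop 0,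
    hainf.eventually_ge_atTop 1, hainf.eventually_ge_atTop ε] with n h1 h2 h3 h4 ha0 ha1 haε
  have hh := hR.bandwidth_pos n
  refine (measure_mono fun ω hω => ?_).trans ((measure_union_le _ _).trans
    ((add_le_add ((measure_union_le _ _).trans (add_le_add h1 h2))
      ((measure_union_le _ _).trans (add_le_add h3 h4))).trans (le_of_eq ?_)))
  · by_contra hbad
    simp only [mem_union, mem_ofPred_eq, not_or, not_not, not_lt, not_le, sub_zero,
      Real.norm_eq_abs] at hbad hω
    obtain ⟨⟨⟨b1, b1'⟩, b2⟩, b3, b4⟩ := hbad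
    have hdist : Metric.hausdorffEDist (Vhat n ω) V < ENNReal.ofReal (δ n) := by
      refine b2.trans_lt ?_
      rw [← ENNReal.ofReal_coe_nnreal, ← ENNReal.ofReal_mul M.coe_nonneg]
      have h5 := mul_nonneg M.coe_nonneg (hsup.rate_nonneg n)
      have h6 : 0 < D.h n / D.a n V ^ 2 := by positivity
      rw [ENNReal.ofReal_lt_ofReal_iff] <;> simp only [hδ] <;> linarith
    obtain ⟨c1, c2, c3, c4⟩ := csSup_image_superset_bounds b3 (hsup.subset n ω) hdist
      (by positivity) b1 b1'
    -- The total is at most 6·ε/16 + 3ε/8 = 3ε/4, below ε.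
    have key := abs_recentred_sub_le ha0 (hanonneg n (Vhat n ω)) (by nlinarith) c1 c2 c3 c4
    linarith
  · calc e / 4 + e / 4 + (e / 4 + e / 4) = e / 4 * 4 := by ring
      _ = e := ENNReal.div_mul_cancel (by simp) (by simp)

end Insensitivity

end KernelBounds

theorem mainTheorem9 {Ω : Type*} [MeasurableSpace Ω] (P : Measure Ω) [IsProbabilityMeasure P]
    {d : ℕ} (hd : 0 < d) (D : KernelBounds.KernelData Ω d)
    (V : Set (EuclideanSpace ℝ (Fin d)))
    (hV : V ⊆ D.𝓥) (hV₀ : KernelBounds.argminSet D.𝓥 D.θ ⊆ V)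
    (hmes : 0 < volume V)
    (hK : D.ConditionK P V) :
    (∀ (Vhat : ℕ → Ω → Set (EuclideanSpace ℝ (Fin d))) (r : ℕ → ℝ),
      TendstoInMeasure P (fun n ω => D.a n (Vhat n ω) ^ 2 - D.a n V ^ 2) atTop (fun _ => 0) →
      KernelBounds.TendsToZeroInProb P
        (fun n ω => ENNReal.ofReal (D.a n V * r n) * D.supGradNorm n ω) →
      D.ConditionN2 P V Vhat r (fun n => D.a n V) (fun n => D.a n V)
        (fun n ω => D.a n (Vhat n ω)) (fun n ω => D.a n (Vhat n ω))) ∧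
    KernelBounds.IsBigOInProb P D.supGradNorm (fun n => (D.h n)⁻¹) := by
  obtain ⟨T⟩ := KernelBounds.nonempty_designSetup hd hK.k1.regular
  exact ⟨fun _ _ ha hr => T.conditionN2 hd hV hmes hK.k1 ha hr,
    T.isBigOInProb_supGradNorm hd hK.k1.regular⟩
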